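/- Let $\mathcal X,\mathcal Y$ be finite alphabets, $W(y|x)$ a memoryless channel from $\mathcal X$ to $\mathcal Y$ (logarithms are natural, $[t]_+=\max\{t,0\}$, $\log 0=-\infty$, $0\log 0=0$), let $P_X$ be a distribution on $\mathcal X$ whose type class $\mathcal T_{P_X}\subseteq\mathcal X^n$ (words with empirical distribution $P_X$) is non-empty for some $n\ge 1$, and let $R>0$. For each such $n$ draw $M=\lceil e^{nR}\rceil$ codewords $\mathbf x_1,\dots,\mathbf x_M$ independently and uniformly from $\mathcal T_{P_X}$. Write $\hat Q_{\mathbf x\mathbf y}$ for the joint empirical distribution of $\mathbf x,\mathbf y$, and $f(Q)=\sum_{x,y}Q(x,y)\log W(y|x)$. A threshold function is a map $h$ from the joint distributions on $\mathcal X\times\mathcal Y$ to $(-\infty,\infty]$ that is real-valued and continuous on some compact set $\mathcal G$ and equals $+\infty$ off $\mathcal G$. The class $\Psi$ consists of the erasure/list decoders $\phi_h$ that put codeword $m$ on the list when the output $\mathbf y$ satisfies $f(\hat Q_{\mathbf x_m\mathbf y})\ge\max_{l\ne m}h(\hat Q_{\mathbf x_l\mathbf y})$. Let $E_e(R,h)$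 and $E_l(R,h)$ be the limits inferior, over the $n$ for which $\mathcal T_{P_X}$ is non-empty, of $-\frac1n\log$ of the ensemble average of, respectively, the average probability that the transmitted codeword is not on the list, and the average number of erroneous codewords on the list. A threshold function $h^*$ is optimal for a requirement $E$ if $\phi_{h^*}\in\Psi$, $E_e(R,h^*)\ge E$, and $E_l(R,h)\le E_l(R,h^*)$ for every $\phi_h\in\Psi$ with $E_e(R,h)\ge E$. Below, $Q,\tilde Q,Q'$ range over joint distributions with $\mathcal X$-marginal $P_X$; $Q_Y$ is the $\mathcal Y$-marginal, $I(Q)$ the mutual information and $D(Q_{Y|X}\|W|P_X)$ the conditional divergence averaged over $P_X$; minima over the empty set are $+\infty$. Put $$g^*(Q_Y,E)=\min\{f(Q'):Q'_Y=Q_Y,\ D(Q'_{Y|X}\|W|P_X)\le E\},$$ $$\mathcal D^*(\tilde Q,R,E)=\{Q:Q_Y=\tilde Q_Y,\ f(Q)\ge g^*(Q_Y,E-[I(\tilde Q)-R]_+)\},$$ $$E_{\rm c}=\min\{D(Q'_{Y|X}\|W|P_X)+[I(Q)-R]_+:\ Q'_Y=Q_Y,\ D(Q_{Y|X}\|W|P_X)<\infty\}.$$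 Let $E$ be a real number such that $E>0$ and all entries of $W$ are positive (then $E_{\rm c}=0$) or, more generally, such that $E\ne E_{\rm c}$. Then: 1. The threshold function $$h^*(Q,R,E)=g^*(Q_Y,E-[I(Q)-R]_+)$$ (for every joint distribution $Q$ on $\mathcal X\times\mathcal Y$) is optimal for the requirement $E$. 2. The resulting maximal list-size exponent is $$E_l(R,h^*)=\min_{\tilde Q}\ \min_{Q\in\mathcal D^*(\tilde Q,R,E)}\{D(\tilde Q_{Y|X}\|W|P_X)+I(Q)-R\},$$ and the minimum is attained if some $\mathcal D^*(\tilde Q,R,E)$ is non-empty. 3. The formula in 2 remains true, with an infimum in place of the minimum, if $\ge$ is replaced by $>$ in the definition of $\mathcal D^*$, provided that the set so obtained is non-empty for some $\tilde Q$ with $D(\tilde Q_{Y|X}\|W|P_X)<\infty$. -/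

import Mathlib

open Filter

namespace ThresholdDecoding

noncomputable section

open Classical in
/-- The empirical distribution of a word: the relative frequency of every letter. -/
def empirical {A : Type*} {n : ℕ} (w : Fin n → A) (a : A) : ℝ :=
  ((Finset.univ.filter (fun i => w i = a)).card : ℝ) / (n : ℝ)

/-- The joint empirical distribution of a pair of words. -/
def jointEmpirical {X Y : Type*} {n : ℕ} (x : Fin n → X) (y : Fin n → Y) : X × Y → ℝ :=
  empirical (fun i => (x i, y i))

open Classical in
/-- The type class of `P` at block length `n`. -/
def typeClass {X : Type*} [Fintype X] (P : X → ℝ) (n : ℕ) : Finset (Fin n → X) :=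
  Finset.univ.filter (fun x => empirical x = P)

section Information

variable {X Y : Type*} [Fintype X] [Fintype Y]

/-- The `X`-marginal. -/
def margX (Q : X × Y → ℝ) (x : X) : ℝ := ∑ y, Q (x, y)

/-- The `Y`-marginal. -/
def margY (Q : X × Y → ℝ) (y : Y) : ℝ := ∑ x, Q (x, y)

/-- The conditional distribution of `Y` given `X`. -/
def condYX (Q : X × Y → ℝ) (x : X) (y : Y) : ℝ := Q (x, y) / margX Q x

/-- The joint distributions with `X`-marginal `P`. -/
def jointDist (P : X → ℝ) : Set (X × Y → ℝ) :=
  {Q | Q ∈ stdSimplex ℝ (X × Y) ∧ margX Q = P}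

/-- Mutual information (natural logarithm, `0 log 0 = 0`). -/
def mutualInfo (Q : X × Y → ℝ) : ℝ :=
  ∑ x, ∑ y, Q (x, y) * Real.log (Q (x, y) / (margX Q x * margY Q y))

open Classical in
/-- The conditional divergence of `V` from `W`, averaged over `P`; it is `+∞` if, for some `x` of
positive probability, `V x` is not absolutely continuous with respect to `W x`. -/
def condDiv (V W : X → Y → ℝ) (P : X → ℝ) : EReal :=
  if ∀ x y, P x ≠ 0 → W x y = 0 → V x y = 0 then
    ((∑ x, P x * ∑ y, V x y * Real.log (V x y / W x y) : ℝ) : EReal)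
  else ⊤

open Classical in
/-- The normalized log-likelihood, the sum of `Q (x, y) log W (y | x)`, with `log 0 = -∞` and
`0 · (-∞) = 0`. -/
def logLik (W : X → Y → ℝ) (Q : X × Y → ℝ) : EReal :=
  if ∀ x y, W x y = 0 → Q (x, y) = 0 then
    ((∑ x, ∑ y, Q (x, y) * Real.log (W x y) : ℝ) : EReal)
  else ⊥

end Information

section Coding

variable {X Y : Type*} [Fintype X] [Fintype Y]

/-- The memoryless channel: probability of the output word `y` given the input word `x`. -/
def channelProb (W : X → Y → ℝ) {n : ℕ} (x : Fin n → X) (y : Fin n → Y) : ℝ :=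
  ∏ i, W (x i) (y i)

open Classical in
/-- The average error probability of the codebook `c` with decoding regions `D`: the transmitted
codeword is not on the list. -/
def errorProb (W : X → Y → ℝ) {n M : ℕ} (c : Fin M → Fin n → X)
    (D : Fin M → Set (Fin n → Y)) : ℝ :=
  1 / (M : ℝ) * ∑ m, ∑ y, if y ∈ D m then 0 else channelProb W (c m) y

open Classical in
/-- The average number of erroneous codewords on the list. -/
def listSize (W : X → Y → ℝ) {n M : ℕ} (c : Fin M → Fin n → X)
    (D : Fin M → Set (Fin n → Y)) : ℝ :=
  ∑ y, 1 / (M : ℝ) * ∑ m, channelProb W (c m) y *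
    ∑ l, if l ≠ m ∧ y ∈ D l then (1 : ℝ) else 0

/-- The decoding regions of the decoder with threshold function `h`: the codeword `m` is on the
list if its normalized log-likelihood is at least the maximum, over all competing codewords `l`, of
`h` at the joint empirical distribution of codeword `l` and the output. -/
def thresholdRegion (W : X → Y → ℝ) (h : (X × Y → ℝ) → EReal) {n M : ℕ}
    (c : Fin M → Fin n → X) (m : Fin M) : Set (Fin n → Y) :=
  {y | ∀ l, l ≠ m → h (jointEmpirical (c l) y) ≤ logLik W (jointEmpirical (c m) y)}

/-- The number of codewords at rate `R` and block length `n`. -/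
def numCodewords (R : ℝ) (n : ℕ) : ℕ := ⌈Real.exp (n * R)⌉₊

/-- The average over the fixed-composition ensemble: the `M` codewords are drawn independently,
each of them uniformly from the type class of `P`. -/
def ensembleAvg (P : X → ℝ) (n M : ℕ) (F : (Fin M → Fin n → X) → ℝ) : ℝ :=
  (∑ c ∈ Fintype.piFinset (fun _ : Fin M => typeClass P n), F c) /
    ((typeClass P n).card : ℝ) ^ M

/-- The exponent `liminf -(1/n) log a n`, with `log 0 = -∞`, along the block lengths `n` at which
the type class of `P` is not empty. -/
def exponent (P : X → ℝ) (a : ℕ → ℝ) : EReal :=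
  liminf (fun n : ℕ => ((-(1 / (n : ℝ)) : ℝ) : EReal) * ENNReal.log (ENNReal.ofReal (a n)))
    (atTop ⊓ 𝓟 {n : ℕ | 0 < n ∧ (typeClass P n).Nonempty})

/-- The random coding error exponent of the decoder with threshold function `h`. -/
def errorExponent (W : X → Y → ℝ) (P : X → ℝ) (R : ℝ) (h : (X × Y → ℝ) → EReal) : EReal :=
  exponent P (fun n => ensembleAvg P n (numCodewords R n)
    (fun c => errorProb W c (thresholdRegion W h c)))

/-- The random coding list size exponent of the decoder with threshold function `h`. -/
def listExponent (W : X → Y → ℝ) (P : X → ℝ) (R : ℝ) (h : (X × Y → ℝ) → EReal) : EReal :=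
  exponent P (fun n => ensembleAvg P n (numCodewords R n)
    (fun c => listSize W c (thresholdRegion W h c)))

/-- The class of threshold functions: real-valued and continuous on some compact set `G` of joint
distributions, and `+∞` at all other joint distributions. -/
def IsThresholdFunction (h : (X × Y → ℝ) → EReal) : Prop :=
  ∃ G ⊆ stdSimplex ℝ (X × Y), IsCompact G ∧
    (∃ k : (X × Y → ℝ) → ℝ, ContinuousOn k G ∧ ∀ Q ∈ G, h Q = ((k Q : ℝ) : EReal)) ∧
    ∀ Q ∈ stdSimplex ℝ (X × Y), Q ∉ G → h Q = ⊤

/-- `h` is an optimal threshold function at rate `R` for the required error exponent `E`. -/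
def IsOptimalThreshold (W : X → Y → ℝ) (P : X → ℝ) (R E : ℝ) (h : (X × Y → ℝ) → EReal) : Prop :=
  IsThresholdFunction h ∧ (E : EReal) ≤ errorExponent W P R h ∧
    ∀ k : (X × Y → ℝ) → EReal, IsThresholdFunction k → (E : EReal) ≤ errorExponent W P R k →
      listExponent W P R k ≤ listExponent W P R h

/-- `g*(q, E)`: the minimum of the log-likelihood over all joint distributions with marginals `P`
and `q` whose conditional divergence from the channel is at most `E`; `+∞` if there is none. -/
def gStar (W : X → Y → ℝ) (P : X → ℝ) (q : Y → ℝ) (E : ℝ) : EReal :=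
  ⨅ Q ∈ {Q : X × Y → ℝ | Q ∈ jointDist P ∧ margY Q = q ∧ condDiv (condYX Q) W P ≤ (E : EReal)},
    logLik W Q

/-- `h*(Q, R, E) = g*(Q_Y, E - [I(Q) - R]_+)`. -/
def hStar (W : X → Y → ℝ) (P : X → ℝ) (R E : ℝ) (Q : X × Y → ℝ) : EReal :=
  gStar W P (margY Q) (E - max (mutualInfo Q - R) 0)

/-- The constraint set of the optimal list size exponent, given the joint distribution `Qt` of the
transmitted codeword and the output. -/
def DStar (W : X → Y → ℝ) (P : X → ℝ) (R E : ℝ) (Qt : X × Y → ℝ) : Set (X × Y → ℝ) :=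
  {Q | Q ∈ jointDist P ∧ margY Q = margY Qt ∧
    gStar W P (margY Q) (E - max (mutualInfo Qt - R) 0) ≤ logLik W Q}

/-- The same constraint set with a strict inequality. -/
def DStarStrict (W : X → Y → ℝ) (P : X → ℝ) (R E : ℝ) (Qt : X × Y → ℝ) : Set (X × Y → ℝ) :=
  {Q | Q ∈ jointDist P ∧ margY Q = margY Qt ∧
    gStar W P (margY Q) (E - max (mutualInfo Qt - R) 0) < logLik W Q}

/-- The objective function `D(Qt_{Y|X} ‖ W | P) + I(Q) - R`. -/
def listObjective (W : X → Y → ℝ) (P : X → ℝ) (R : ℝ) (Qt Q : X × Y → ℝ) : EReal :=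
  condDiv (condYX Qt) W P + ((mutualInfo Q - R : ℝ) : EReal)

/-- The smallest required exponent at which `h*` is finite at some joint distribution that the
channel can produce: the minimum of `D(Q'_{Y|X} ‖ W | P) + [I(Q) - R]_+` over all `Q`, `Q'` with
the same `Y`-marginal, where `Q` has finite conditional divergence. It is `0` if `W` has no zero
entry. -/
def criticalExponent (W : X → Y → ℝ) (P : X → ℝ) (R : ℝ) : EReal :=
  ⨅ Q ∈ {Q : X × Y → ℝ | Q ∈ jointDist P ∧ condDiv (condYX Q) W P < ⊤},
    ⨅ Q' ∈ {Q' : X × Y → ℝ | Q' ∈ jointDist P ∧ margY Q' = margY Q},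
      condDiv (condYX Q') W P + ((max (mutualInfo Q - R) 0 : ℝ) : EReal)

end Coding

end

end ThresholdDecoding

/-!
The proof is by the method of types. Up to factors polynomial in the block length `n`, a type class
of type `Q` has `e ^ (n H(Q))` elements (`card_typeClass_le`, `exp_entropy_le_card_typeClass`), so a
random codeword of type `P` has joint type `Q` with a given output of type `Q_Y` with probability
`e ^ (-n I(Q))` (`typeProb_le`, `le_typeProb`), and the transmitted codeword and the output have
joint type `Q` with probability `e ^ (-n D(Q_{Y|X} ‖ W | P))` (`sum_transProb_le`,
`le_sum_transProb`). There are only polynomially many joint types.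

Achievability is a union bound. The decoder with an arbitrary threshold `h` errs only if the
transmitted joint type `Q'` and that of some other codeword, `Q`, satisfy `f(Q') < h(Q)`, which
costs `D(Q') + [I(Q) - R]_+` (`le_errorExponent`); for `h = h*`, this exceeds `E` by the definition
of `g*`. In the same way an erroneous codeword of joint type `Q` is on the list only if
`h*(Q̃) ≤ f(Q)` for the joint type `Q̃` of the transmitted one, that is `Q ∈ D*(Q̃)`, and this costs
`D(Q̃) + I(Q) - R` (`le_listExponent`).

For the converse, the exponents are limits inferior, so that it suffices to study block lengths at
which given *rational* joint distributions are types. If `k` meets the requirement `E`, then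
`k(Q) ≤ f(Q')` for all rational `Q`, `Q'` with the same `Y`-marginal and
`D(Q') + [I(Q) - R]_+ < E`, since otherwise the pair would produce too many errors
(`errorExponent_le`, `threshold_le_logLik`). Membership of `Q` in `D*(Q̃)` means that there is a
`Q'` with `f(Q') ≤ f(Q)` and `D(Q') + [I(Q̃) - R]_+ ≤ E` (`IsListTriple`). If such a triple is
rational and the last inequality is strict, then `k(Q̃) ≤ f(Q)`, and also `k(Q'') ≤ f(Q)` for all
joint types with `I(Q'')` slightly above `R`; codewords of the remaining joint types are too rare to
matter, so the decoder with threshold `k` lists codewords of joint type `Q` with `y` almost always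
when `Q̃` occurs, and its list size exponent is at most `D(Q̃) + I(Q) - R` (`listExponent_le`).

The general triple is reached by approximation. As `E ≠ E_c`, mixing with a triple that has slack
makes the divergence inequality strict; here `D` and, for a fixed `X`-marginal, `I` are convex
(`realDiv_add_max_le`). Rational approximation, by `ℚ`-linear maps `ℝ → ℚ` close to the identity,
preserves the supports and the linear constraints (`exists_rational_approx`). It preserves
`f(Q') ≤ f(Q)` if the inequality is strict or if `f` is constant on all admissible distributions
with the same `Y`-marginal, and otherwise `Q` or `Q'` can be moved slightly to make the inequality
strict (`listExponent_le_of_stable`, `listExponent_le_of_lt`).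

The minimum is attained because the triples form a compact set, and the strict constraint set gives
the same infimum because a mixture of a triple with a strict triple is strict. Finally, `h*` is
continuous where it is finite: limits of minimizers are minimizers, by the strict convexity of `D`
(`realLogLik_le_of_tendsto`).
-/

namespace ThresholdDecoding

noncomputable section

set_option linter.unusedSectionVars false

/-! ### Entropy and factorial bounds -/

/-- The Shannon entropy `-∑ p log p` (natural logarithm) of a weight function on a finite
alphabet. -/
def entropy {A : Type*} [Fintype A] (p : A → ℝ) : ℝ := ∑ a, Real.negMulLog (p a)

/-- The polynomial factor `e (n + 1) ^ 2` that absorbs the error of the crude Stirling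
approximation `n ! ≈ (n / e) ^ n`. The exponent `2` is what the induction for the upper bound
needs. -/
def polyFactor (n : ℕ) : ℝ := Real.exp 1 * ((n : ℝ) + 1) ^ 2

lemma one_le_polyFactor (n : ℕ) : 1 ≤ polyFactor n := by
  have h1 : (1 : ℝ) ≤ Real.exp 1 := Real.one_le_exp (by norm_num)
  have h2 : (1 : ℝ) ≤ ((n : ℝ) + 1) ^ 2 := one_le_pow₀ (by linarith [n.cast_nonneg (α := ℝ)])
  calc (1 : ℝ) = 1 * 1 := by ring
    _ ≤ _ := mul_le_mul h1 h2 (by norm_num) (by linarith)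

lemma polyFactor_pos (n : ℕ) : 0 < polyFactor n := by
  linarith [one_le_polyFactor n]

lemma log_polyFactor (n : ℕ) : Real.log (polyFactor n) = 1 + 2 * Real.log ((n : ℝ) + 1) := by
  have : (0 : ℝ) < (n : ℝ) + 1 := by positivity
  rw [polyFactor, Real.log_mul (by positivity) (by positivity), Real.log_exp, Real.log_pow]
  norm_num

lemma log_polyFactor_mono {m n : ℕ} (h : m ≤ n) :
    Real.log (polyFactor m) ≤ Real.log (polyFactor n) := by
  have h' : (m : ℝ) ≤ n := by exact_mod_cast h
  have := Real.log_le_log (by positivity : (0 : ℝ) < (m : ℝ) + 1)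
    (by linarith : (m : ℝ) + 1 ≤ n + 1)
  rw [log_polyFactor, log_polyFactor]
  linarith

lemma le_log_factorial (n : ℕ) : n * Real.log n - n ≤ Real.log (n.factorial : ℝ) := by
  induction n with
  | zero => simp
  | succ n ih =>
    rw [Nat.factorial_succ]
    push_cast
    rw [Real.log_mul (by positivity) (by positivity)]
    rcases Nat.eq_zero_or_pos n with rfl | hn
    · simp
    have hn' : (0 : ℝ) < n := by exact_mod_cast hn
    have h := Real.log_le_sub_one_of_pos (x := ((n : ℝ) + 1) / n) (by positivity)
    rw [Real.log_div (by positivity) (by positivity)] at h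
    have h2 : (n : ℝ) * (((n : ℝ) + 1) / n - 1) = 1 := by field_simp; ring
    nlinarith

lemma log_factorial_le (n : ℕ) :
    Real.log (n.factorial : ℝ) ≤ n * Real.log n - n + Real.log (polyFactor n) := by
  rw [log_polyFactor]
  induction n with
  | zero => simp
  | succ n ih =>
    rw [Nat.factorial_succ]
    push_cast
    rw [Real.log_mul (by positivity) (by positivity)]
    have h2 := Real.log_le_sub_one_of_pos (x := ((n : ℝ) + 1) / (n + 1 + 1)) (by positivity)
    rw [Real.log_div (by positivity) (by positivity)] at h2
    have e2 : ((n : ℝ) + 1) / (n + 1 + 1) - 1 = - (1 / (n + 2)) := by field_simp; ring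
    rw [e2] at h2
    have h1 : (n : ℝ) * (Real.log n - Real.log (n + 1)) ≤ - (n / (n + 1)) := by
      rcases Nat.eq_zero_or_pos n with rfl | hn
      · simp
      have hn' : (0 : ℝ) < n := by exact_mod_cast hn
      have h := Real.log_le_sub_one_of_pos (x := (n : ℝ) / (n + 1)) (by positivity)
      rw [Real.log_div (by positivity) (by positivity)] at h
      have e : (n : ℝ) * ((n : ℝ) / (n + 1) - 1) = - (n / (n + 1)) := by field_simp; ring
      rw [← e]
      exact mul_le_mul_of_nonneg_left h hn'.le
    have h3 : 1 ≤ (n : ℝ) / (n + 1) + 2 * (1 / (n + 2)) := by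
      rw [← sub_nonneg]
      have : (n : ℝ) / (n + 1) + 2 * (1 / (n + 2)) - 1 = n / ((n + 1) * (n + 2)) := by
        field_simp; ring
      rw [this]; positivity
    linarith

open Classical in
/-- The number of occurrences of the letter `a` in the word `w`. -/
def letterCount {A : Type*} {n : ℕ} (w : Fin n → A) (a : A) : ℕ :=
  (Finset.univ.filter (fun i => w i = a)).card

/-! ### Sizes of type classes -/

section TypeClass

variable {A : Type*} {n : ℕ}

lemma empirical_apply (w : Fin n → A) (a : A) : empirical w a = letterCount w a / n := rfl

lemma empirical_nonneg (w : Fin n → A) (a : A) : 0 ≤ empirical w a := by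
  rw [empirical_apply]; positivity

lemma letterCount_le (w : Fin n → A) (a : A) : letterCount w a ≤ n := by
  classical
  simpa [letterCount] using Finset.card_filter_le (Finset.univ : Finset (Fin n)) (fun i => w i = a)

lemma sum_letterCount [Fintype A] (w : Fin n → A) : ∑ a, letterCount w a = n := by
  classical
  have := Finset.card_eq_sum_card_fiberwise (f := w) (s := Finset.univ) (t := Finset.univ)
    (fun _ _ => Finset.mem_univ _)
  simp only [Finset.card_univ, Fintype.card_fin] at this
  exact this.symm

lemma letterCount_eq_of_empirical_eq {w w' : Fin n → A} (h : empirical w = empirical w') (a : A) :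
    letterCount w a = letterCount w' a := by
  rcases Nat.eq_zero_or_pos n with rfl | hn
  · simp [letterCount]
  have := congrFun h a
  rw [empirical_apply, empirical_apply, div_left_inj' (by positivity)] at this
  exact_mod_cast this

/-- Words with the same empirical distribution are rearrangements of each other. -/
lemma exists_perm_of_empirical_eq {w w' : Fin n → A} (h : empirical w = empirical w') :
    ∃ σ : Equiv.Perm (Fin n), w ∘ σ = w' := by
  classical
  have hc : ∀ a, Nonempty ({i // w' i = a} ≃ {i // w i = a}) := fun a => by
    refine ⟨Fintype.equivOfCardEq ?_⟩
    have := letterCount_eq_of_empirical_eq h a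
    rw [Fintype.card_subtype, Fintype.card_subtype]
    exact this.symm
  let e := fun a => (hc a).some
  refine ⟨(Equiv.sigmaFiberEquiv w').symm.trans
    ((Equiv.sigmaCongrRight e).trans (Equiv.sigmaFiberEquiv w)), ?_⟩
  funext i
  simpa using! (e (w' i) ⟨i, rfl⟩).2

lemma empirical_comp_perm (w : Fin n → A) (σ : Equiv.Perm (Fin n)) :
    empirical (w ∘ σ) = empirical w := by
  classical
  funext a
  rw [empirical_apply, empirical_apply]
  congr 2
  refine Finset.card_bij (fun i _ => σ i) ?_ ?_ ?_
  · intro i hi; simpa using hi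
  · intro i _ j _ hij; exact σ.injective hij
  · intro j hj; exact ⟨σ.symm j, by simpa using hj, by simp⟩

variable [Fintype A]

lemma mem_typeClass {p : A → ℝ} {w : Fin n → A} : w ∈ typeClass p n ↔ empirical w = p := by
  simp [typeClass]

/-- The size of a type class is a multinomial coefficient. -/
lemma card_typeClass_mul (w : Fin n → A) :
    (typeClass (empirical w) n).card * ∏ a, (letterCount w a).factorial = n.factorial := by
  classical
  have hst : Fintype.card {g : Equiv.Perm (Fin n) // w ∘ g = w}
      = ∏ a, (letterCount w a).factorial := by
    rw [DomMulAct.stabilizer_card]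
    refine Finset.prod_congr rfl fun a _ => ?_
    rw [Fintype.card_subtype]; rfl
  have hn : n.factorial = Fintype.card (Equiv.Perm (Fin n)) := by
    rw [Fintype.card_perm, Fintype.card_fin]
  rw [hn, ← hst, ← Finset.card_univ (α := Equiv.Perm (Fin n)),
    Finset.card_eq_sum_card_fiberwise (f := fun σ : Equiv.Perm (Fin n) => w ∘ σ)
      (t := typeClass (empirical w) n)
      (fun σ _ => by
        simpa [mem_typeClass] using empirical_comp_perm w σ), Finset.sum_const_nat]
  intro w' hw'
  obtain ⟨τ, hτ⟩ := exists_perm_of_empirical_eq (mem_typeClass.1 hw').symm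
  rw [Fintype.card_subtype]
  refine Finset.card_bij (fun σ _ => σ * τ⁻¹) ?_ ?_ ?_
  · intro σ hσ
    simp only [Finset.mem_filter, Finset.mem_univ, true_and] at hσ ⊢
    funext i
    have h1 := congrFun hσ (τ⁻¹ i)
    have h2 := congrFun hτ (τ⁻¹ i)
    simp only [Function.comp_apply, Equiv.Perm.mul_apply] at h1 h2 ⊢
    rw [h1, ← h2]; simp
  · intro σ _ σ' _ h; exact mul_right_cancel h
  · intro σ hσ
    refine ⟨σ * τ, ?_, by simp⟩
    simp only [Finset.mem_filter, Finset.mem_univ, true_and] at hσ ⊢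
    rw [← hτ]
    funext i
    exact congrFun hσ (τ i)

lemma card_typeClass_pos (w : Fin n → A) : 0 < (typeClass (empirical w) n).card :=
  Finset.card_pos.2 ⟨w, mem_typeClass.2 rfl⟩

lemma mul_entropy_empirical (hn : 0 < n) (w : Fin n → A) :
    n * entropy (empirical w) =
      n * Real.log n - ∑ a, letterCount w a * Real.log (letterCount w a) := by
  have hn' : (0 : ℝ) < n := by exact_mod_cast hn
  have hs : (n : ℝ) * Real.log n = ∑ a, (letterCount w a : ℝ) * Real.log n := by
    rw [← Finset.sum_mul]
    congr 1
    exact_mod_cast (sum_letterCount w).symm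
  rw [hs, entropy, Finset.mul_sum, ← Finset.sum_sub_distrib]
  refine Finset.sum_congr rfl fun a _ => ?_
  rw [empirical_apply, Real.negMulLog]
  rcases Nat.eq_zero_or_pos (letterCount w a) with h | h
  · simp [h]
  · have h' : (0 : ℝ) < letterCount w a := by exact_mod_cast h
    rw [Real.log_div (by positivity) (by positivity)]
    field_simp
    ring

lemma log_card_typeClass (w : Fin n → A) :
    Real.log (typeClass (empirical w) n).card =
      Real.log n.factorial - ∑ a, Real.log (letterCount w a).factorial := by
  have h := congrArg (fun k : ℕ => Real.log (k : ℝ)) (card_typeClass_mul w)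
  have hc := card_typeClass_pos w
  simp only [Nat.cast_mul, Nat.cast_prod] at h
  rw [Real.log_mul (by positivity) (by
    rw [Finset.prod_ne_zero_iff]; intro a _; positivity),
    Real.log_prod (by intro a _; positivity)] at h
  linarith

lemma card_typeClass_le (hn : 0 < n) (w : Fin n → A) :
    ((typeClass (empirical w) n).card : ℝ) ≤
      polyFactor n * Real.exp (n * entropy (empirical w)) := by
  have hc : (0 : ℝ) < (typeClass (empirical w) n).card := by exact_mod_cast card_typeClass_pos w
  rw [← Real.log_le_log_iff hc (mul_pos (polyFactor_pos n) (Real.exp_pos _)),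
    Real.log_mul (polyFactor_pos n).ne' (Real.exp_pos _).ne', Real.log_exp, log_card_typeClass,
    mul_entropy_empirical hn]
  have h1 := log_factorial_le n
  have h2 : ∑ a, ((letterCount w a : ℝ) * Real.log (letterCount w a) - letterCount w a)
      ≤ ∑ a, Real.log (letterCount w a).factorial :=
    Finset.sum_le_sum fun a _ => le_log_factorial _
  have h3 : ∑ a, (letterCount w a : ℝ) = n := by exact_mod_cast sum_letterCount w
  rw [Finset.sum_sub_distrib, h3] at h2
  linarith

lemma exp_entropy_le_card_typeClass (hn : 0 < n) (w : Fin n → A) :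
    Real.exp (n * entropy (empirical w)) ≤
      polyFactor n ^ Fintype.card A * ((typeClass (empirical w) n).card : ℝ) := by
  have hc : (0 : ℝ) < (typeClass (empirical w) n).card := by exact_mod_cast card_typeClass_pos w
  have hB := polyFactor_pos n
  rw [← Real.log_le_log_iff (Real.exp_pos _) (by positivity),
    Real.log_mul (by positivity) hc.ne', Real.log_exp, Real.log_pow, log_card_typeClass,
    mul_entropy_empirical hn]
  have h1 := le_log_factorial n
  have h2 : ∑ a, Real.log (letterCount w a).factorial ≤
      ∑ a, ((letterCount w a : ℝ) * Real.log (letterCount w a) - letterCount w a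
        + Real.log (polyFactor n)) :=
    Finset.sum_le_sum fun a _ => (log_factorial_le _).trans
      (add_le_add_right (log_polyFactor_mono (letterCount_le w a)) _)
  have h3 : ∑ a, (letterCount w a : ℝ) = n := by exact_mod_cast sum_letterCount w
  rw [Finset.sum_add_distrib, Finset.sum_sub_distrib, h3, Finset.sum_const, Finset.card_univ,
    nsmul_eq_mul] at h2
  linarith

end TypeClass

/-! ### Joint types: information quantities and counting -/

section Pairs

variable {X Y : Type*} [Fintype X] [Fintype Y]

/-- The joint distributions with `X`-marginal `P` that vanish wherever the channel does; these are
the ones with finite log-likelihood and finite conditional divergence. -/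
def admissible (W : X → Y → ℝ) (P : X → ℝ) : Set (X × Y → ℝ) :=
  {Q | Q ∈ jointDist P ∧ ∀ x y, W x y = 0 → Q (x, y) = 0}

/-- The log-likelihood as a real number; it is `logLik` on admissible distributions. -/
def realLogLik (W : X → Y → ℝ) (Q : X × Y → ℝ) : ℝ := ∑ x, ∑ y, Q (x, y) * Real.log (W x y)

/-- The conditional divergence as a real number, in the form
`-H(Y|X) - ∑ Q log W`; it is `condDiv (condYX Q) W P` on admissible distributions. -/
def realDiv (W : X → Y → ℝ) (P : X → ℝ) (Q : X × Y → ℝ) : ℝ :=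
  entropy P - entropy Q - realLogLik W Q

lemma margX_eq_zero {Q : X × Y → ℝ} (h0 : ∀ p, 0 ≤ Q p) {x : X} (h : margX Q x = 0) (y : Y) :
    Q (x, y) = 0 :=
  (Finset.sum_eq_zero_iff_of_nonneg (fun y _ => h0 (x, y))).1 h y (Finset.mem_univ y)

lemma margY_eq_zero {Q : X × Y → ℝ} (h0 : ∀ p, 0 ≤ Q p) {y : Y} (h : margY Q y = 0) (x : X) :
    Q (x, y) = 0 :=
  (Finset.sum_eq_zero_iff_of_nonneg (fun x _ => h0 (x, y))).1 h x (Finset.mem_univ x)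

lemma margX_nonneg {Q : X × Y → ℝ} (h0 : ∀ p, 0 ≤ Q p) (x : X) : 0 ≤ margX Q x :=
  Finset.sum_nonneg fun _ _ => h0 _

lemma margY_nonneg {Q : X × Y → ℝ} (h0 : ∀ p, 0 ≤ Q p) (y : Y) : 0 ≤ margY Q y :=
  Finset.sum_nonneg fun _ _ => h0 _

lemma jointDist_nonneg {P : X → ℝ} {Q : X × Y → ℝ} (hQ : Q ∈ jointDist P) (p : X × Y) : 0 ≤ Q p :=
  hQ.1.1 p

lemma mutualInfo_eq_entropy {Q : X × Y → ℝ} (h0 : ∀ p, 0 ≤ Q p) :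
    mutualInfo Q = entropy (margX Q) + entropy (margY Q) - entropy Q := by
  have hX : entropy (margX Q) = ∑ x, ∑ y, -(Q (x, y) * Real.log (margX Q x)) := by
    refine Finset.sum_congr rfl fun x _ => ?_
    rw [Finset.sum_neg_distrib, ← Finset.sum_mul, Real.negMulLog, neg_mul]; rfl
  have hY : entropy (margY Q) = ∑ x, ∑ y, -(Q (x, y) * Real.log (margY Q y)) := by
    rw [Finset.sum_comm]
    refine Finset.sum_congr rfl fun y _ => ?_
    rw [Finset.sum_neg_distrib, ← Finset.sum_mul, Real.negMulLog, neg_mul]; rfl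
  rw [hX, hY, entropy, Fintype.sum_prod_type, mutualInfo, ← Finset.sum_add_distrib,
    ← Finset.sum_sub_distrib]
  refine Finset.sum_congr rfl fun x _ => ?_
  rw [← Finset.sum_add_distrib, ← Finset.sum_sub_distrib]
  refine Finset.sum_congr rfl fun y _ => ?_
  by_cases h : Q (x, y) = 0
  · simp [h]
  have hx : margX Q x ≠ 0 := fun h' => h (margX_eq_zero h0 h' y)
  have hy : margY Q y ≠ 0 := fun h' => h (margY_eq_zero h0 h' x)
  rw [Real.log_div h (mul_ne_zero hx hy), Real.log_mul hx hy, Real.negMulLog]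
  ring

lemma logLik_of_mem_admissible {W : X → Y → ℝ} {P : X → ℝ} {Q : X × Y → ℝ}
    (hQ : Q ∈ admissible W P) : logLik W Q = ((realLogLik W Q : ℝ) : EReal) := by
  rw [logLik, if_pos hQ.2]; rfl

lemma logLik_eq_bot {W : X → Y → ℝ} {P : X → ℝ} {Q : X × Y → ℝ} (hQ : Q ∈ jointDist P)
    (h : Q ∉ admissible W P) : logLik W Q = ⊥ := by
  rw [logLik, if_neg fun h' => h ⟨hQ, h'⟩]

lemma condDiv_of_mem_admissible {W : X → Y → ℝ} {P : X → ℝ} {Q : X × Y → ℝ}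
    (hQ : Q ∈ admissible W P) : condDiv (condYX Q) W P = ((realDiv W P Q : ℝ) : EReal) := by
  have h0 := jointDist_nonneg hQ.1
  have hm : margX Q = P := hQ.1.2
  rw [condDiv, if_pos fun x y _ hw => by rw [condYX, hQ.2 x y hw, zero_div]]
  congr 1
  have hP : entropy P = ∑ x, ∑ y, -(Q (x, y) * Real.log (P x)) := by
    refine Finset.sum_congr rfl fun x _ => ?_
    rw [Finset.sum_neg_distrib, ← Finset.sum_mul, Real.negMulLog, neg_mul]
    rw [← congrFun hm x]; rfl
  rw [realDiv, hP, entropy, Fintype.sum_prod_type, realLogLik, ← Finset.sum_sub_distrib,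
    ← Finset.sum_sub_distrib]
  refine Finset.sum_congr rfl fun x _ => ?_
  rw [← Finset.sum_sub_distrib, ← Finset.sum_sub_distrib, Finset.mul_sum]
  refine Finset.sum_congr rfl fun y _ => ?_
  rw [condYX, hm]
  by_cases h : Q (x, y) = 0
  · simp [h]
  have hx : P x ≠ 0 := fun h' => h (margX_eq_zero h0 (by rw [hm, h']) y)
  have hw : W x y ≠ 0 := fun h' => h (hQ.2 x y h')
  rw [Real.log_div (div_ne_zero h hx) hw, Real.log_div h hx, Real.negMulLog]
  field_simp
  ring

lemma condDiv_eq_top {W : X → Y → ℝ} {P : X → ℝ} {Q : X × Y → ℝ} (hQ : Q ∈ jointDist P)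
    (h : Q ∉ admissible W P) : condDiv (condYX Q) W P = ⊤ := by
  rw [condDiv, if_neg]
  intro h'
  refine h ⟨hQ, fun x y hw => ?_⟩
  by_cases hx : P x = 0
  · exact margX_eq_zero (jointDist_nonneg hQ) (by rw [hQ.2, hx]) y
  · have := h' x y hx hw
    rw [condYX, hQ.2, div_eq_zero_iff] at this
    exact this.resolve_right hx

lemma mem_admissible_of_condDiv_lt_top {W : X → Y → ℝ} {P : X → ℝ} {Q : X × Y → ℝ}
    (hQ : Q ∈ jointDist P) (h : condDiv (condYX Q) W P < ⊤) : Q ∈ admissible W P := by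
  by_contra h'
  exact h.ne (condDiv_eq_top hQ h')

variable {n : ℕ}

lemma margX_jointEmpirical (x : Fin n → X) (y : Fin n → Y) :
    margX (jointEmpirical x y) = empirical x := by
  classical
  funext a
  simp only [margX, jointEmpirical, empirical_apply, ← Finset.sum_div]
  congr 1
  have := Finset.card_eq_sum_card_fiberwise (f := y) (s := Finset.univ.filter (fun i => x i = a))
    (t := Finset.univ) (fun _ _ => Finset.mem_univ _)
  rw [letterCount, this]
  push_cast
  refine Finset.sum_congr rfl fun b _ => ?_
  rw [letterCount, Finset.filter_filter]
  congr 2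
  ext i; simp [Prod.ext_iff]

lemma margY_jointEmpirical (x : Fin n → X) (y : Fin n → Y) :
    margY (jointEmpirical x y) = empirical y := by
  classical
  funext b
  simp only [margY, jointEmpirical, empirical_apply, ← Finset.sum_div]
  congr 1
  have := Finset.card_eq_sum_card_fiberwise (f := x) (s := Finset.univ.filter (fun i => y i = b))
    (t := Finset.univ) (fun _ _ => Finset.mem_univ _)
  rw [letterCount, this]
  push_cast
  refine Finset.sum_congr rfl fun a _ => ?_
  rw [letterCount, Finset.filter_filter]
  congr 2
  ext i; simp [Prod.ext_iff, and_comm]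

lemma empirical_mem_stdSimplex {A : Type*} [Fintype A] (hn : 0 < n) (w : Fin n → A) :
    empirical w ∈ stdSimplex ℝ A := by
  refine ⟨fun a => empirical_nonneg w a, ?_⟩
  simp only [empirical_apply, ← Finset.sum_div]
  rw [div_eq_one_iff_eq (by positivity)]
  exact_mod_cast sum_letterCount w

lemma jointEmpirical_mem_jointDist {P : X → ℝ} (hn : 0 < n) {x : Fin n → X}
    (hx : x ∈ typeClass P n) (y : Fin n → Y) : jointEmpirical x y ∈ jointDist P :=
  ⟨empirical_mem_stdSimplex hn _, by rw [margX_jointEmpirical, mem_typeClass.1 hx]⟩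

lemma jointEmpirical_comp_perm (x : Fin n → X) (y : Fin n → Y) (σ : Equiv.Perm (Fin n)) :
    jointEmpirical (x ∘ σ) (y ∘ σ) = jointEmpirical x y :=
  empirical_comp_perm (fun i => (x i, y i)) σ

/-- The average of `g` over the type class of `P`. -/
def typeAvg (P : X → ℝ) (n : ℕ) (g : (Fin n → X) → ℝ) : ℝ :=
  (∑ x ∈ typeClass P n, g x) / ((typeClass P n).card : ℝ)

open Classical in
/-- The probability that a uniformly chosen word of the type class of `P` has the joint type `Q`
with `y`. -/
def typeProb (P : X → ℝ) (Q : X × Y → ℝ) (y : Fin n → Y) : ℝ :=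
  typeAvg P n (fun x => if jointEmpirical x y = Q then 1 else 0)

open Classical in
/-- The number of words of type `P` with joint type `Q` with `y` depends on `y` only through its
type. -/
lemma card_filter_jointEmpirical_congr (P : X → ℝ) (Q : X × Y → ℝ) {y y' : Fin n → Y}
    (h : empirical y = empirical y') :
    ((typeClass P n).filter (fun x => jointEmpirical x y = Q)).card =
      ((typeClass P n).filter (fun x => jointEmpirical x y' = Q)).card := by
  obtain ⟨σ, rfl⟩ := exists_perm_of_empirical_eq h
  refine Finset.card_bij (fun x _ => x ∘ σ) ?_ ?_ ?_
  · intro x hx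
    simp only [Finset.mem_filter, mem_typeClass] at hx ⊢
    rw [empirical_comp_perm, jointEmpirical_comp_perm]; exact hx
  · intro x _ x' _ hxx
    funext i
    have := congrFun hxx (σ.symm i)
    simpa using this
  · intro x hx
    simp only [Finset.mem_filter, mem_typeClass] at hx
    refine ⟨x ∘ σ.symm, ?_, by funext i; simp⟩
    simp only [Finset.mem_filter, mem_typeClass]
    rw [empirical_comp_perm, ← jointEmpirical_comp_perm (x ∘ σ.symm) y σ]
    have hσ : (x ∘ σ.symm) ∘ σ = x := by funext i; simp
    rw [hσ]; exact hx

open Classical in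
lemma typeProb_eq (P : X → ℝ) (Q : X × Y → ℝ) (y : Fin n → Y) :
    typeProb P Q y = ((typeClass P n).filter (fun x => jointEmpirical x y = Q)).card /
      ((typeClass P n).card : ℝ) := by
  rw [typeProb, typeAvg, Finset.sum_boole]

lemma typeProb_nonneg (P : X → ℝ) (Q : X × Y → ℝ) (y : Fin n → Y) : 0 ≤ typeProb P Q y := by
  rw [typeProb_eq]; positivity

open Classical in
/-- Double counting of the pairs of words with joint type `Q`. -/
lemma card_typeClass_eq_sum {P : X → ℝ} {Q : X × Y → ℝ} (hQ : margX Q = P) :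
    (typeClass Q n).card =
      ∑ y : Fin n → Y, ((typeClass P n).filter (fun x => jointEmpirical x y = Q)).card := by
  rw [Finset.card_eq_sum_card_fiberwise (f := fun (w : Fin n → X × Y) i => (w i).2)
    (t := Finset.univ) (fun _ _ => Finset.mem_univ _)]
  refine Finset.sum_congr rfl fun y _ => ?_
  refine Finset.card_bij (fun w _ i => (w i).1) ?_ ?_ ?_
  · intro w hw
    simp only [Finset.mem_filter, mem_typeClass] at hw ⊢
    obtain ⟨h1, rfl⟩ := hw
    have : jointEmpirical (fun i => (w i).1) (fun i => (w i).2) = Q := h1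
    exact ⟨by rw [← margX_jointEmpirical _ (fun i => (w i).2), this, hQ], this⟩
  · intro w hw w' hw' h
    simp only [Finset.mem_filter, mem_typeClass] at hw hw'
    funext i
    exact Prod.ext (congrFun h i) (congrFun (hw.2.trans hw'.2.symm) i)
  · intro x hx
    simp only [Finset.mem_filter, mem_typeClass] at hx
    refine ⟨fun i => (x i, y i), ?_, rfl⟩
    simp only [Finset.mem_filter, mem_typeClass]
    exact ⟨hx.2, trivial⟩

open Classical in
lemma card_filter_mul_card_typeClass {P : X → ℝ} {Q : X × Y → ℝ} (hQ : margX Q = P)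
    {y : Fin n → Y} (hy : empirical y = margY Q) :
    ((typeClass P n).filter (fun x => jointEmpirical x y = Q)).card *
      (typeClass (empirical y) n).card = (typeClass Q n).card := by
  rw [card_typeClass_eq_sum hQ, mul_comm, ← Finset.sum_subset (Finset.subset_univ _)
    (s₁ := typeClass (empirical y) n)]
  · rw [Finset.sum_const_nat]
    intro y' hy'
    exact card_filter_jointEmpirical_congr P Q (mem_typeClass.1 hy')
  · intro y' _ hy'
    rw [Finset.card_eq_zero, Finset.filter_eq_empty_iff]
    intro x _ hx
    refine hy' (mem_typeClass.2 ?_)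
    rw [hy, ← hx, margY_jointEmpirical]

variable (X Y) in
/-- A subexponential factor large enough for all the bounds on joint types below. -/
def subexpFactor (n : ℕ) : ℝ :=
  polyFactor n ^ (Fintype.card (X × Y) + Fintype.card X + Fintype.card Y + 2)

lemma subexpFactor_pos (n : ℕ) : 0 < subexpFactor X Y n := pow_pos (polyFactor_pos n) _

lemma one_le_subexpFactor (n : ℕ) : 1 ≤ subexpFactor X Y n := one_le_pow₀ (one_le_polyFactor n)

lemma polyFactor_pow_le {k : ℕ} (h : k ≤ Fintype.card (X × Y) + Fintype.card X + Fintype.card Y + 2)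
    (n : ℕ) : polyFactor n ^ k ≤ subexpFactor X Y n :=
  pow_le_pow_right₀ (one_le_polyFactor n) h

lemma typeProb_le {P : X → ℝ} (hn : 0 < n) (Q : X × Y → ℝ) (y : Fin n → Y) :
    typeProb P Q y ≤ subexpFactor X Y n * Real.exp (-(n * mutualInfo Q)) := by
  classical
  by_cases he : ∃ x ∈ typeClass P n, jointEmpirical x y = Q
  swap
  · rw [typeProb_eq, Finset.card_eq_zero.2]
    · simpa using mul_nonneg (subexpFactor_pos n).le (Real.exp_pos _).le
    · rw [Finset.filter_eq_empty_iff]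
      intro x hx h; exact he ⟨x, hx, h⟩
  obtain ⟨x, hx, hQ⟩ := he
  have hxP := mem_typeClass.1 hx
  have hmX : margX Q = P := by rw [← hQ, margX_jointEmpirical, hxP]
  have hmY : empirical y = margY Q := by rw [← hQ, margY_jointEmpirical]
  have hQ0 : ∀ p, 0 ≤ Q p := fun p => by rw [← hQ]; exact empirical_nonneg _ _
  have hcard := card_filter_mul_card_typeClass hmX hmY
  have h1 := card_typeClass_le hn (fun i => (x i, y i))
  have h2 := exp_entropy_le_card_typeClass hn x
  have h3 := exp_entropy_le_card_typeClass hn y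
  have hx0 := card_typeClass_pos x
  have hy0 := card_typeClass_pos y
  change ((typeClass (jointEmpirical x y) n).card : ℝ) ≤
    _ * Real.exp (n * entropy (jointEmpirical x y)) at h1
  rw [hQ] at h1
  rw [hxP] at h2 hx0
  rw [hmY] at h3 hy0 hcard
  rw [typeProb_eq, mutualInfo_eq_entropy hQ0, hmX]
  have hcard' : (((typeClass P n).filter (fun x => jointEmpirical x y = Q)).card : ℝ) *
      ((typeClass (margY Q) n).card : ℝ) = (typeClass Q n).card := by exact_mod_cast hcard
  have hx0' : (0 : ℝ) < (typeClass P n).card := by exact_mod_cast hx0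
  have hy0' : (0 : ℝ) < (typeClass (margY Q) n).card := by exact_mod_cast hy0
  rw [div_le_iff₀ hx0', ← mul_le_mul_iff_left₀ hy0', hcard']
  have hB := polyFactor_pos n
  calc ((typeClass Q n).card : ℝ) ≤ polyFactor n * Real.exp (n * entropy Q) := h1
    _ = polyFactor n * Real.exp (-(n * (entropy P + entropy (margY Q) - entropy Q))) *
        Real.exp (n * entropy P) * Real.exp (n * entropy (margY Q)) := by
      rw [mul_assoc, mul_assoc, ← Real.exp_add, ← Real.exp_add]
      congr 2; ring
    _ ≤ polyFactor n * Real.exp (-(n * (entropy P + entropy (margY Q) - entropy Q))) *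
        (polyFactor n ^ Fintype.card X * (typeClass P n).card) *
        (polyFactor n ^ Fintype.card Y * (typeClass (margY Q) n).card) := by gcongr
    _ = polyFactor n ^ (1 + Fintype.card X + Fintype.card Y) *
        Real.exp (-(n * (entropy P + entropy (margY Q) - entropy Q))) * (typeClass P n).card *
        (typeClass (margY Q) n).card := by ring
    _ ≤ _ := by
      gcongr
      exact polyFactor_pow_le (by omega) n

lemma le_typeProb {P : X → ℝ} (hn : 0 < n) {x₀ : Fin n → X} (hx₀ : x₀ ∈ typeClass P n)
    {y₀ y : Fin n → Y} (hy : empirical y = empirical y₀) {Q : X × Y → ℝ}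
    (hQ : jointEmpirical x₀ y₀ = Q) :
    Real.exp (-(n * mutualInfo Q)) ≤ subexpFactor X Y n * typeProb P Q y := by
  classical
  have hxP := mem_typeClass.1 hx₀
  have hmX : margX Q = P := by rw [← hQ, margX_jointEmpirical, hxP]
  have hmY : empirical y = margY Q := by rw [← hQ, margY_jointEmpirical, hy]
  have hQ0 : ∀ p, 0 ≤ Q p := fun p => by rw [← hQ]; exact empirical_nonneg _ _
  have hcard := card_filter_mul_card_typeClass hmX hmY
  have h1 := exp_entropy_le_card_typeClass hn (fun i => (x₀ i, y₀ i))
  have h2 := card_typeClass_le hn x₀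
  have h3 := card_typeClass_le hn y
  have hx0 := card_typeClass_pos x₀
  have hy0 := card_typeClass_pos y
  change Real.exp (n * entropy (jointEmpirical x₀ y₀)) ≤
    _ * ((typeClass (jointEmpirical x₀ y₀) n).card : ℝ) at h1
  rw [hQ] at h1
  rw [hxP] at h2 hx0
  rw [hmY] at h3 hy0 hcard
  rw [typeProb_eq, mutualInfo_eq_entropy hQ0, hmX]
  have hcard' : (((typeClass P n).filter (fun x => jointEmpirical x y = Q)).card : ℝ) *
      ((typeClass (margY Q) n).card : ℝ) = (typeClass Q n).card := by exact_mod_cast hcard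
  have hx0' : (0 : ℝ) < (typeClass P n).card := by exact_mod_cast hx0
  have hy0' : (0 : ℝ) < (typeClass (margY Q) n).card := by exact_mod_cast hy0
  rw [mul_div_assoc', le_div_iff₀ hx0', ← mul_le_mul_iff_left₀ hy0', mul_assoc (subexpFactor X Y n),
    hcard']
  have hB := polyFactor_pos n
  calc Real.exp (-(n * (entropy P + entropy (margY Q) - entropy Q))) * (typeClass P n).card *
        (typeClass (margY Q) n).card
      ≤ Real.exp (-(n * (entropy P + entropy (margY Q) - entropy Q))) *
        (polyFactor n * Real.exp (n * entropy P)) *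
        (polyFactor n * Real.exp (n * entropy (margY Q))) := by gcongr
    _ = polyFactor n ^ 2 * Real.exp (n * entropy Q) := by
      have : Real.exp (n * entropy Q) =
        Real.exp (-(n * (entropy P + entropy (margY Q) - entropy Q))) *
          Real.exp (n * entropy P) * Real.exp (n * entropy (margY Q)) := by
        rw [← Real.exp_add, ← Real.exp_add]; congr 1; ring
      rw [this]; ring
    _ ≤ polyFactor n ^ 2 * (polyFactor n ^ Fintype.card (X × Y) * (typeClass Q n).card) := by
      gcongr
    _ = polyFactor n ^ (2 + Fintype.card (X × Y)) * (typeClass Q n).card := by ring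
    _ ≤ _ := by
      gcongr
      exact polyFactor_pow_le (by omega) n

lemma channelProb_nonneg {W : X → Y → ℝ} (hW0 : ∀ x y, 0 ≤ W x y) (x : Fin n → X) (y : Fin n → Y) :
    0 ≤ channelProb W x y := Finset.prod_nonneg fun _ _ => hW0 _ _

lemma letterCount_pos_iff {A : Type*} (w : Fin n → A) (a : A) :
    0 < letterCount w a ↔ ∃ i, w i = a := by
  classical
  simp [letterCount, Finset.card_pos, Finset.filter_nonempty_iff]

lemma empirical_ne_zero_iff {A : Type*} (w : Fin n → A) (a : A) :
    empirical w a ≠ 0 ↔ ∃ i, w i = a := by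
  rw [← letterCount_pos_iff, empirical_apply, Nat.pos_iff_ne_zero]
  constructor
  · intro h h'; exact h (by simp [h'])
  · intro h
    have h' := letterCount_le w a
    have : n ≠ 0 := by omega
    have h1 : (letterCount w a : ℝ) ≠ 0 := by exact_mod_cast h
    have h2 : (n : ℝ) ≠ 0 := by exact_mod_cast this
    exact div_ne_zero h1 h2

lemma channelProb_eq_exp {W : X → Y → ℝ} (hW0 : ∀ x y, 0 ≤ W x y) (hn : 0 < n)
    (x : Fin n → X) (y : Fin n → Y)
    (h : ∀ a b, W a b = 0 → jointEmpirical x y (a, b) = 0) :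
    channelProb W x y = Real.exp (n * realLogLik W (jointEmpirical x y)) := by
  classical
  have hpos : ∀ i, 0 < W (x i) (y i) := fun i => by
    refine lt_of_le_of_ne (hW0 _ _) fun h' => ?_
    exact (empirical_ne_zero_iff (fun i => (x i, y i)) _).2 ⟨i, rfl⟩ (h _ _ h'.symm)
  have hn' : (n : ℝ) ≠ 0 := by positivity
  rw [channelProb, ← Real.exp_log (Finset.prod_pos fun i _ => hpos i),
    Real.log_prod (fun i _ => (hpos i).ne')]
  congr 1
  have hs := Finset.sum_fiberwise' (s := (Finset.univ : Finset (Fin n)))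
    (g := fun i => (x i, y i)) (f := fun p : X × Y => Real.log (W p.1 p.2))
  rw [← hs, realLogLik, ← Fintype.sum_prod_type' (f := fun a b => _ * Real.log (W a b)),
    Finset.mul_sum]
  refine Finset.sum_congr rfl ?_
  rintro ⟨a, b⟩ -
  have hc : (Finset.univ.filter (fun i => (x i, y i) = (a, b))).card =
      letterCount (fun i => (x i, y i)) (a, b) := by
    unfold letterCount; congr!
  rw [Finset.sum_const, nsmul_eq_mul, jointEmpirical, empirical_apply, hc]
  field_simp

lemma channelProb_eq_zero {W : X → Y → ℝ} (x : Fin n → X) (y : Fin n → Y)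
    (h : ¬ ∀ a b, W a b = 0 → jointEmpirical x y (a, b) = 0) :
    channelProb W x y = 0 := by
  push Not at h
  obtain ⟨a, b, hw, hab⟩ := h
  obtain ⟨i, hi⟩ := (empirical_ne_zero_iff (fun i => (x i, y i)) _).1 hab
  simp only [Prod.mk.injEq] at hi
  exact Finset.prod_eq_zero (Finset.mem_univ i) (by rw [hi.1, hi.2, hw])

open Classical in
/-- The probability that the transmitted word, uniform on the type class of `P`, and the channel
output have the joint type `Q`, restricted to the output `y`. -/
def transProb (W : X → Y → ℝ) (P : X → ℝ) (Q : X × Y → ℝ) (y : Fin n → Y) : ℝ :=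
  typeAvg P n (fun x => if jointEmpirical x y = Q then channelProb W x y else 0)

lemma typeAvg_nonneg {P : X → ℝ} {g : (Fin n → X) → ℝ} (h : ∀ x, 0 ≤ g x) :
    0 ≤ typeAvg P n g :=
  div_nonneg (Finset.sum_nonneg fun _ _ => h _) (Nat.cast_nonneg _)

lemma transProb_nonneg {W : X → Y → ℝ} (hW0 : ∀ x y, 0 ≤ W x y) (P : X → ℝ) (Q : X × Y → ℝ)
    (y : Fin n → Y) : 0 ≤ transProb W P Q y :=
  typeAvg_nonneg fun x => by
    split_ifs
    · exact channelProb_nonneg hW0 x y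
    · exact le_rfl

lemma transProb_eq_zero {W : X → Y → ℝ} {P : X → ℝ} {Q : X × Y → ℝ} (hQ : Q ∈ jointDist P)
    (h : Q ∉ admissible W P) (y : Fin n → Y) : transProb W P Q y = 0 := by
  rw [transProb, typeAvg, Finset.sum_eq_zero, zero_div]
  intro x _
  split_ifs with hx
  · exact channelProb_eq_zero x y fun h' => h ⟨hQ, by rw [← hx]; exact h'⟩
  · rfl

lemma transProb_eq_zero_of_margY {W : X → Y → ℝ} {P : X → ℝ} {Q : X × Y → ℝ} {y : Fin n → Y}
    (h : empirical y ≠ margY Q) : transProb W P Q y = 0 := by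
  rw [transProb, typeAvg, Finset.sum_eq_zero, zero_div]
  intro x _
  rw [if_neg]
  rintro rfl
  exact h (margY_jointEmpirical x y).symm

lemma sum_transProb_eq {W : X → Y → ℝ} (hW0 : ∀ x y, 0 ≤ W x y) {P : X → ℝ} (hn : 0 < n)
    {Q : X × Y → ℝ} (hQ : Q ∈ admissible W P) :
    ∑ y : Fin n → Y, transProb W P Q y =
      (typeClass Q n).card * Real.exp (n * realLogLik W Q) / (typeClass P n).card := by
  classical
  rw [card_typeClass_eq_sum hQ.1.2]
  simp only [transProb, typeAvg, ← Finset.sum_div]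
  congr 1
  push_cast
  rw [Finset.sum_mul]
  refine Finset.sum_congr rfl fun y _ => ?_
  rw [← Finset.sum_filter, ← nsmul_eq_mul, ← Finset.sum_const]
  refine Finset.sum_congr rfl fun x hx => ?_
  have hx' := (Finset.mem_filter.1 hx).2
  rw [channelProb_eq_exp hW0 hn x y (by rw [hx']; exact hQ.2), hx']

lemma sum_transProb_le {W : X → Y → ℝ} (hW0 : ∀ x y, 0 ≤ W x y) {P : X → ℝ} (hn : 0 < n)
    {Q : X × Y → ℝ} (hQ : Q ∈ admissible W P) :
    ∑ y : Fin n → Y, transProb W P Q y ≤ subexpFactor X Y n * Real.exp (-(n * realDiv W P Q)) := by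
  classical
  by_cases he : (typeClass Q n).Nonempty
  swap
  · rw [sum_transProb_eq hW0 hn hQ, Finset.not_nonempty_iff_eq_empty.1 he]
    simpa using mul_nonneg (subexpFactor_pos n).le (Real.exp_pos _).le
  obtain ⟨w, hw⟩ := he
  have hwQ := mem_typeClass.1 hw
  have hx : empirical (fun i => (w i).1) = P := by
    rw [← margX_jointEmpirical _ (fun i => (w i).2), ← hQ.1.2, ← hwQ]; rfl
  rw [sum_transProb_eq hW0 hn hQ]
  have h1 := card_typeClass_le hn w
  have h2 := exp_entropy_le_card_typeClass hn (fun i => (w i).1)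
  have h0 := card_typeClass_pos (fun i => (w i).1)
  rw [hwQ] at h1
  rw [hx] at h2 h0
  have h0' : (0 : ℝ) < (typeClass P n).card := by exact_mod_cast h0
  have hB := polyFactor_pos n
  rw [div_le_iff₀ h0', realDiv]
  calc (typeClass Q n).card * Real.exp (n * realLogLik W Q)
      ≤ polyFactor n * Real.exp (n * entropy Q) * Real.exp (n * realLogLik W Q) := by gcongr
    _ = polyFactor n * Real.exp (-(n * (entropy P - entropy Q - realLogLik W Q))) *
        Real.exp (n * entropy P) := by
      rw [mul_assoc, mul_assoc, ← Real.exp_add, ← Real.exp_add]; congr 2; ring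
    _ ≤ polyFactor n * Real.exp (-(n * (entropy P - entropy Q - realLogLik W Q))) *
        (polyFactor n ^ Fintype.card X * (typeClass P n).card) := by gcongr
    _ = polyFactor n ^ (1 + Fintype.card X) *
        Real.exp (-(n * (entropy P - entropy Q - realLogLik W Q))) * (typeClass P n).card := by ring
    _ ≤ _ := by
      gcongr
      exact polyFactor_pow_le (by omega) n

lemma le_sum_transProb {W : X → Y → ℝ} (hW0 : ∀ x y, 0 ≤ W x y) {P : X → ℝ} (hn : 0 < n)
    {Q : X × Y → ℝ} (hQ : Q ∈ admissible W P) {x₀ : Fin n → X} {y₀ : Fin n → Y}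
    (h : jointEmpirical x₀ y₀ = Q) :
    Real.exp (-(n * realDiv W P Q)) ≤ subexpFactor X Y n * ∑ y : Fin n → Y, transProb W P Q y := by
  classical
  have hx : empirical x₀ = P := by
    rw [← margX_jointEmpirical _ y₀, ← hQ.1.2, ← h]
  rw [sum_transProb_eq hW0 hn hQ]
  have h1 := exp_entropy_le_card_typeClass hn (fun i => (x₀ i, y₀ i))
  change Real.exp (n * entropy (jointEmpirical x₀ y₀)) ≤
    _ * ((typeClass (jointEmpirical x₀ y₀) n).card : ℝ) at h1
  have h2 := card_typeClass_le hn x₀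
  have h0 := card_typeClass_pos x₀
  rw [h] at h1
  rw [hx] at h2 h0
  have h0' : (0 : ℝ) < (typeClass P n).card := by exact_mod_cast h0
  have hB := polyFactor_pos n
  rw [mul_div_assoc', le_div_iff₀ h0', realDiv]
  calc Real.exp (-(n * (entropy P - entropy Q - realLogLik W Q))) * (typeClass P n).card
      ≤ Real.exp (-(n * (entropy P - entropy Q - realLogLik W Q))) *
        (polyFactor n * Real.exp (n * entropy P)) := by gcongr
    _ = polyFactor n * Real.exp (n * entropy Q) * Real.exp (n * realLogLik W Q) := by
      have : Real.exp (n * entropy Q) * Real.exp (n * realLogLik W Q) =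
          Real.exp (-(n * (entropy P - entropy Q - realLogLik W Q))) *
            Real.exp (n * entropy P) := by
        rw [← Real.exp_add, ← Real.exp_add]; congr 1; ring
      rw [mul_assoc, this]; ring
    _ ≤ polyFactor n * (polyFactor n ^ Fintype.card (X × Y) * (typeClass Q n).card) *
        Real.exp (n * realLogLik W Q) := by gcongr
    _ = polyFactor n ^ (1 + Fintype.card (X × Y)) *
        ((typeClass Q n).card * Real.exp (n * realLogLik W Q)) := by ring
    _ ≤ _ := by
      gcongr
      exact polyFactor_pow_le (by omega) n

end Pairs

/-! ### Exponents of sequences -/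

section Exponents

lemma log_mul_polyFactor_pow_div_tendsto {K : ℝ} (hK : 0 < K) (d : ℕ) :
    Tendsto (fun n : ℕ => Real.log (K * polyFactor n ^ d) / n) atTop (nhds 0) := by
  have h1 : Tendsto (fun n : ℕ => Real.log ((n : ℝ) + 1) / n) atTop (nhds 0) := by
    have h := (Real.tendsto_pow_log_div_mul_add_atTop 1 (-1) 1 one_ne_zero).comp
      (tendsto_atTop_add_const_right _ (1 : ℝ) tendsto_natCast_atTop_atTop)
    refine h.congr fun n => ?_
    simp
  have h2 : Tendsto (fun n : ℕ => (Real.log K + d) * (1 / (n : ℝ)) +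
      2 * d * (Real.log ((n : ℝ) + 1) / n)) atTop (nhds ((Real.log K + d) * 0 + 2 * d * 0)) :=
    (tendsto_one_div_atTop_nhds_zero_nat.const_mul _).add (h1.const_mul _)
  simp only [mul_zero, add_zero] at h2
  refine h2.congr fun n => ?_
  rw [Real.log_mul hK.ne' (pow_pos (polyFactor_pos n) d).ne', Real.log_pow, log_polyFactor]
  ring

lemma mul_polyFactor_pow_le_exp {K δ : ℝ} (hK : 0 < K) (d : ℕ) (hδ : 0 < δ) :
    ∀ᶠ n : ℕ in atTop, K * polyFactor n ^ d ≤ Real.exp (n * δ) := by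
  filter_upwards [(log_mul_polyFactor_pow_div_tendsto hK d).eventually (gt_mem_nhds hδ),
    eventually_gt_atTop 0] with n hn h0
  have h0' : (0 : ℝ) < n := by exact_mod_cast h0
  rw [div_lt_iff₀ h0'] at hn
  have := polyFactor_pos n
  rw [← Real.log_le_log_iff (by positivity) (Real.exp_pos _), Real.log_exp]
  linarith

variable {X : Type*} [Fintype X]

/-- A sequence bounded by `e ^ (-nr)` up to a subexponential factor has exponent at least `r`. -/
lemma le_exponent {P : X → ℝ} {a : ℕ → ℝ} {r K : ℝ} (hK : 0 < K) (d : ℕ)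
    (h : ∀ n, 0 < n → (typeClass P n).Nonempty → a n ≤ K * polyFactor n ^ d * Real.exp (-(n * r))) :
    (r : EReal) ≤ exponent P a := by
  refine EReal.ge_of_forall_gt_iff_ge.1 fun s hs => ?_
  have hs' : 0 < r - s := by
    have : s < r := by exact_mod_cast hs
    linarith
  refine le_liminf_of_le (by isBoundedDefault) ?_
  rw [eventually_inf_principal]
  filter_upwards [mul_polyFactor_pow_le_exp hK d hs'] with n hn ⟨h0, hT⟩
  have h0' : (0 : ℝ) < n := by exact_mod_cast h0
  rw [ENNReal.log_ofReal]
  split_ifs with ha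
  · rw [EReal.coe_mul_bot_of_neg (by simpa using h0)]
    exact le_top
  · push Not at ha
    rw [← EReal.coe_mul, EReal.coe_le_coe_iff]
    have h1 : a n ≤ Real.exp (n * (r - s)) * Real.exp (-(n * r)) :=
      (h n h0 hT).trans (mul_le_mul_of_nonneg_right hn (Real.exp_pos _).le)
    rw [← Real.exp_add] at h1
    have h2 := Real.log_le_log ha h1
    rw [Real.log_exp] at h2
    have h3 : Real.log (a n) ≤ -(n * s) := by linarith
    have h4 : s = 1 / n * (n * s) := by field_simp
    rw [h4, neg_mul, ← mul_neg]
    exact mul_le_mul_of_nonneg_left (by linarith) (by positivity)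

/-- A sequence that is at least `e ^ (-nr)`, up to a subexponential factor, along the multiples of
some block length has exponent at most `r`. -/
lemma exponent_le {P : X → ℝ} {a : ℕ → ℝ} {r K : ℝ} (hK : 0 < K) (d : ℕ) {N : ℕ} (hN : 0 < N)
    (h : ∀ᶠ j : ℕ in atTop, (typeClass P (N * j)).Nonempty ∧
      Real.exp (-((N * j : ℕ) * r)) ≤ K * polyFactor (N * j) ^ d * a (N * j)) :
    exponent P a ≤ (r : EReal) := by
  refine EReal.le_of_forall_lt_iff_le.1 fun s hs => ?_
  have hs' : 0 < s - r := by
    have : r < s := by exact_mod_cast hs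
    linarith
  refine liminf_le_of_frequently_le ?_ (by isBoundedDefault)
  rw [frequently_iff]
  intro U hU
  rw [mem_inf_principal] at hU
  have hNj : Tendsto (fun j : ℕ => N * j) atTop atTop :=
    tendsto_id.const_mul_atTop' hN
  obtain ⟨j, ⟨hT, hj⟩, hUj, hCj, hj0⟩ := (h.and ((hNj.eventually hU).and
    ((hNj.eventually (mul_polyFactor_pow_le_exp hK d hs')).and (eventually_gt_atTop 0)))).exists
  have h0 : 0 < N * j := Nat.mul_pos hN hj0
  refine ⟨N * j, hUj ⟨h0, hT⟩, ?_⟩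
  generalize N * j = n at *
  have h0' : (0 : ℝ) < n := by exact_mod_cast h0
  have hC : 0 < K * polyFactor n ^ d := mul_pos hK (pow_pos (polyFactor_pos n) d)
  have ha : 0 < a n := by
    by_contra ha
    push Not at ha
    have := mul_nonpos_of_nonneg_of_nonpos hC.le ha
    linarith [Real.exp_pos (-((n : ℝ) * r))]
  rw [ENNReal.log_ofReal_of_pos ha, ← EReal.coe_mul, EReal.coe_le_coe_iff]
  have h1 := hj.trans (mul_le_mul_of_nonneg_right hCj ha.le)
  have h2 := Real.log_le_log (Real.exp_pos _) h1
  rw [Real.log_mul (Real.exp_pos _).ne' ha.ne', Real.log_exp, Real.log_exp] at h2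
  have h3 : -(n * s) ≤ Real.log (a n) := by linarith
  have h4 : s = 1 / n * (n * s) := by field_simp
  rw [h4, neg_mul, ← mul_neg]
  exact mul_le_mul_of_nonneg_left (by linarith) (by positivity)

end Exponents

/-! ### Averages over the random codebook -/

section Ensemble

variable {X : Type*} [Fintype X] {P : X → ℝ} {n M : ℕ}

lemma ensembleAvg_prod (g : Fin M → (Fin n → X) → ℝ) :
    ensembleAvg P n M (fun c => ∏ i, g i (c i)) = ∏ i, typeAvg P n (g i) := by
  simp only [ensembleAvg, typeAvg, Finset.prod_div_distrib, Finset.prod_const, Finset.card_univ,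
    Fintype.card_fin]
  rw [Finset.prod_univ_sum]

lemma ensembleAvg_sum {ι : Type*} (s : Finset ι) (F : ι → (Fin M → Fin n → X) → ℝ) :
    ensembleAvg P n M (fun c => ∑ i ∈ s, F i c) = ∑ i ∈ s, ensembleAvg P n M (F i) := by
  simp only [ensembleAvg]
  rw [Finset.sum_comm, Finset.sum_div]

lemma ensembleAvg_const_mul (r : ℝ) (F : (Fin M → Fin n → X) → ℝ) :
    ensembleAvg P n M (fun c => r * F c) = r * ensembleAvg P n M F := by
  simp only [ensembleAvg]
  rw [← Finset.mul_sum, mul_div_assoc]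

lemma ensembleAvg_sub (F G : (Fin M → Fin n → X) → ℝ) :
    ensembleAvg P n M (fun c => F c - G c) = ensembleAvg P n M F - ensembleAvg P n M G := by
  simp only [ensembleAvg]
  rw [Finset.sum_sub_distrib, sub_div]

lemma ensembleAvg_mono {F G : (Fin M → Fin n → X) → ℝ}
    (h : ∀ c, (∀ i, c i ∈ typeClass P n) → F c ≤ G c) :
    ensembleAvg P n M F ≤ ensembleAvg P n M G := by
  refine div_le_div_of_nonneg_right (Finset.sum_le_sum fun c hc => h c ?_) (by positivity)
  exact fun i => Fintype.mem_piFinset.1 hc i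

lemma typeAvg_one (hT : (typeClass P n).Nonempty) : typeAvg P n (fun _ => 1) = 1 := by
  have := hT.card_pos
  rw [typeAvg, Finset.sum_const, nsmul_eq_mul, mul_one, div_self (by positivity)]

lemma typeAvg_sub (F G : (Fin n → X) → ℝ) :
    typeAvg P n (fun c => F c - G c) = typeAvg P n F - typeAvg P n G := by
  simp only [typeAvg]
  rw [Finset.sum_sub_distrib, sub_div]

lemma typeAvg_sum {ι : Type*} (s : Finset ι) (F : ι → (Fin n → X) → ℝ) :
    typeAvg P n (fun c => ∑ i ∈ s, F i c) = ∑ i ∈ s, typeAvg P n (F i) := by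
  simp only [typeAvg]
  rw [Finset.sum_comm, Finset.sum_div]

lemma typeAvg_mono {F G : (Fin n → X) → ℝ} (h : ∀ x ∈ typeClass P n, F x ≤ G x) :
    typeAvg P n F ≤ typeAvg P n G :=
  div_le_div_of_nonneg_right (Finset.sum_le_sum h) (by positivity)

lemma prod_ite_eq_mul_pow (m : Fin M) (a e : ℝ) :
    ∏ i, (if i = m then a else e) = a * e ^ (M - 1) := by
  rw [← Finset.mul_prod_erase _ _ (Finset.mem_univ m), if_pos rfl]
  congr 1
  rw [Finset.prod_congr rfl (g := fun _ => e)
    (fun i hi => if_neg (Finset.ne_of_mem_erase hi)), Finset.prod_const,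
    Finset.card_erase_of_mem (Finset.mem_univ m), Finset.card_univ, Fintype.card_fin]

lemma prod_ite_ite_eq_mul_pow {m l : Fin M} (hml : l ≠ m) (a b e : ℝ) :
    ∏ i, (if i = m then a else if i = l then b else e) = a * b * e ^ (M - 2) := by
  have hl : l ∈ Finset.univ.erase m := Finset.mem_erase.2 ⟨hml, Finset.mem_univ l⟩
  rw [← Finset.mul_prod_erase _ _ (Finset.mem_univ m), if_pos rfl,
    ← Finset.mul_prod_erase _ _ hl, if_neg hml, if_pos rfl, mul_assoc]
  congr 2
  rw [Finset.prod_congr rfl (g := fun _ => e) (fun i hi => by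
    rw [if_neg (Finset.ne_of_mem_erase (Finset.mem_of_mem_erase hi)),
      if_neg (Finset.ne_of_mem_erase hi)]), Finset.prod_const,
    Finset.card_erase_of_mem hl, Finset.card_erase_of_mem (Finset.mem_univ m), Finset.card_univ,
    Fintype.card_fin]
  rfl

/-- Independence of one codeword from all others. -/
lemma ensembleAvg_mul_prod (m : Fin M) (a e : (Fin n → X) → ℝ) :
    ensembleAvg P n M (fun c => ∏ i, (if i = m then a else e) (c i)) =
      typeAvg P n a * typeAvg P n e ^ (M - 1) := by
  rw [ensembleAvg_prod, ← prod_ite_eq_mul_pow m]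
  exact Finset.prod_congr rfl fun i _ => by split_ifs <;> rfl

/-- Independence of two codewords from each other and from all others. -/
lemma ensembleAvg_mul_mul_prod {m l : Fin M} (hml : l ≠ m) (a b e : (Fin n → X) → ℝ) :
    ensembleAvg P n M (fun c => ∏ i, (if i = m then a else if i = l then b else e) (c i)) =
      typeAvg P n a * typeAvg P n b * typeAvg P n e ^ (M - 2) := by
  rw [ensembleAvg_prod, ← prod_ite_ite_eq_mul_pow hml]
  exact Finset.prod_congr rfl fun i _ => by split_ifs <;> rfl

variable {Y : Type*} [Fintype Y]

lemma ensembleAvg_errorProb (W : X → Y → ℝ) (h : (X × Y → ℝ) → EReal) :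
    ensembleAvg P n M (fun c => errorProb W c (thresholdRegion W h c)) =
      1 / (M : ℝ) * ∑ m, ∑ y, ensembleAvg P n M (fun c =>
        open Classical in if y ∈ thresholdRegion W h c m then 0 else channelProb W (c m) y) := by
  simp only [errorProb]
  rw [ensembleAvg_const_mul, ensembleAvg_sum]
  congr 1
  exact Finset.sum_congr rfl fun m _ => ensembleAvg_sum _ _

lemma ensembleAvg_listSize (W : X → Y → ℝ) (h : (X × Y → ℝ) → EReal) :
    ensembleAvg P n M (fun c => listSize W c (thresholdRegion W h c)) =
      ∑ y, 1 / (M : ℝ) * ∑ m, ∑ l, ensembleAvg P n M (fun c => channelProb W (c m) y *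
        (open Classical in if l ≠ m ∧ y ∈ thresholdRegion W h c l then (1 : ℝ) else 0)) := by
  simp only [listSize, Finset.mul_sum]
  rw [ensembleAvg_sum]
  refine Finset.sum_congr rfl fun y _ => ?_
  rw [ensembleAvg_sum]
  refine Finset.sum_congr rfl fun m _ => ?_
  rw [ensembleAvg_sum]
  refine Finset.sum_congr rfl fun l _ => ?_
  rw [ensembleAvg_const_mul]

lemma typeProb_compl (hT : (typeClass P n).Nonempty) (Q : X × Y → ℝ) (y : Fin n → Y) :
    typeAvg P n (fun x => open Classical in if jointEmpirical x y = Q then 0 else 1) =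
      1 - typeProb P Q y := by
  classical
  have h := typeAvg_sub (P := P) (fun _ => 1) (fun x => if jointEmpirical x y = Q then 1 else 0)
  rw [typeAvg_one hT] at h
  rw [typeProb, ← h]
  congr 1
  funext x
  split_ifs <;> norm_num

lemma typeProb_le_one (hT : (typeClass P n).Nonempty) (Q : X × Y → ℝ) (y : Fin n → Y) :
    typeProb P Q y ≤ 1 := by
  classical
  rw [← typeAvg_one hT]
  refine typeAvg_mono fun x _ => ?_
  split_ifs <;> norm_num

open Classical in
/-- The probability that the transmitted codeword has joint type `Qt` with the output and that some
other codeword has joint type `Q` with it, restricted to the output `y`. -/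
lemma ensembleAvg_trans_exists (hT : (typeClass P n).Nonempty) (W : X → Y → ℝ)
    (Qt Q : X × Y → ℝ) (y : Fin n → Y) (m : Fin M) :
    ensembleAvg P n M (fun c => if jointEmpirical (c m) y = Qt ∧
        ∃ l, l ≠ m ∧ jointEmpirical (c l) y = Q then channelProb W (c m) y else 0) =
      transProb W P Qt y * (1 - (1 - typeProb P Q y) ^ (M - 1)) := by
  set a : (Fin n → X) → ℝ := fun x => if jointEmpirical x y = Qt then channelProb W x y else 0
    with ha
  set e : (Fin n → X) → ℝ := fun x => if jointEmpirical x y = Q then 0 else 1 with he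
  have h1 := ensembleAvg_mul_prod (P := P) m a (fun _ => 1)
  have h2 := ensembleAvg_mul_prod (P := P) m a e
  rw [typeAvg_one hT, one_pow, mul_one] at h1
  rw [typeProb_compl hT] at h2
  rw [mul_sub, mul_one, transProb, ← h2, ← h1, ← ensembleAvg_sub]
  congr 1
  funext c
  have key : ∀ e : (Fin n → X) → ℝ, ∏ i, (if i = m then a else e) (c i) =
      a (c m) * ∏ i ∈ Finset.univ.erase m, e (c i) := fun e => by
    rw [← Finset.mul_prod_erase _ _ (Finset.mem_univ m), if_pos rfl]
    congr 1
    exact Finset.prod_congr rfl fun i hi => by rw [if_neg (Finset.ne_of_mem_erase hi)]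
  rw [key, key, Finset.prod_const_one]
  by_cases hm : jointEmpirical (c m) y = Qt
  · by_cases hl : ∃ l, l ≠ m ∧ jointEmpirical (c l) y = Q
    · rw [if_pos ⟨hm, hl⟩]
      obtain ⟨l, hl, hlQ⟩ := hl
      have hz : ∏ i ∈ Finset.univ.erase m, e (c i) = 0 :=
        Finset.prod_eq_zero (Finset.mem_erase.2 ⟨hl, Finset.mem_univ l⟩) (if_pos hlQ)
      rw [hz]
      simp [ha, hm]
    · rw [if_neg fun h => hl h.2, Finset.prod_eq_one]
      · ring
      · intro i hi
        exact if_neg fun h => hl ⟨i, Finset.ne_of_mem_erase hi, h⟩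
  · rw [if_neg fun h => hm h.1]
    simp [ha, hm]

variable (Y) in
open Classical in
/-- The joint types of block length `n` with `X`-marginal `P`. -/
def jointTypes (P : X → ℝ) (n : ℕ) : Finset (X × Y → ℝ) :=
  (Finset.univ.image (fun w : Fin n → X × Y => empirical w)).filter (· ∈ jointDist P)

lemma jointEmpirical_mem_jointTypes (hn : 0 < n) {x : Fin n → X} (hx : x ∈ typeClass P n)
    (y : Fin n → Y) : jointEmpirical x y ∈ jointTypes Y P n := by
  classical
  rw [jointTypes, Finset.mem_filter, Finset.mem_image]
  exact ⟨⟨_, Finset.mem_univ _, rfl⟩, jointEmpirical_mem_jointDist hn hx y⟩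

lemma card_jointTypes_le (P : X → ℝ) (n : ℕ) :
    ((jointTypes Y P n).card : ℝ) ≤ polyFactor n ^ Fintype.card (X × Y) := by
  classical
  have h1 : jointTypes Y P n ⊆ Finset.univ.image
      (fun k : X × Y → Fin (n + 1) => fun p => ((k p : ℕ) : ℝ) / n) := by
    intro Q hQ
    rw [jointTypes, Finset.mem_filter, Finset.mem_image] at hQ
    obtain ⟨⟨w, _, rfl⟩, _⟩ := hQ
    exact Finset.mem_image.2 ⟨fun p => ⟨letterCount w p, Nat.lt_succ_of_le (letterCount_le w p)⟩,
      Finset.mem_univ _, rfl⟩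
  have h2 := (Finset.card_le_card h1).trans Finset.card_image_le
  rw [Finset.card_univ, Fintype.card_fun, Fintype.card_fin] at h2
  calc ((jointTypes Y P n).card : ℝ) ≤ ((n + 1) ^ Fintype.card (X × Y) : ℕ) := by exact_mod_cast h2
    _ = ((n : ℝ) + 1) ^ Fintype.card (X × Y) := by push_cast; rfl
    _ ≤ _ := by
      refine pow_le_pow_left₀ (by positivity) ?_ _
      have h1 : (1 : ℝ) ≤ Real.exp 1 := Real.one_le_exp (by norm_num)
      have h2 : (1 : ℝ) ≤ (n : ℝ) + 1 := by linarith [n.cast_nonneg (α := ℝ)]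
      rw [polyFactor]
      nlinarith [mul_nonneg (sub_nonneg.2 h1) (sq_nonneg ((n : ℝ) + 1))]

end Ensemble

/-! ### The number of codewords -/

section Codewords

variable {R : ℝ} {n : ℕ}

lemma exp_le_numCodewords (R : ℝ) (n : ℕ) : Real.exp (n * R) ≤ numCodewords R n := Nat.le_ceil _

lemma one_lt_numCodewords (hR : 0 < R) (hn : 0 < n) : 1 < numCodewords R n := by
  rw [numCodewords, Nat.lt_ceil, Nat.cast_one]
  exact Real.one_lt_exp_iff.2 (by positivity)

lemma numCodewords_le (hR : 0 < R) (n : ℕ) : (numCodewords R n : ℝ) ≤ 2 * Real.exp (n * R) := by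
  have h1 := (Nat.ceil_lt_add_one (Real.exp_pos (n * R)).le).le
  have h2 : 1 ≤ Real.exp (n * R) := Real.one_le_exp (by positivity)
  rw [numCodewords]; linarith

lemma exp_le_two_mul_numCodewords_sub (hR : 0 < R) (hn : 0 < n) :
    Real.exp (n * R) ≤ 2 * ((numCodewords R n - 1 : ℕ) : ℝ) := by
  have h1 := exp_le_numCodewords R n
  have h2 : (2 : ℝ) ≤ numCodewords R n := by exact_mod_cast one_lt_numCodewords hR hn
  rw [Nat.cast_sub (one_lt_numCodewords hR hn).le]
  push_cast
  linarith

end Codewords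

/-! ### Achievability: union bounds over joint types -/

section UnionBounds

variable {X Y : Type*} [Fintype X] [Fintype Y] {W : X → Y → ℝ} {P : X → ℝ} {R : ℝ}
  {h : (X × Y → ℝ) → EReal}

/-- The probability that one of the other codewords has joint type `Q` with `y` is at most
`e ^ (-n [I(Q) - R]_+)`, up to a subexponential factor. -/
lemma one_sub_pow_le_exp {n : ℕ} (hR : 0 < R) (hn : 0 < n) (hT : (typeClass P n).Nonempty)
    (Q : X × Y → ℝ) (y : Fin n → Y) :
    1 - (1 - typeProb P Q y) ^ (numCodewords R n - 1) ≤
      2 * subexpFactor X Y n * Real.exp (-(n * max (mutualInfo Q - R) 0)) := by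
  have hp0 := typeProb_nonneg P Q y
  have hp1 := typeProb_le_one hT Q y
  have hS := one_le_subexpFactor (X := X) (Y := Y) n
  have hpow : 0 ≤ (1 - typeProb P Q y) ^ (numCodewords R n - 1) := pow_nonneg (by linarith) _
  rcases le_total (mutualInfo Q - R) 0 with hI | hI
  · rw [max_eq_right hI, mul_zero, neg_zero, Real.exp_zero]
    linarith
  · rw [max_eq_left hI]
    have h1 := one_add_mul_le_pow (a := -typeProb P Q y) (by linarith) (numCodewords R n - 1)
    rw [← sub_eq_add_neg] at h1
    have h2 : ((numCodewords R n - 1 : ℕ) : ℝ) ≤ 2 * Real.exp (n * R) :=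
      le_trans (by exact_mod_cast Nat.sub_le _ _) (numCodewords_le hR n)
    have h3 := typeProb_le (P := P) hn Q y
    calc 1 - (1 - typeProb P Q y) ^ (numCodewords R n - 1)
        ≤ ((numCodewords R n - 1 : ℕ) : ℝ) * typeProb P Q y := by linarith
      _ ≤ 2 * Real.exp (n * R) * (subexpFactor X Y n * Real.exp (-(n * mutualInfo Q))) := by gcongr
      _ = 2 * subexpFactor X Y n * (Real.exp (n * R) * Real.exp (-(n * mutualInfo Q))) := by ring
      _ = _ := by rw [← Real.exp_add]; congr 2; ring

lemma card_pairs_jointTypes_le {n : ℕ} {s : Finset ((X × Y → ℝ) × (X × Y → ℝ))}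
    (hs : s ⊆ jointTypes Y P n ×ˢ jointTypes Y P n) :
    (s.card : ℝ) ≤ polyFactor n ^ (2 * Fintype.card (X × Y)) := by
  have h1 : (s.card : ℝ) ≤ (jointTypes Y P n).card * (jointTypes Y P n).card := by
    exact_mod_cast (Finset.card_le_card hs).trans (Finset.card_product _ _).le
  have h2 := card_jointTypes_le (Y := Y) P n
  have h3 := polyFactor_pos n
  calc (s.card : ℝ) ≤ _ := h1
    _ ≤ polyFactor n ^ Fintype.card (X × Y) * polyFactor n ^ Fintype.card (X × Y) := by gcongr
    _ = _ := by rw [← pow_add]; congr 1; ring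

open Classical in
/-- Union bound for the error exponent over the pairs of joint types of the transmitted and of a
competing codeword. -/
lemma le_errorExponent (hW0 : ∀ x y, 0 ≤ W x y) (hR : 0 < R) {r : ℝ}
    (hr : ∀ Qt ∈ admissible W P, ∀ Q ∈ jointDist P, margY Q = margY Qt → logLik W Qt < h Q →
      r ≤ realDiv W P Qt + max (mutualInfo Q - R) 0) :
    (r : EReal) ≤ errorExponent W P R h := by
  set d := Fintype.card (X × Y) + Fintype.card X + Fintype.card Y + 2 with hd
  refine le_exponent (K := 2) two_pos (2 * Fintype.card (X × Y) + 2 * d) fun n hn hT => ?_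
  set M := numCodewords R n with hM
  have hM0 : (0 : ℝ) < M := by exact_mod_cast zero_lt_one.trans (one_lt_numCodewords hR hn)
  set bad : Finset ((X × Y → ℝ) × (X × Y → ℝ)) := (jointTypes Y P n ×ˢ jointTypes Y P n).filter
    (fun p => margY p.2 = margY p.1 ∧ logLik W p.1 < h p.2) with hbad
  have hS := subexpFactor_pos (X := X) (Y := Y) n
  have hpair : ∀ p ∈ bad, ∑ y : Fin n → Y,
      transProb W P p.1 y * (1 - (1 - typeProb P p.2 y) ^ (M - 1)) ≤
        2 * subexpFactor X Y n ^ 2 * Real.exp (-(n * r)) := by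
    rintro ⟨Qt, Q⟩ hp
    simp only [hbad, Finset.mem_filter, Finset.mem_product, jointTypes] at hp
    obtain ⟨⟨⟨_, hQt⟩, ⟨_, hQ⟩⟩, hm, hlt⟩ := hp
    by_cases hadm : Qt ∈ admissible W P
    swap
    · rw [Finset.sum_eq_zero fun y _ => by rw [transProb_eq_zero hQt hadm, zero_mul]]
      positivity
    have hle := hr Qt hadm Q hQ hm hlt
    calc ∑ y : Fin n → Y, transProb W P Qt y * (1 - (1 - typeProb P Q y) ^ (M - 1))
        ≤ ∑ y : Fin n → Y, transProb W P Qt y *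
          (2 * subexpFactor X Y n * Real.exp (-(n * max (mutualInfo Q - R) 0))) :=
          Finset.sum_le_sum fun y _ => mul_le_mul_of_nonneg_left
            (one_sub_pow_le_exp hR hn hT Q y) (transProb_nonneg hW0 P Qt y)
      _ = (∑ y : Fin n → Y, transProb W P Qt y) *
          (2 * subexpFactor X Y n * Real.exp (-(n * max (mutualInfo Q - R) 0))) := by
          rw [Finset.sum_mul]
      _ ≤ subexpFactor X Y n * Real.exp (-(n * realDiv W P Qt)) *
          (2 * subexpFactor X Y n * Real.exp (-(n * max (mutualInfo Q - R) 0))) :=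
          mul_le_mul_of_nonneg_right (sum_transProb_le hW0 hn hadm) (by positivity)
      _ = 2 * subexpFactor X Y n ^ 2 * (Real.exp (-(n * realDiv W P Qt)) *
          Real.exp (-(n * max (mutualInfo Q - R) 0))) := by ring
      _ ≤ _ := by
          rw [← Real.exp_add]
          gcongr
          have := mul_le_mul_of_nonneg_left hle (n.cast_nonneg (α := ℝ))
          linarith
  have hterm : ∀ m : Fin M, ∀ y : Fin n → Y,
      ensembleAvg P n M (fun c => if y ∈ thresholdRegion W h c m then 0 else channelProb W (c m) y)
        ≤ ∑ p ∈ bad, transProb W P p.1 y * (1 - (1 - typeProb P p.2 y) ^ (M - 1)) := by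
    intro m y
    rw [Finset.sum_congr rfl fun p _ => (ensembleAvg_trans_exists hT W p.1 p.2 y m).symm,
      ← ensembleAvg_sum]
    refine ensembleAvg_mono fun c hc => ?_
    have hnn : ∀ p ∈ bad, 0 ≤ if jointEmpirical (c m) y = p.1 ∧
        ∃ l, l ≠ m ∧ jointEmpirical (c l) y = p.2 then channelProb W (c m) y else 0 := by
      intro p _
      split_ifs
      · exact channelProb_nonneg hW0 _ _
      · exact le_rfl
    split_ifs with hy
    · exact Finset.sum_nonneg hnn
    · simp only [thresholdRegion, Set.mem_ofPred_eq] at hy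
      push Not at hy
      obtain ⟨l, hl, hlt⟩ := hy
      have hmem : (jointEmpirical (c m) y, jointEmpirical (c l) y) ∈ bad := by
        simp only [hbad, Finset.mem_filter, Finset.mem_product]
        exact ⟨⟨jointEmpirical_mem_jointTypes hn (hc m) y,
          jointEmpirical_mem_jointTypes hn (hc l) y⟩,
          by rw [margY_jointEmpirical, margY_jointEmpirical], hlt⟩
      refine le_trans ?_ (Finset.single_le_sum hnn hmem)
      rw [if_pos ⟨rfl, l, hl, rfl⟩]
  have hcard : (bad.card : ℝ) ≤ polyFactor n ^ (2 * Fintype.card (X × Y)) :=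
    card_pairs_jointTypes_le (Finset.filter_subset _ _)
  change ensembleAvg P n M (fun c => errorProb W c (thresholdRegion W h c)) ≤ _
  rw [ensembleAvg_errorProb]
  have hm : ∀ m : Fin M, ∑ y, ensembleAvg P n M (fun c =>
      if y ∈ thresholdRegion W h c m then 0 else channelProb W (c m) y) ≤
        2 * polyFactor n ^ (2 * Fintype.card (X × Y) + 2 * d) * Real.exp (-(n * r)) := by
    intro m
    refine (Finset.sum_le_sum fun y _ => hterm m y).trans ?_
    rw [Finset.sum_comm]
    refine (Finset.sum_le_sum hpair).trans ?_
    rw [Finset.sum_const, nsmul_eq_mul]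
    calc (bad.card : ℝ) * (2 * subexpFactor X Y n ^ 2 * Real.exp (-(n * r)))
        ≤ polyFactor n ^ (2 * Fintype.card (X × Y)) *
          (2 * subexpFactor X Y n ^ 2 * Real.exp (-(n * r))) := by gcongr
      _ = _ := by rw [subexpFactor, ← hd]; ring
  refine (mul_le_mul_of_nonneg_left (Finset.sum_le_sum fun m _ => hm m) (by positivity)).trans ?_
  rw [Finset.sum_const, Finset.card_univ, Fintype.card_fin, nsmul_eq_mul, ← mul_assoc,
    one_div_mul_cancel hM0.ne', one_mul]

open Classical in
/-- Union bound for the list size exponent over the pairs of joint types of the transmitted and of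
an erroneous codeword. -/
lemma le_listExponent (hW0 : ∀ x y, 0 ≤ W x y) (hR : 0 < R) {r : ℝ}
    (hr : ∀ Qt ∈ admissible W P, ∀ Q ∈ jointDist P, margY Q = margY Qt → h Qt ≤ logLik W Q →
      r ≤ realDiv W P Qt + (mutualInfo Q - R)) :
    (r : EReal) ≤ listExponent W P R h := by
  set d := Fintype.card (X × Y) + Fintype.card X + Fintype.card Y + 2 with hd
  refine le_exponent (K := 2) two_pos (2 * Fintype.card (X × Y) + 2 * d) fun n hn hT => ?_
  set M := numCodewords R n with hM
  have hM0 : (0 : ℝ) < M := by exact_mod_cast zero_lt_one.trans (one_lt_numCodewords hR hn)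
  set bad : Finset ((X × Y → ℝ) × (X × Y → ℝ)) := (jointTypes Y P n ×ˢ jointTypes Y P n).filter
    (fun p => margY p.2 = margY p.1 ∧ h p.1 ≤ logLik W p.2) with hbad
  have hS := subexpFactor_pos (X := X) (Y := Y) n
  have hpair : ∀ p ∈ bad, ∑ y : Fin n → Y, transProb W P p.1 y * typeProb P p.2 y ≤
        subexpFactor X Y n ^ 2 * Real.exp (-(n * (r + R))) := by
    rintro ⟨Qt, Q⟩ hp
    simp only [hbad, Finset.mem_filter, Finset.mem_product, jointTypes] at hp
    obtain ⟨⟨⟨_, hQt⟩, ⟨_, hQ⟩⟩, hm, hlt⟩ := hp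
    by_cases hadm : Qt ∈ admissible W P
    swap
    · rw [Finset.sum_eq_zero fun y _ => by rw [transProb_eq_zero hQt hadm, zero_mul]]
      positivity
    have hle := hr Qt hadm Q hQ hm hlt
    calc ∑ y : Fin n → Y, transProb W P Qt y * typeProb P Q y
        ≤ ∑ y : Fin n → Y, transProb W P Qt y *
          (subexpFactor X Y n * Real.exp (-(n * mutualInfo Q))) :=
          Finset.sum_le_sum fun y _ => mul_le_mul_of_nonneg_left
            (typeProb_le hn Q y) (transProb_nonneg hW0 P Qt y)
      _ = (∑ y : Fin n → Y, transProb W P Qt y) *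
          (subexpFactor X Y n * Real.exp (-(n * mutualInfo Q))) := by
          rw [Finset.sum_mul]
      _ ≤ subexpFactor X Y n * Real.exp (-(n * realDiv W P Qt)) *
          (subexpFactor X Y n * Real.exp (-(n * mutualInfo Q))) :=
          mul_le_mul_of_nonneg_right (sum_transProb_le hW0 hn hadm) (by positivity)
      _ = subexpFactor X Y n ^ 2 * (Real.exp (-(n * realDiv W P Qt)) *
          Real.exp (-(n * mutualInfo Q))) := by ring
      _ ≤ _ := by
          rw [← Real.exp_add]
          gcongr
          have := mul_le_mul_of_nonneg_left hle (n.cast_nonneg (α := ℝ))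
          linarith
  have hterm : ∀ m l : Fin M, ∀ y : Fin n → Y,
      ensembleAvg P n M (fun c => channelProb W (c m) y *
        (if l ≠ m ∧ y ∈ thresholdRegion W h c l then (1 : ℝ) else 0))
        ≤ ∑ p ∈ bad, transProb W P p.1 y * typeProb P p.2 y := by
    intro m l y
    by_cases hl : l ≠ m
    swap
    · have h1 : ∀ p ∈ bad, 0 ≤ transProb W P p.1 y * typeProb P p.2 y := fun p _ =>
        mul_nonneg (transProb_nonneg hW0 _ _ _) (typeProb_nonneg _ _ _)
      refine le_trans (le_of_eq ?_) (Finset.sum_nonneg h1)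
      simp [hl, ensembleAvg]
    set g : (X × Y → ℝ) × (X × Y → ℝ) → Fin M → (Fin n → X) → ℝ := fun p i =>
      if i = m then (fun x => if jointEmpirical x y = p.1 then channelProb W x y else 0)
      else if i = l then (fun x => if jointEmpirical x y = p.2 then 1 else 0) else fun _ => 1
      with hg
    have hE : ∀ p ∈ bad, transProb W P p.1 y * typeProb P p.2 y =
        ensembleAvg P n M (fun c => ∏ i, g p i (c i)) := fun p _ => by
      rw [hg, ensembleAvg_mul_mul_prod hl, typeAvg_one hT, one_pow, mul_one]; rfl
    have hg0 : ∀ p i x, 0 ≤ g p i x := by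
      intro p i x
      simp only [hg]
      split_ifs
      · dsimp only; split_ifs
        · exact channelProb_nonneg hW0 _ _
        · exact le_rfl
      · dsimp only; split_ifs <;> norm_num
      · norm_num
    rw [Finset.sum_congr rfl hE, ← ensembleAvg_sum]
    refine ensembleAvg_mono fun c hc => ?_
    have hnn : ∀ p ∈ bad, 0 ≤ ∏ i, g p i (c i) := fun p _ => Finset.prod_nonneg fun i _ => hg0 p i _
    split_ifs with hy
    · have hlt := hy.2 m hl.symm
      have hmem : (jointEmpirical (c m) y, jointEmpirical (c l) y) ∈ bad := by
        simp only [hbad, Finset.mem_filter, Finset.mem_product]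
        exact ⟨⟨jointEmpirical_mem_jointTypes hn (hc m) y,
          jointEmpirical_mem_jointTypes hn (hc l) y⟩,
          by rw [margY_jointEmpirical, margY_jointEmpirical], hlt⟩
      refine le_trans (le_of_eq ?_) (Finset.single_le_sum hnn hmem)
      rw [← Finset.mul_prod_erase _ _ (Finset.mem_univ m), Finset.prod_eq_one]
      · simp [hg]
      · intro i hi
        simp only [hg, if_neg (Finset.ne_of_mem_erase hi)]
        split_ifs with hil
        · simp [hil]
        · rfl
    · rw [mul_zero]; exact Finset.sum_nonneg hnn
  have hcard : (bad.card : ℝ) ≤ polyFactor n ^ (2 * Fintype.card (X × Y)) :=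
    card_pairs_jointTypes_le (Finset.filter_subset _ _)
  change ensembleAvg P n M (fun c => listSize W c (thresholdRegion W h c)) ≤ _
  rw [ensembleAvg_listSize]
  set B := polyFactor n ^ (2 * Fintype.card (X × Y)) *
    (subexpFactor X Y n ^ 2 * Real.exp (-(n * (r + R)))) with hB
  have hsum : ∑ y : Fin n → Y, ∑ p ∈ bad, transProb W P p.1 y * typeProb P p.2 y ≤ B := by
    rw [Finset.sum_comm]
    refine (Finset.sum_le_sum hpair).trans ?_
    rw [Finset.sum_const, nsmul_eq_mul]
    exact mul_le_mul_of_nonneg_right hcard (by positivity)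
  calc _ ≤ ∑ y : Fin n → Y, 1 / (M : ℝ) * ∑ m : Fin M, ∑ l : Fin M,
        ∑ p ∈ bad, transProb W P p.1 y * typeProb P p.2 y :=
        Finset.sum_le_sum fun y _ => mul_le_mul_of_nonneg_left
          (Finset.sum_le_sum fun m _ => Finset.sum_le_sum fun l _ => hterm m l y) (by positivity)
    _ = M * ∑ y : Fin n → Y, ∑ p ∈ bad, transProb W P p.1 y * typeProb P p.2 y := by
        rw [Finset.mul_sum]
        refine Finset.sum_congr rfl fun y _ => ?_
        simp only [Finset.sum_const, Finset.card_univ, Fintype.card_fin, nsmul_eq_mul]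
        field_simp
    _ ≤ (2 * Real.exp (n * R)) * B := by
        refine mul_le_mul (numCodewords_le hR n) hsum ?_ (by positivity)
        exact Finset.sum_nonneg fun y _ => Finset.sum_nonneg fun p _ =>
          mul_nonneg (transProb_nonneg hW0 _ _ _) (typeProb_nonneg _ _ _)
    _ = 2 * polyFactor n ^ (2 * Fintype.card (X × Y)) * subexpFactor X Y n ^ 2 *
        (Real.exp (n * R) * Real.exp (-(n * (r + R)))) := by rw [hB]; ring
    _ = _ := by
        have : (n : ℝ) * R + -(n * (r + R)) = -(n * r) := by ring
        rw [← Real.exp_add, this, subexpFactor, ← hd]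
        ring

end UnionBounds

/-! ### Rational distributions are types -/

section RationalTypes

/-- All values of `p` are rational. -/
def IsRational {A : Type*} (p : A → ℝ) : Prop := ∀ a, ∃ q : ℚ, p a = q

variable {A : Type*} [Fintype A] {X Y : Type*} [Fintype X] [Fintype Y]

lemma isRational_empirical {A : Type*} {n : ℕ} (w : Fin n → A) : IsRational (empirical w) :=
  fun a => ⟨(letterCount w a : ℚ) / n, by rw [empirical_apply]; push_cast; rfl⟩

/-- Every assignment of counts that sum to `n` is realized by a word of length `n`. -/
lemma exists_word_of_counts {n : ℕ} (k : A → ℕ) (hk : ∑ a, k a = n) :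
    ∃ w : Fin n → A, ∀ a, letterCount w a = k a := by
  classical
  have hc : Fintype.card (Fin n) = Fintype.card (Σ a, Fin (k a)) := by
    rw [Fintype.card_sigma, Fintype.card_fin]
    simp [hk]
  let e := Fintype.equivOfCardEq hc
  refine ⟨fun i => (e i).1, fun a => ?_⟩
  have : letterCount (fun i => (e i).1) a =
      (Finset.univ.filter (fun s : Σ a, Fin (k a) => s.1 = a)).card := by
    refine Finset.card_bij (fun i _ => e i) ?_ ?_ ?_
    · intro i hi; simpa using hi
    · intro i _ j _ hij; exact e.injective hij
    · intro s hs; exact ⟨e.symm s, by simpa using hs, by simp⟩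
  rw [this, ← Fintype.card_subtype, Fintype.card_congr (Equiv.sigmaSubtype a), Fintype.card_fin]

/-- A rational distribution is a type at all multiples of some block length. -/
lemma IsRational.exists_word {p : A → ℝ} (hp : IsRational p) (hs : p ∈ stdSimplex ℝ A) :
    ∃ N : ℕ, 0 < N ∧ ∀ j : ℕ, 0 < j → ∃ w : Fin (N * j) → A, empirical w = p := by
  choose q hq using hp
  have hq0 : ∀ a, 0 ≤ q a := fun a => by
    have := hs.1 a; rw [hq] at this; exact_mod_cast this
  refine ⟨∏ a, (q a).den, Finset.prod_pos fun a _ => (q a).pos, fun j hj => ?_⟩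
  set N := ∏ a, (q a).den with hN
  have hNpos : 0 < N := Finset.prod_pos fun a _ => (q a).pos
  have hk : ∀ a, ∃ k : ℕ, (k : ℚ) = q a * (N * j : ℕ) := fun a => by
    obtain ⟨c, hc⟩ := Finset.dvd_prod_of_mem (fun a => (q a).den) (Finset.mem_univ a)
    refine ⟨(q a).num.toNat * c * j, ?_⟩
    have h1 : ((q a).num.toNat : ℚ) = (q a).num := by
      have : ((q a).num.toNat : ℤ) = (q a).num := Int.toNat_of_nonneg (Rat.num_nonneg.2 (hq0 a))
      exact_mod_cast this
    have h2 : q a * (q a).den = (q a).num := Rat.mul_den_eq_num _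
    rw [hN, hc]
    push_cast
    rw [h1, ← h2]; ring
  choose k hk using hk
  have hkr : ∀ a, (k a : ℝ) = p a * (N * j : ℕ) := fun a => by
    rw [hq]; exact_mod_cast congrArg (fun t : ℚ => (t : ℝ)) (hk a)
  have hsum : ∑ a, k a = N * j := by
    have : ∑ a, (k a : ℝ) = (N * j : ℕ) := by
      rw [Finset.sum_congr rfl fun a _ => hkr a, ← Finset.sum_mul, hs.2, one_mul]
    exact_mod_cast this
  obtain ⟨w, hw⟩ := exists_word_of_counts k hsum
  have hpos : ((N * j : ℕ) : ℝ) ≠ 0 := by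
    have := Nat.mul_pos hNpos hj
    positivity
  refine ⟨w, funext fun a => ?_⟩
  rw [empirical_apply, hw, hkr, mul_div_assoc, div_self hpos, mul_one]

/-- Two rational joint distributions are joint types at all multiples of a common block length. -/
lemma exists_common_words {P : X → ℝ} {Q Q' : X × Y → ℝ} (hQ : Q ∈ jointDist P)
    (hQ' : Q' ∈ jointDist P) (hr : IsRational Q) (hr' : IsRational Q') :
    ∃ N : ℕ, 0 < N ∧ ∀ j : ℕ, 0 < j →
      (∃ x ∈ typeClass P (N * j), ∃ y, jointEmpirical x y = Q) ∧
      ∃ x ∈ typeClass P (N * j), ∃ y, jointEmpirical x y = Q' := by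
  obtain ⟨N₁, h₁, hw₁⟩ := hr.exists_word hQ.1
  obtain ⟨N₂, h₂, hw₂⟩ := hr'.exists_word hQ'.1
  have key : ∀ {n : ℕ} {Q : X × Y → ℝ}, Q ∈ jointDist P → (∃ w : Fin n → X × Y, empirical w = Q) →
      ∃ x ∈ typeClass P n, ∃ y, jointEmpirical x y = Q := by
    rintro n Q hQ ⟨w, hw⟩
    have hj : jointEmpirical (fun i => (w i).1) (fun i => (w i).2) = Q := hw
    exact ⟨_, mem_typeClass.2 (by rw [← margX_jointEmpirical _ (fun i => (w i).2), hj, hQ.2]),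
      _, hj⟩
  refine ⟨N₁ * N₂, Nat.mul_pos h₁ h₂, fun j hj => ⟨key hQ ?_, key hQ' ?_⟩⟩
  · have := hw₁ (N₂ * j) (Nat.mul_pos h₂ hj)
    rwa [← mul_assoc] at this
  · have := hw₂ (N₁ * j) (Nat.mul_pos h₁ hj)
    rwa [← mul_assoc, mul_comm N₂] at this

end RationalTypes

/-! ### Lower bounds from single pairs of joint types -/

section LowerBounds

variable {X Y : Type*} [Fintype X] [Fintype Y] {W : X → Y → ℝ} {P : X → ℝ} {R : ℝ}
  {h : (X × Y → ℝ) → EReal}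

/-- At least one of `k` independent events of probability `p` occurs with probability at least
`min 1 (k p) / 2`. -/
lemma min_one_le_two_mul_one_sub_pow {p : ℝ} (h0 : 0 ≤ p) (h1 : p ≤ 1) (k : ℕ) :
    min 1 (k * p) ≤ 2 * (1 - (1 - p) ^ k) := by
  set u := (k : ℝ) * p with hu
  have hu0 : 0 ≤ u := by positivity
  have h2 : (1 - p) ^ k ≤ Real.exp (-u) := by
    have : 1 - p ≤ Real.exp (-p) := by linarith [Real.add_one_le_exp (-p)]
    calc (1 - p) ^ k ≤ Real.exp (-p) ^ k := pow_le_pow_left₀ (by linarith) this k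
      _ = _ := by rw [← Real.exp_nat_mul]; congr 1; ring
  have h3 : Real.exp (-u) * (1 + u) ≤ 1 := by
    rw [Real.exp_neg, inv_mul_le_iff₀ (Real.exp_pos _)]
    linarith [Real.add_one_le_exp u]
  have h4 : (1 - Real.exp (-u)) * (1 + u) ≥ u := by nlinarith
  have h5 : 0 ≤ 1 - Real.exp (-u) := by
    have := Real.exp_le_one_iff.2 (neg_nonpos.2 hu0)
    linarith
  rcases le_total u 1 with hu1 | hu1
  · have := min_le_right (1 : ℝ) u
    nlinarith
  · have := min_le_left (1 : ℝ) u
    nlinarith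

lemma exp_le_one_sub_pow {n : ℕ} (hR : 0 < R) (hn : 0 < n) {x₀ : Fin n → X}
    (hx₀ : x₀ ∈ typeClass P n) {y₀ y : Fin n → Y} (hy : empirical y = empirical y₀)
    {Q : X × Y → ℝ} (hQ : jointEmpirical x₀ y₀ = Q) :
    Real.exp (-(n * max (mutualInfo Q - R) 0)) ≤
      4 * subexpFactor X Y n * (1 - (1 - typeProb P Q y) ^ (numCodewords R n - 1)) := by
  have hS := one_le_subexpFactor (X := X) (Y := Y) n
  have h1 := le_typeProb hn hx₀ hy hQ
  have h2 := exp_le_two_mul_numCodewords_sub hR hn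
  have h3 := min_one_le_two_mul_one_sub_pow (typeProb_nonneg P Q y)
    (typeProb_le_one ⟨x₀, hx₀⟩ Q y) (numCodewords R n - 1)
  set k := ((numCodewords R n - 1 : ℕ) : ℝ)
  have h4 : Real.exp (-(n * max (mutualInfo Q - R) 0)) ≤
      2 * subexpFactor X Y n * min 1 (k * typeProb P Q y) := by
    rw [mul_min_of_nonneg _ _ (by positivity)]
    refine le_min ?_ ?_
    · have : Real.exp (-(n * max (mutualInfo Q - R) 0)) ≤ 1 :=
        Real.exp_le_one_iff.2 (neg_nonpos.2 (mul_nonneg n.cast_nonneg (le_max_right _ _)))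
      linarith
    · calc Real.exp (-(n * max (mutualInfo Q - R) 0))
          ≤ Real.exp (n * R) * Real.exp (-(n * mutualInfo Q)) := by
            rw [← Real.exp_add]
            gcongr
            have := mul_le_mul_of_nonneg_left (le_max_left (mutualInfo Q - R) 0)
              (n.cast_nonneg (α := ℝ))
            linarith
        _ ≤ 2 * k * (subexpFactor X Y n * typeProb P Q y) := by gcongr
        _ = _ := by ring
  calc _ ≤ _ := h4
    _ ≤ 2 * subexpFactor X Y n * (2 * (1 - (1 - typeProb P Q y) ^ (numCodewords R n - 1))) := by
      gcongr
    _ = _ := by ring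

open Classical in
/-- A pair of rational joint distributions of the transmitted and of a competing codeword for which
the decoder errs bounds its error exponent from above. -/
lemma errorExponent_le (hW0 : ∀ x y, 0 ≤ W x y) (hR : 0 < R) {Qt Q : X × Y → ℝ}
    (hQt : Qt ∈ admissible W P) (hQ : Q ∈ jointDist P) (hm : margY Q = margY Qt)
    (hrt : IsRational Qt) (hr : IsRational Q) (hlt : logLik W Qt < h Q) :
    errorExponent W P R h ≤ ((realDiv W P Qt + max (mutualInfo Q - R) 0 : ℝ) : EReal) := by
  set d := Fintype.card (X × Y) + Fintype.card X + Fintype.card Y + 2 with hd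
  obtain ⟨N, hN, hw⟩ := exists_common_words hQt.1 hQ hrt hr
  refine exponent_le (K := 4) four_pos (2 * d) hN ?_
  filter_upwards [eventually_gt_atTop 0] with j hj
  obtain ⟨⟨x₁, hx₁, y₁, hQt'⟩, ⟨x₀, hx₀, y₀, hQ'⟩⟩ := hw j hj
  have hn : 0 < N * j := Nat.mul_pos hN hj
  generalize N * j = n at *
  have hT : (typeClass P n).Nonempty := ⟨x₀, hx₀⟩
  refine ⟨hT, ?_⟩
  set M := numCodewords R n with hM
  have hM0 : (0 : ℝ) < M := by exact_mod_cast zero_lt_one.trans (one_lt_numCodewords hR hn)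
  have hS := subexpFactor_pos (X := X) (Y := Y) n
  rw [ensembleAvg_errorProb]
  have hterm : ∀ (m : Fin M) (y : Fin n → Y),
      transProb W P Qt y * (1 - (1 - typeProb P Q y) ^ (M - 1)) ≤ ensembleAvg P n M (fun c =>
        if y ∈ thresholdRegion W h c m then 0 else channelProb W (c m) y) := by
    intro m y
    rw [← ensembleAvg_trans_exists hT W Qt Q y m]
    refine ensembleAvg_mono fun c hc => ?_
    split_ifs with h1 h2
    · obtain ⟨hm', l, hl, hlQ⟩ := h1
      have := h2 l hl
      rw [hm', hlQ] at this
      exact absurd hlt (not_lt.2 this)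
    · exact le_rfl
    · exact le_rfl
    · exact channelProb_nonneg hW0 _ _
  have hy : ∀ y : Fin n → Y, transProb W P Qt y * Real.exp (-(n * max (mutualInfo Q - R) 0)) ≤
      4 * subexpFactor X Y n *
        (transProb W P Qt y * (1 - (1 - typeProb P Q y) ^ (M - 1))) := by
    intro y
    by_cases hyt : empirical y = margY Qt
    · have hy0 : empirical y = empirical y₀ := by
        rw [hyt, ← hm, ← hQ', margY_jointEmpirical]
      have := mul_le_mul_of_nonneg_left (exp_le_one_sub_pow hR hn hx₀ hy0 hQ')
        (transProb_nonneg hW0 P Qt y)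
      linarith
    · simp [transProb_eq_zero_of_margY hyt]
  have hm : ∀ m : Fin M, Real.exp (-(n * (realDiv W P Qt + max (mutualInfo Q - R) 0))) ≤
      4 * subexpFactor X Y n ^ 2 * ∑ y, ensembleAvg P n M (fun c =>
        if y ∈ thresholdRegion W h c m then 0 else channelProb W (c m) y) := by
    intro m
    calc Real.exp (-(n * (realDiv W P Qt + max (mutualInfo Q - R) 0)))
        = Real.exp (-(n * realDiv W P Qt)) * Real.exp (-(n * max (mutualInfo Q - R) 0)) := by
          rw [← Real.exp_add]; congr 1; ring
      _ ≤ (subexpFactor X Y n * ∑ y : Fin n → Y, transProb W P Qt y) *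
          Real.exp (-(n * max (mutualInfo Q - R) 0)) := by
          gcongr
          exact le_sum_transProb hW0 hn hQt hQt'
      _ = subexpFactor X Y n * ∑ y : Fin n → Y, transProb W P Qt y *
          Real.exp (-(n * max (mutualInfo Q - R) 0)) := by rw [mul_assoc, Finset.sum_mul]
      _ ≤ subexpFactor X Y n * ∑ y : Fin n → Y, 4 * subexpFactor X Y n *
          ensembleAvg P n M (fun c =>
            if y ∈ thresholdRegion W h c m then 0 else channelProb W (c m) y) := by
          refine mul_le_mul_of_nonneg_left (Finset.sum_le_sum fun y _ => ?_) hS.le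
          exact (hy y).trans (mul_le_mul_of_nonneg_left (hterm m y) (by positivity))
      _ = _ := by rw [← Finset.mul_sum]; ring
  have hsum := Finset.sum_le_sum fun m (_ : m ∈ (Finset.univ : Finset (Fin M))) => hm m
  rw [Finset.sum_const, Finset.card_univ, Fintype.card_fin, nsmul_eq_mul, ← Finset.mul_sum] at hsum
  have hS2 : polyFactor n ^ (2 * d) = subexpFactor X Y n ^ 2 := by
    rw [subexpFactor, ← hd]; ring
  rw [hS2]
  rw [← le_div_iff₀' hM0] at hsum
  refine hsum.trans (le_of_eq ?_)
  ring

open Classical in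
/-- Let `Qt` and `Q` be rational. If an erroneous codeword of joint type `Q` reaches the threshold
at the joint type `Qt` of the transmitted codeword, and the thresholds at all joint types whose mutual
information is at most `R + δ`, then `Qt` and `Q` bound the list size exponent from above: further
codewords of the other joint types do not occur, except with exponentially small probability. -/
lemma listExponent_le (hW0 : ∀ x y, 0 ≤ W x y) (hR : 0 < R) {Qt Q : X × Y → ℝ}
    (hQt : Qt ∈ admissible W P) (hQ : Q ∈ jointDist P) (hm : margY Q = margY Qt)
    (hrt : IsRational Qt) (hr : IsRational Q) (hle : h Qt ≤ logLik W Q) {δ : ℝ} (hδ : 0 < δ)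
    (hother : ∀ Q'' ∈ jointDist P, margY Q'' = margY Q → IsRational Q'' →
      mutualInfo Q'' ≤ R + δ → h Q'' ≤ logLik W Q) :
    listExponent W P R h ≤ ((realDiv W P Qt + (mutualInfo Q - R) : ℝ) : EReal) := by
  set d := Fintype.card (X × Y) + Fintype.card X + Fintype.card Y + 2 with hd
  obtain ⟨N, hN, hw⟩ := exists_common_words hQt.1 hQ hrt hr
  refine exponent_le (K := 4) four_pos (2 * d) hN ?_
  have hNj : Tendsto (fun j : ℕ => N * j) atTop atTop := tendsto_id.const_mul_atTop' hN
  filter_upwards [eventually_gt_atTop 0, hNj.eventually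
    (mul_polyFactor_pow_le_exp (K := 4) four_pos (Fintype.card (X × Y) + d) hδ)] with j hj hbig
  obtain ⟨⟨x₁, hx₁, y₁, hQt'⟩, ⟨x₀, hx₀, y₀, hQ'⟩⟩ := hw j hj
  have hn : 0 < N * j := Nat.mul_pos hN hj
  generalize N * j = n at *
  have hT : (typeClass P n).Nonempty := ⟨x₀, hx₀⟩
  refine ⟨hT, ?_⟩
  set M := numCodewords R n with hM
  have hM1 : 1 < M := one_lt_numCodewords hR hn
  have hM0 : (0 : ℝ) < M := by exact_mod_cast zero_lt_one.trans hM1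
  have hS := subexpFactor_pos (X := X) (Y := Y) n
  set quiet : (Fin n → Y) → (Fin n → X) → ℝ :=
    fun y x => if h (jointEmpirical x y) ≤ logLik W Q then 1 else 0 with hquiet
  have hquiet1 : ∀ y, typeAvg P n (quiet y) ≤ 1 := fun y => by
    rw [← typeAvg_one hT]
    refine typeAvg_mono fun x _ => ?_
    simp only [hquiet]; split_ifs <;> norm_num
  -- By the union bound, a fixed codeword interferes with probability at most
  -- `e ^ (-n (R + δ))` up to a subexponential factor.
  have hloud : ∀ y : Fin n → Y, empirical y = margY Q →
      1 - typeAvg P n (quiet y) ≤ polyFactor n ^ (Fintype.card (X × Y) + d) *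
        Real.exp (-(n * (R + δ))) := by
    intro y hy
    rw [← typeAvg_one hT, ← typeAvg_sub]
    set loud := (jointTypes Y P n).filter (fun Q'' => R + δ < mutualInfo Q'')
    have h1 : typeAvg P n (fun x => 1 - quiet y x) ≤ ∑ Q'' ∈ loud, typeProb P Q'' y := by
      simp only [typeProb]
      rw [← typeAvg_sum]
      refine typeAvg_mono fun x hx => ?_
      have hnn : ∀ Q'' ∈ loud, (0 : ℝ) ≤ if jointEmpirical x y = Q'' then 1 else 0 :=
        fun _ _ => by split_ifs <;> norm_num
      simp only [hquiet]
      split_ifs with hq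
      · rw [sub_self]; exact Finset.sum_nonneg hnn
      · have hmem : jointEmpirical x y ∈ loud := by
          refine Finset.mem_filter.2 ⟨jointEmpirical_mem_jointTypes hn hx y, ?_⟩
          by_contra hI
          exact hq (hother _ (jointEmpirical_mem_jointDist hn hx y)
            (by rw [margY_jointEmpirical, hy]) (isRational_empirical _) (not_lt.1 hI))
        refine le_trans ?_ (Finset.single_le_sum hnn hmem)
        simp
    refine h1.trans ?_
    have h2 : ∀ Q'' ∈ loud, typeProb P Q'' y ≤ polyFactor n ^ d * Real.exp (-(n * (R + δ))) := by
      intro Q'' hQ''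
      refine (typeProb_le hn Q'' y).trans ?_
      rw [subexpFactor, ← hd]
      have := (Finset.mem_filter.1 hQ'').2
      have hp := polyFactor_pos n
      gcongr
    refine (Finset.sum_le_sum h2).trans ?_
    rw [Finset.sum_const, nsmul_eq_mul, pow_add _ (Fintype.card (X × Y)) d, mul_assoc]
    have hp := polyFactor_pos n
    have hpos : 0 ≤ polyFactor n ^ d * Real.exp (-(n * (R + δ))) := by positivity
    refine mul_le_mul_of_nonneg_right (le_trans ?_ (card_jointTypes_le (Y := Y) P n)) hpos
    exact_mod_cast Finset.card_filter_le _ _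
  -- All other codewords stay quiet with probability at least `1 / 2`, by Bernoulli's inequality.
  have hhalf : ∀ y : Fin n → Y, empirical y = margY Q →
      1 / 2 ≤ typeAvg P n (quiet y) ^ (M - 2) := by
    intro y hy
    have h0 : 0 ≤ typeAvg P n (quiet y) := typeAvg_nonneg fun x => by
      simp only [hquiet]; split_ifs <;> norm_num
    have h1 := one_add_mul_le_pow (a := typeAvg P n (quiet y) - 1) (by linarith) (M - 2)
    rw [add_sub_cancel] at h1
    have h2 : ((M - 2 : ℕ) : ℝ) ≤ 2 * Real.exp (n * R) :=
      le_trans (by exact_mod_cast Nat.sub_le _ _) (numCodewords_le hR n)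
    have h3 : ((M - 2 : ℕ) : ℝ) * (1 - typeAvg P n (quiet y)) ≤ 1 / 2 := by
      calc ((M - 2 : ℕ) : ℝ) * (1 - typeAvg P n (quiet y))
          ≤ (2 * Real.exp (n * R)) * (polyFactor n ^ (Fintype.card (X × Y) + d) *
            Real.exp (-(n * (R + δ)))) :=
            mul_le_mul h2 (hloud y hy) (by linarith [hquiet1 y]) (by positivity)
        _ = 1 / 2 * (4 * polyFactor n ^ (Fintype.card (X × Y) + d)) *
            (Real.exp (n * R) * Real.exp (-(n * (R + δ)))) := by ring
        _ ≤ 1 / 2 * Real.exp (n * δ) * (Real.exp (n * R) * Real.exp (-(n * (R + δ)))) := by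
            gcongr
        _ = 1 / 2 := by
            rw [mul_assoc, ← Real.exp_add, ← Real.exp_add]
            have : (n : ℝ) * δ + (n * R + -(n * (R + δ))) = 0 := by ring
            rw [this, Real.exp_zero, mul_one]
    linarith
  have hterm : ∀ (m l : Fin M), l ≠ m → ∀ (y : Fin n → Y),
      transProb W P Qt y * typeProb P Q y * typeAvg P n (quiet y) ^ (M - 2) ≤
      ensembleAvg P n M (fun c => channelProb W (c m) y *
        (if l ≠ m ∧ y ∈ thresholdRegion W h c l then (1 : ℝ) else 0)) := by
    intro m l hl y
    rw [transProb, typeProb, ← ensembleAvg_mul_mul_prod hl]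
    refine ensembleAvg_mono fun c hc => ?_
    set g : Fin M → (Fin n → X) → ℝ := fun i =>
      if i = m then (fun x => if jointEmpirical x y = Qt then channelProb W x y else 0)
      else if i = l then (fun x => if jointEmpirical x y = Q then 1 else 0) else quiet y with hg
    have hgm : g m (c m) = if jointEmpirical (c m) y = Qt then channelProb W (c m) y else 0 := by
      simp [hg]
    have hgl : g l (c l) = if jointEmpirical (c l) y = Q then 1 else 0 := by
      simp [hg, hl]
    have hgo : ∀ i, i ≠ m → i ≠ l → g i (c i) =
        if h (jointEmpirical (c i) y) ≤ logLik W Q then 1 else 0 := by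
      intro i him hil; simp [hg, him, hil, hquiet]
    have hrhs : 0 ≤ channelProb W (c m) y *
        (if l ≠ m ∧ y ∈ thresholdRegion W h c l then (1 : ℝ) else 0) :=
      mul_nonneg (channelProb_nonneg hW0 _ _) (by split_ifs <;> norm_num)
    by_cases hcm : jointEmpirical (c m) y = Qt
    swap
    · have hz : ∏ i, g i (c i) = 0 :=
        Finset.prod_eq_zero (Finset.mem_univ m) (by rw [hgm, if_neg hcm])
      exact hz.trans_le hrhs
    by_cases hcl : jointEmpirical (c l) y = Q
    swap
    · have hz : ∏ i, g i (c i) = 0 :=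
        Finset.prod_eq_zero (Finset.mem_univ l) (by rw [hgl, if_neg hcl])
      exact hz.trans_le hrhs
    by_cases hco : ∀ i, i ≠ m → i ≠ l → h (jointEmpirical (c i) y) ≤ logLik W Q
    swap
    · push Not at hco
      obtain ⟨i, him, hil, hi⟩ := hco
      have hz : ∏ i, g i (c i) = 0 :=
        Finset.prod_eq_zero (Finset.mem_univ i) (by rw [hgo i him hil, if_neg (not_le.2 hi)])
      exact hz.trans_le hrhs
    have hy : y ∈ thresholdRegion W h c l := by
      intro i hil
      rw [hcl]
      by_cases him : i = m
      · rw [him, hcm]; exact hle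
      · exact hco i him hil
    rw [if_pos ⟨hl, hy⟩, mul_one]
    have : ∏ i, g i (c i) = channelProb W (c m) y := by
      rw [← Finset.mul_prod_erase _ _ (Finset.mem_univ m), hgm, if_pos hcm, Finset.prod_eq_one,
        mul_one]
      intro i hi
      have him := Finset.ne_of_mem_erase hi
      by_cases hil : i = l
      · rw [hil, hgl, if_pos hcl]
      · rw [hgo i him hil, if_pos (hco i him hil)]
    exact this.le
  have hy : ∀ y : Fin n → Y, transProb W P Qt y * Real.exp (-(n * mutualInfo Q)) ≤
      2 * subexpFactor X Y n *
        (transProb W P Qt y * typeProb P Q y * typeAvg P n (quiet y) ^ (M - 2)) := by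
    intro y
    by_cases hyt : empirical y = margY Qt
    · have hy0 : empirical y = empirical y₀ := by
        rw [hyt, ← hm, ← hQ', margY_jointEmpirical]
      have h1 := mul_le_mul_of_nonneg_left (le_typeProb hn hx₀ hy0 hQ')
        (transProb_nonneg hW0 P Qt y)
      have h2 := mul_le_mul_of_nonneg_left (hhalf y (by rw [hyt, hm]))
        (mul_nonneg hS.le (mul_nonneg (transProb_nonneg hW0 P Qt y) (typeProb_nonneg P Q y)))
      linarith
    · simp [transProb_eq_zero_of_margY hyt]
  set avg := ensembleAvg P n M (fun c => listSize W c (thresholdRegion W h c)) with havg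
  have hlow : ((M - 1 : ℕ) : ℝ) * ∑ y : Fin n → Y,
      (transProb W P Qt y * typeProb P Q y * typeAvg P n (quiet y) ^ (M - 2)) ≤ avg := by
    rw [havg, ensembleAvg_listSize, Finset.mul_sum]
    refine Finset.sum_le_sum fun y _ => ?_
    set t := transProb W P Qt y * typeProb P Q y * typeAvg P n (quiet y) ^ (M - 2) with ht
    have hml : ∀ m : Fin M, ((M - 1 : ℕ) : ℝ) * t ≤ ∑ l, ensembleAvg P n M (fun c =>
        channelProb W (c m) y *
        (if l ≠ m ∧ y ∈ thresholdRegion W h c l then (1 : ℝ) else 0)) := by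
      intro m
      have h1 : ((M - 1 : ℕ) : ℝ) * t = ∑ l ∈ Finset.univ.erase m, t := by
        rw [Finset.sum_const, Finset.card_erase_of_mem (Finset.mem_univ m), Finset.card_univ,
          Fintype.card_fin, nsmul_eq_mul]
      rw [h1]
      refine (Finset.sum_le_sum fun l hl => hterm m l (Finset.ne_of_mem_erase hl) y).trans ?_
      refine Finset.sum_le_sum_of_subset_of_nonneg (Finset.erase_subset _ _) fun l _ _ => ?_
      refine div_nonneg (Finset.sum_nonneg fun c _ => ?_) (by positivity)
      exact mul_nonneg (channelProb_nonneg hW0 _ _) (by split_ifs <;> norm_num)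
    have h2 := Finset.sum_le_sum fun m (_ : m ∈ (Finset.univ : Finset (Fin M))) => hml m
    rw [Finset.sum_const, Finset.card_univ, Fintype.card_fin, nsmul_eq_mul] at h2
    rw [one_div, le_inv_mul_iff₀ hM0]
    exact h2
  have hS2 : polyFactor n ^ (2 * d) = subexpFactor X Y n ^ 2 := by
    rw [subexpFactor, ← hd]; ring
  rw [hS2]
  calc Real.exp (-(n * (realDiv W P Qt + (mutualInfo Q - R))))
      = Real.exp (n * R) * (Real.exp (-(n * realDiv W P Qt)) * Real.exp (-(n * mutualInfo Q))) := by
        rw [← Real.exp_add, ← Real.exp_add]; congr 1; ring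
    _ ≤ (2 * ((M - 1 : ℕ) : ℝ)) * ((subexpFactor X Y n * ∑ y : Fin n → Y, transProb W P Qt y) *
          Real.exp (-(n * mutualInfo Q))) := by
        have h1 := le_sum_transProb hW0 hn hQt hQt'
        have h2 := exp_le_two_mul_numCodewords_sub hR hn
        gcongr
    _ = 2 * ((M - 1 : ℕ) : ℝ) * subexpFactor X Y n * ∑ y : Fin n → Y, transProb W P Qt y *
          Real.exp (-(n * mutualInfo Q)) := by rw [← Finset.sum_mul]; ring
    _ ≤ 2 * ((M - 1 : ℕ) : ℝ) * subexpFactor X Y n * ∑ y : Fin n → Y, 2 * subexpFactor X Y n *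
        (transProb W P Qt y * typeProb P Q y * typeAvg P n (quiet y) ^ (M - 2)) := by
        exact mul_le_mul_of_nonneg_left (Finset.sum_le_sum fun y _ => hy y) (by positivity)
    _ = 4 * subexpFactor X Y n ^ 2 * (((M - 1 : ℕ) : ℝ) * ∑ y : Fin n → Y,
        (transProb W P Qt y * typeProb P Q y * typeAvg P n (quiet y) ^ (M - 2))) := by
        rw [← Finset.mul_sum]; ring
    _ ≤ _ := by gcongr

end LowerBounds

/-! ### Continuity and convexity of the information quantities -/

section Analysis

variable {X Y : Type*} [Fintype X] [Fintype Y] {W : X → Y → ℝ} {P : X → ℝ}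

lemma continuous_margX : Continuous (margX : (X × Y → ℝ) → X → ℝ) :=
  continuous_pi fun _ => continuous_finsetSum _ fun _ _ => continuous_apply _

lemma continuous_margY : Continuous (margY : (X × Y → ℝ) → Y → ℝ) :=
  continuous_pi fun _ => continuous_finsetSum _ fun _ _ => continuous_apply _

lemma continuous_entropy {A : Type*} [Fintype A] : Continuous (entropy : (A → ℝ) → ℝ) :=
  continuous_finsetSum _ fun a _ => Real.continuous_negMulLog.comp (continuous_apply a)

lemma continuous_realLogLik (W : X → Y → ℝ) : Continuous (realLogLik W) :=
  continuous_finsetSum _ fun _ _ => continuous_finsetSum _ fun _ _ =>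
    (continuous_apply _).mul continuous_const

lemma continuous_realDiv (W : X → Y → ℝ) (P : X → ℝ) : Continuous (realDiv W P) :=
  (continuous_const.sub continuous_entropy).sub (continuous_realLogLik W)

lemma continuousOn_mutualInfo : ContinuousOn mutualInfo {Q : X × Y → ℝ | ∀ p, 0 ≤ Q p} := by
  have h : Continuous fun Q : X × Y → ℝ => entropy (margX Q) + entropy (margY Q) - entropy Q :=
    ((continuous_entropy.comp continuous_margX).add (continuous_entropy.comp continuous_margY)).sub
      continuous_entropy
  exact h.continuousOn.congr fun Q hQ => mutualInfo_eq_entropy hQ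

/-- Sequential continuity of the mutual information on non-negative weights. -/
lemma tendsto_mutualInfo {ι : Type*} {l : Filter ι} {u : ι → X × Y → ℝ} {Q : X × Y → ℝ}
    (hu : Tendsto u l (nhds Q)) (h0 : ∀ᶠ i in l, ∀ p, 0 ≤ u i p) (hQ : ∀ p, 0 ≤ Q p) :
    Tendsto (fun i => mutualInfo (u i)) l (nhds (mutualInfo Q)) :=
  (continuousOn_mutualInfo Q hQ).tendsto.comp
    (tendsto_nhdsWithin_iff.2 ⟨hu, h0⟩)

lemma isClosed_jointDist (P : X → ℝ) : IsClosed (jointDist P : Set (X × Y → ℝ)) :=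
  (isClosed_stdSimplex ℝ _).inter (isClosed_singleton.preimage continuous_margX)

lemma isCompact_jointDist (P : X → ℝ) : IsCompact (jointDist P : Set (X × Y → ℝ)) :=
  (isCompact_stdSimplex ℝ (X × Y)).of_isClosed_subset (isClosed_jointDist P) fun _ h => h.1

lemma isCompact_admissible (W : X → Y → ℝ) (P : X → ℝ) : IsCompact (admissible W P) := by
  have h : {Q : X × Y → ℝ | ∀ x y, W x y = 0 → Q (x, y) = 0} =
      ⋂ x, ⋂ y, ⋂ _ : W x y = 0, {Q | Q (x, y) = 0} := by
    ext; simp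
  have hc : IsClosed {Q : X × Y → ℝ | ∀ x y, W x y = 0 → Q (x, y) = 0} := by
    rw [h]
    exact isClosed_iInter fun x => isClosed_iInter fun y => isClosed_iInter fun _ =>
      isClosed_singleton.preimage (continuous_apply (x, y))
  exact (isCompact_jointDist P).of_isClosed_subset ((isClosed_jointDist P).inter hc) fun _ h => h.1

lemma margX_add_smul (a b : ℝ) (Q Q' : X × Y → ℝ) :
    margX (a • Q + b • Q') = a • margX Q + b • margX Q' := by
  funext x
  simp [margX, Finset.sum_add_distrib, Finset.mul_sum]

lemma margY_add_smul (a b : ℝ) (Q Q' : X × Y → ℝ) :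
    margY (a • Q + b • Q') = a • margY Q + b • margY Q' := by
  funext x
  simp [margY, Finset.sum_add_distrib, Finset.mul_sum]

lemma realLogLik_add_smul (a b : ℝ) (Q Q' : X × Y → ℝ) :
    realLogLik W (a • Q + b • Q') = a * realLogLik W Q + b * realLogLik W Q' := by
  simp only [realLogLik, Finset.mul_sum, ← Finset.sum_add_distrib]
  refine Finset.sum_congr rfl fun x _ => Finset.sum_congr rfl fun y _ => ?_
  simp only [Pi.add_apply, Pi.smul_apply, smul_eq_mul]
  ring

lemma convex_jointDist (P : X → ℝ) : Convex ℝ (jointDist P : Set (X × Y → ℝ)) := by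
  intro Q hQ Q' hQ' a b ha hb hab
  refine ⟨convex_stdSimplex ℝ _ hQ.1 hQ'.1 ha hb hab, ?_⟩
  rw [margX_add_smul, hQ.2, hQ'.2, ← add_smul, hab, one_smul]

lemma convex_admissible (W : X → Y → ℝ) (P : X → ℝ) : Convex ℝ (admissible W P) := by
  intro Q hQ Q' hQ' a b ha hb hab
  refine ⟨convex_jointDist P hQ.1 hQ'.1 ha hb hab, fun x y hw => ?_⟩
  simp [hQ.2 x y hw, hQ'.2 x y hw]

/-- The two-term log-sum inequality. -/
lemma log_sum_inequality {a₁ a₂ b₁ b₂ : ℝ} (ha₁ : 0 ≤ a₁) (ha₂ : 0 ≤ a₂) (hb₁ : 0 ≤ b₁)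
    (hb₂ : 0 ≤ b₂) (h₁ : b₁ = 0 → a₁ = 0) (h₂ : b₂ = 0 → a₂ = 0) :
    (a₁ + a₂) * Real.log ((a₁ + a₂) / (b₁ + b₂)) ≤
      a₁ * Real.log (a₁ / b₁) + a₂ * Real.log (a₂ / b₂) := by
  rcases eq_or_lt_of_le (add_nonneg ha₁ ha₂) with h | hA
  · have e₁ : a₁ = 0 := by linarith
    have e₂ : a₂ = 0 := by linarith
    simp [e₁, e₂]
  have hB : 0 < b₁ + b₂ := by
    rcases eq_or_lt_of_le (add_nonneg hb₁ hb₂) with h | h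
    · have e₁ := h₁ (by linarith)
      have e₂ := h₂ (by linarith)
      linarith
    · exact h
  have key : ∀ a b : ℝ, 0 ≤ a → 0 ≤ b → (b = 0 → a = 0) →
      a * Real.log ((a₁ + a₂) / (b₁ + b₂)) - a * Real.log (a / b) ≤
        (a₁ + a₂) * (b / (b₁ + b₂)) - a := by
    intro a b ha hb hab
    rcases eq_or_lt_of_le ha with rfl | ha
    · simp; positivity
    have hb : 0 < b := lt_of_le_of_ne hb fun h => ha.ne' (hab h.symm)
    rw [← mul_sub, ← Real.log_div (by positivity) (by positivity)]
    have := Real.log_le_sub_one_of_pos (x := (a₁ + a₂) / (b₁ + b₂) / (a / b)) (by positivity)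
    calc _ ≤ a * ((a₁ + a₂) / (b₁ + b₂) / (a / b) - 1) := mul_le_mul_of_nonneg_left this ha.le
      _ = _ := by field_simp
  have k₁ := key a₁ b₁ ha₁ hb₁ h₁
  have k₂ := key a₂ b₂ ha₂ hb₂ h₂
  have hs : b₁ / (b₁ + b₂) + b₂ / (b₁ + b₂) = 1 := by rw [← add_div, div_self hB.ne']
  nlinarith

/-- For a fixed input distribution, the mutual information is convex in the channel. -/
lemma convexOn_mutualInfo (P : X → ℝ) :
    ConvexOn ℝ (jointDist P : Set (X × Y → ℝ)) mutualInfo := by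
  refine ⟨convex_jointDist P, fun Q hQ Q' hQ' a b ha hb hab => ?_⟩
  have h0 := jointDist_nonneg hQ
  have h0' := jointDist_nonneg hQ'
  simp only [mutualInfo, smul_eq_mul, Finset.mul_sum, ← Finset.sum_add_distrib]
  refine Finset.sum_le_sum fun x _ => Finset.sum_le_sum fun y _ => ?_
  rw [(convex_jointDist P hQ hQ' ha hb hab).2, hQ.2, hQ'.2, margY_add_smul]
  simp only [Pi.add_apply, Pi.smul_apply, smul_eq_mul]
  have hP : 0 ≤ P x := by rw [← hQ.2]; exact margX_nonneg h0 x
  have key : ∀ {Q : X × Y → ℝ}, Q ∈ jointDist P → ∀ c : ℝ,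
      c * (P x * margY Q y) = 0 → c * Q (x, y) = 0 := by
    intro Q hQ c hc
    have h0 := jointDist_nonneg hQ
    rcases mul_eq_zero.1 hc with h | h
    · rw [h, zero_mul]
    rcases mul_eq_zero.1 h with h | h
    · rw [margX_eq_zero h0 (by rw [hQ.2, h]) y, mul_zero]
    · rw [margY_eq_zero h0 h x, mul_zero]
  have hlog : ∀ c s t : ℝ, c * s * Real.log (c * s / (c * t)) = c * (s * Real.log (s / t)) := by
    intro c s t
    by_cases hc : c = 0
    · simp [hc]
    · rw [mul_div_mul_left _ _ hc, mul_assoc]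
  have h := log_sum_inequality (mul_nonneg ha (h0 (x, y))) (mul_nonneg hb (h0' (x, y)))
    (mul_nonneg ha (mul_nonneg hP (margY_nonneg h0 y)))
    (mul_nonneg hb (mul_nonneg hP (margY_nonneg h0' y))) (key hQ a) (key hQ' b)
  rw [hlog, hlog] at h
  rw [mul_add, mul_left_comm (P x) a, mul_left_comm (P x) b]
  exact h

/-- The conditional divergence is strictly convex in the joint distribution. -/
lemma strictConvexOn_realDiv (W : X → Y → ℝ) (P : X → ℝ) :
    StrictConvexOn ℝ (admissible W P) (realDiv W P) := by
  refine ⟨convex_admissible W P, fun Q hQ Q' hQ' hne a b ha hb hab => ?_⟩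
  have hent : a * entropy Q + b * entropy Q' < entropy (a • Q + b • Q') := by
    simp only [entropy, Finset.mul_sum, ← Finset.sum_add_distrib]
    obtain ⟨p, hp⟩ := Function.ne_iff.1 hne
    refine Finset.sum_lt_sum (fun p _ => ?_) ⟨p, Finset.mem_univ p, ?_⟩
    · exact Real.concaveOn_negMulLog.2 (jointDist_nonneg hQ.1 p) (jointDist_nonneg hQ'.1 p)
        ha.le hb.le hab
    · exact Real.strictConcaveOn_negMulLog.2 (jointDist_nonneg hQ.1 p) (jointDist_nonneg hQ'.1 p)
        hp ha hb hab
  have hb' : b = 1 - a := by linarith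
  simp only [realDiv, realLogLik_add_smul, smul_eq_mul]
  subst hb'
  linarith

/-- The smallest required exponent for which `Q'` is a feasible competitor in the threshold at a
joint distribution with the same marginals as `Qt` is convex in the pair. -/
lemma realDiv_add_max_le {R : ℝ} {Q₁ Q₂ Qt₁ Qt₂ : X × Y → ℝ} (h₁ : Q₁ ∈ admissible W P)
    (h₂ : Q₂ ∈ admissible W P) (ht₁ : Qt₁ ∈ jointDist P) (ht₂ : Qt₂ ∈ jointDist P) {a b : ℝ}
    (ha : 0 ≤ a) (hb : 0 ≤ b) (hab : a + b = 1) :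
    realDiv W P (a • Q₁ + b • Q₂) + max (mutualInfo (a • Qt₁ + b • Qt₂) - R) 0 ≤
      a * (realDiv W P Q₁ + max (mutualInfo Qt₁ - R) 0) +
        b * (realDiv W P Q₂ + max (mutualInfo Qt₂ - R) 0) := by
  have h3 := (strictConvexOn_realDiv W P).convexOn.2 h₁ h₂ ha hb hab
  have h4 := (convexOn_mutualInfo P).2 ht₁ ht₂ ha hb hab
  simp only [smul_eq_mul] at h3 h4
  have m1 := mul_le_mul_of_nonneg_left (le_max_left (mutualInfo Qt₁ - R) 0) ha
  have m2 := mul_le_mul_of_nonneg_left (le_max_left (mutualInfo Qt₂ - R) 0) hb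
  have m3 := mul_nonneg ha (le_max_right (mutualInfo Qt₁ - R) 0)
  have m4 := mul_nonneg hb (le_max_right (mutualInfo Qt₂ - R) 0)
  have : max (mutualInfo (a • Qt₁ + b • Qt₂) - R) 0 ≤
      a * max (mutualInfo Qt₁ - R) 0 + b * max (mutualInfo Qt₂ - R) 0 := by
    refine max_le ?_ (by linarith)
    have hb' : b = 1 - a := by linarith
    subst hb'
    linarith
  linarith

end Analysis

/-! ### Rational approximation in a rational polytope -/

section RationalApproximation

/-- There are `ℚ`-linear maps `ℝ → ℚ` fixing `1` that converge pointwise to the identity: move the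
elements of a Hamel basis through `1` to nearby rational numbers. -/
lemma exists_seq_rat_linear :
    ∃ φ : ℕ → ℝ →ₗ[ℚ] ℚ, (∀ k, φ k 1 = 1) ∧
      ∀ v : ℝ, Tendsto (fun k => ((φ k v : ℚ) : ℝ)) atTop (nhds v) := by
  classical
  have hli : LinearIndepOn ℚ id ({1} : Set ℝ) := LinearIndepOn.singleton (by simp)
  let b := Module.Basis.extend hli
  have hr : ∀ (i : hli.extend (Set.subset_univ _)) (k : ℕ), ∃ q : ℚ,
      |(q : ℝ) - b i| < 1 / ((k : ℝ) + 1) ∧ (b i = 1 → q = 1) := by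
    intro i k
    have hk : (0 : ℝ) < 1 / ((k : ℝ) + 1) := by positivity
    by_cases h1 : b i = 1
    · exact ⟨1, by simpa [h1] using hk, fun _ => rfl⟩
    · obtain ⟨q, hq⟩ := exists_rat_near (b i) hk
      exact ⟨q, by rwa [abs_sub_comm], fun h => absurd h h1⟩
  choose r hr1 hr2 using hr
  have hbi : ∀ i, b i = (i : ℝ) := fun i => Module.Basis.extend_apply_self hli i
  have hmem : (1 : ℝ) ∈ hli.extend (Set.subset_univ _) :=
    hli.subset_extend (Set.subset_univ _) rfl
  refine ⟨fun k => b.constr ℚ (fun i => r i k), fun k => ?_, fun v => ?_⟩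
  · have h := b.constr_basis ℚ (fun i => r i k) ⟨1, hmem⟩
    rw [hbi] at h
    rw [h]
    exact hr2 _ _ (hbi _)
  · have hlim : ∀ i, Tendsto (fun k => ((r i k : ℚ) : ℝ)) atTop (nhds (b i)) := fun i => by
      rw [tendsto_iff_dist_tendsto_zero]
      refine squeeze_zero (fun _ => dist_nonneg) (fun k => ?_)
        tendsto_one_div_add_atTop_nhds_zero_nat
      rw [Real.dist_eq]
      exact (hr1 i k).le
    have hv : v = ∑ i ∈ (b.repr v).support, ((b.repr v i : ℚ) : ℝ) * b i := by
      conv_lhs => rw [← b.linearCombination_repr v, Finsupp.linearCombination_apply, Finsupp.sum]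
      exact Finset.sum_congr rfl fun i _ => Rat.smul_def _ _
    have hφ : ∀ k, ((b.constr ℚ (fun i => r i k) v : ℚ) : ℝ) =
        ∑ i ∈ (b.repr v).support, ((b.repr v i : ℚ) : ℝ) * ((r i k : ℚ) : ℝ) := fun k => by
      rw [Module.Basis.constr_apply, Finsupp.sum]
      simp only [smul_eq_mul]
      push_cast
      rfl
    simp only [hφ]
    conv => rhs; rw [hv]
    exact tendsto_finsetSum _ fun i _ => (hlim i).const_mul _

variable {X Y : Type*} [Fintype X] [Fintype Y] {W : X → Y → ℝ} {P : X → ℝ}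

/-- Joint distributions with a common `Y`-marginal and a common rational `X`-marginal can be
approximated simultaneously by rational ones, without enlarging the supports. -/
lemma exists_rational_approx (hP : IsRational P) :
    ∃ φ : ℕ → (X × Y → ℝ) → (X × Y → ℝ),
      (∀ k Q, IsRational (φ k Q)) ∧
      (∀ k Q p, Q p = 0 → φ k Q p = 0) ∧
      (∀ k Q Q', margY Q = margY Q' → margY (φ k Q) = margY (φ k Q')) ∧
      (∀ Q, Tendsto (fun k => φ k Q) atTop (nhds Q)) ∧
      ∀ Q ∈ jointDist P, ∀ᶠ k in atTop, φ k Q ∈ jointDist P := by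
  obtain ⟨φ, h1, hlim⟩ := exists_seq_rat_linear
  have hrat : ∀ k (q : ℚ), φ k (q : ℝ) = q := fun k q => by
    have : (q : ℝ) = q • (1 : ℝ) := by rw [Rat.smul_def, mul_one]
    rw [this, map_smul, h1, smul_eq_mul, mul_one]
  have hX : ∀ k (Q : X × Y → ℝ) x, margX (fun p => ((φ k (Q p) : ℚ) : ℝ)) x = φ k (margX Q x) := by
    intro k Q x
    simp only [margX]
    rw [map_sum]
    push_cast
    rfl
  have hY : ∀ k (Q : X × Y → ℝ) y, margY (fun p => ((φ k (Q p) : ℚ) : ℝ)) y = φ k (margY Q y) := by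
    intro k Q y
    simp only [margY]
    rw [map_sum]
    push_cast
    rfl
  refine ⟨fun k Q p => φ k (Q p), fun k Q p => ⟨_, rfl⟩, fun k Q p h => by simp [h],
    fun k Q Q' h => ?_, fun Q => tendsto_pi_nhds.2 fun p => hlim (Q p), fun Q hQ => ?_⟩
  · funext y
    rw [hY, hY, h]
  · have hpos : ∀ p, ∀ᶠ k in atTop, (0 : ℝ) ≤ φ k (Q p) := by
      intro p
      rcases eq_or_lt_of_le (jointDist_nonneg hQ p) with h | h
      · refine Eventually.of_forall fun k => ?_
        simp [← h]
      · filter_upwards [(hlim (Q p)).eventually (lt_mem_nhds h)] with k hk using hk.le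
    filter_upwards [eventually_all.2 hpos] with k hk
    refine ⟨⟨hk, ?_⟩, ?_⟩
    · have h2 : ∑ p, φ k (Q p) = 1 := by rw [← map_sum, hQ.1.2, h1]
      have h3 : ∑ p, ((φ k (Q p) : ℚ) : ℝ) = 1 := by exact_mod_cast h2
      exact h3
    · funext x
      rw [hX, hQ.2]
      obtain ⟨q, hq⟩ := hP x
      rw [hq, hrat]

end RationalApproximation

/-! ### The optimal threshold and its constraint set -/

section Threshold

variable {X Y : Type*} [Fintype X] [Fintype Y] {W : X → Y → ℝ} {P : X → ℝ} {R E : ℝ}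

/-- The joint distributions over which `gStar` minimizes; their divergence and log-likelihood are
automatically finite. -/
def feasible (W : X → Y → ℝ) (P : X → ℝ) (q : Y → ℝ) (E : ℝ) : Set (X × Y → ℝ) :=
  {Q | Q ∈ admissible W P ∧ margY Q = q ∧ realDiv W P Q ≤ E}

lemma isCompact_feasible (W : X → Y → ℝ) (P : X → ℝ) (q : Y → ℝ) (E : ℝ) :
    IsCompact (feasible W P q E) := by
  have hc : IsClosed {Q : X × Y → ℝ | margY Q = q ∧ realDiv W P Q ≤ E} :=
    (isClosed_singleton.preimage continuous_margY).inter
      (isClosed_Iic.preimage (continuous_realDiv W P))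
  exact (isCompact_admissible W P).inter_right hc

lemma gStar_le {q : Y → ℝ} {Q : X × Y → ℝ} (hQ : Q ∈ feasible W P q E) :
    gStar W P q E ≤ ((realLogLik W Q : ℝ) : EReal) := by
  rw [← logLik_of_mem_admissible hQ.1]
  refine iInf₂_le Q ⟨hQ.1.1, hQ.2.1, ?_⟩
  rw [condDiv_of_mem_admissible hQ.1]
  exact_mod_cast hQ.2.2

lemma le_gStar {q : Y → ℝ} {c : EReal}
    (h : ∀ Q ∈ feasible W P q E, c ≤ ((realLogLik W Q : ℝ) : EReal)) : c ≤ gStar W P q E := by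
  refine le_iInf₂ fun Q hQ => ?_
  obtain ⟨hQ, hm, hD⟩ := hQ
  have ha := mem_admissible_of_condDiv_lt_top hQ (hD.trans_lt (EReal.coe_lt_top E))
  rw [condDiv_of_mem_admissible ha] at hD
  rw [logLik_of_mem_admissible ha]
  exact h Q ⟨ha, hm, by exact_mod_cast hD⟩

lemma gStar_eq_top {q : Y → ℝ} (h : feasible W P q E = ∅) : gStar W P q E = ⊤ :=
  top_le_iff.1 (le_gStar fun Q hQ => by simp [h] at hQ)

lemma exists_gStar_eq {q : Y → ℝ} (h : (feasible W P q E).Nonempty) :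
    ∃ Q ∈ feasible W P q E, gStar W P q E = ((realLogLik W Q : ℝ) : EReal) ∧
      ∀ Q' ∈ feasible W P q E, realLogLik W Q ≤ realLogLik W Q' := by
  obtain ⟨Q, hQ, hmin⟩ := (isCompact_feasible W P q E).exists_isMinOn h
    (continuous_realLogLik W).continuousOn
  refine ⟨Q, hQ, le_antisymm (gStar_le hQ) (le_gStar fun Q' hQ' => ?_), fun Q' hQ' => hmin hQ'⟩
  exact_mod_cast hmin hQ'

/-- `Qt` is the joint type of the transmitted codeword, `Q` that of an erroneous one, and `Q'` is a
feasible competitor in the threshold at `Qt` whose likelihood `Q` reaches. -/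
structure IsListTriple (W : X → Y → ℝ) (P : X → ℝ) (R E : ℝ) (Qt Q Q' : X × Y → ℝ) : Prop where
  trans : Qt ∈ jointDist P
  wrong : Q ∈ admissible W P
  comp : Q' ∈ admissible W P
  marg_wrong : margY Q = margY Qt
  marg_comp : margY Q' = margY Qt
  logLik_le : realLogLik W Q' ≤ realLogLik W Q
  div_le : realDiv W P Q' + max (mutualInfo Qt - R) 0 ≤ E

lemma IsListTriple.mem_DStar {Qt Q Q' : X × Y → ℝ} (h : IsListTriple W P R E Qt Q Q') :
    Q ∈ DStar W P R E Qt := by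
  refine ⟨h.wrong.1, h.marg_wrong, ?_⟩
  rw [logLik_of_mem_admissible h.wrong]
  have hf : Q' ∈ feasible W P (margY Q) (E - max (mutualInfo Qt - R) 0) :=
    ⟨h.comp, h.marg_comp.trans h.marg_wrong.symm, by linarith [h.div_le]⟩
  exact (gStar_le hf).trans (by exact_mod_cast h.logLik_le)

lemma IsListTriple.mem_DStarStrict {Qt Q Q' : X × Y → ℝ} (h : IsListTriple W P R E Qt Q Q')
    (hlt : realLogLik W Q' < realLogLik W Q) : Q ∈ DStarStrict W P R E Qt := by
  refine ⟨h.wrong.1, h.marg_wrong, ?_⟩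
  rw [logLik_of_mem_admissible h.wrong]
  have hf : Q' ∈ feasible W P (margY Q) (E - max (mutualInfo Qt - R) 0) :=
    ⟨h.comp, h.marg_comp.trans h.marg_wrong.symm, by linarith [h.div_le]⟩
  exact (gStar_le hf).trans_lt (by exact_mod_cast hlt)

lemma exists_isListTriple_of_gStar_le {Qt Q : X × Y → ℝ} (hQt : Qt ∈ jointDist P)
    (hQ : Q ∈ jointDist P) (hm : margY Q = margY Qt)
    (hle : gStar W P (margY Q) (E - max (mutualInfo Qt - R) 0) ≤ logLik W Q) :
    ∃ Q', IsListTriple W P R E Qt Q Q' ∧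
      gStar W P (margY Q) (E - max (mutualInfo Qt - R) 0) = ((realLogLik W Q' : ℝ) : EReal) := by
  have hne : (feasible W P (margY Q) (E - max (mutualInfo Qt - R) 0)).Nonempty := by
    by_contra h
    rw [gStar_eq_top (Set.not_nonempty_iff_eq_empty.1 h), top_le_iff, logLik] at hle
    split_ifs at hle
    · exact EReal.coe_ne_top _ hle
    · exact bot_ne_top hle
  obtain ⟨Q', hQ', hg, _⟩ := exists_gStar_eq hne
  have hadm : Q ∈ admissible W P := by
    by_contra h
    rw [hg, logLik_eq_bot hQ h, le_bot_iff] at hle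
    exact EReal.coe_ne_bot _ hle
  rw [hg, logLik_of_mem_admissible hadm] at hle
  exact ⟨Q', ⟨hQt, hadm, hQ'.1, hm, hQ'.2.1.trans hm, by exact_mod_cast hle,
    by linarith [hQ'.2.2]⟩, hg⟩

lemma exists_isListTriple {Qt Q : X × Y → ℝ} (hQt : Qt ∈ jointDist P)
    (hQ : Q ∈ DStar W P R E Qt) : ∃ Q', IsListTriple W P R E Qt Q Q' :=
  (exists_isListTriple_of_gStar_le hQt hQ.1 hQ.2.1 hQ.2.2).imp fun _ h => h.1

lemma exists_isListTriple_of_strict {Qt Q : X × Y → ℝ} (hQt : Qt ∈ jointDist P)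
    (hQ : Q ∈ DStarStrict W P R E Qt) :
    ∃ Q', IsListTriple W P R E Qt Q Q' ∧ realLogLik W Q' < realLogLik W Q := by
  obtain ⟨Q', h, hg⟩ := exists_isListTriple_of_gStar_le hQt hQ.1 hQ.2.1 hQ.2.2.le
  refine ⟨Q', h, ?_⟩
  have := hQ.2.2
  rw [hg, logLik_of_mem_admissible h.wrong] at this
  exact_mod_cast this

/-- Mixtures of list triples are list triples. -/
lemma IsListTriple.mix {E₁ E₂ : ℝ} {Qt₁ Q₁ Q₁' Qt₂ Q₂ Q₂' : X × Y → ℝ}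
    (h₁ : IsListTriple W P R E₁ Qt₁ Q₁ Q₁') (h₂ : IsListTriple W P R E₂ Qt₂ Q₂ Q₂') {a b : ℝ}
    (ha : 0 ≤ a) (hb : 0 ≤ b) (hab : a + b = 1) :
    IsListTriple W P R (a * E₁ + b * E₂) (a • Qt₁ + b • Qt₂) (a • Q₁ + b • Q₂)
      (a • Q₁' + b • Q₂') where
  trans := convex_jointDist P h₁.trans h₂.trans ha hb hab
  wrong := convex_admissible W P h₁.wrong h₂.wrong ha hb hab
  comp := convex_admissible W P h₁.comp h₂.comp ha hb hab
  marg_wrong := by rw [margY_add_smul, margY_add_smul, h₁.marg_wrong, h₂.marg_wrong]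
  marg_comp := by rw [margY_add_smul, margY_add_smul, h₁.marg_comp, h₂.marg_comp]
  logLik_le := by
    rw [realLogLik_add_smul, realLogLik_add_smul]
    exact add_le_add (mul_le_mul_of_nonneg_left h₁.logLik_le ha)
      (mul_le_mul_of_nonneg_left h₂.logLik_le hb)
  div_le := (realDiv_add_max_le h₁.comp h₂.comp h₁.trans h₂.trans ha hb hab).trans
    (add_le_add (mul_le_mul_of_nonneg_left h₁.div_le ha) (mul_le_mul_of_nonneg_left h₂.div_le hb))

/-- The objective function as a real number; it is `listObjective` if `Qt` is admissible. -/
def realObjective (W : X → Y → ℝ) (P : X → ℝ) (R : ℝ) (Qt Q : X × Y → ℝ) : ℝ :=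
  realDiv W P Qt + (mutualInfo Q - R)

lemma listObjective_eq {Qt : X × Y → ℝ} (hQt : Qt ∈ admissible W P) (Q : X × Y → ℝ) :
    listObjective W P R Qt Q = ((realObjective W P R Qt Q : ℝ) : EReal) := by
  rw [listObjective, condDiv_of_mem_admissible hQt, realObjective, EReal.coe_add]

lemma listObjective_eq_top {Qt : X × Y → ℝ} (hQt : Qt ∈ jointDist P) (h : Qt ∉ admissible W P)
    (Q : X × Y → ℝ) : listObjective W P R Qt Q = ⊤ := by
  rw [listObjective, condDiv_eq_top hQt h, EReal.top_add_coe]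

lemma tendsto_realObjective {ι : Type*} {l : Filter ι} {u v : ι → X × Y → ℝ} {Qt Q : X × Y → ℝ}
    (hu : Tendsto u l (nhds Qt)) (hv : Tendsto v l (nhds Q)) (hQ : Q ∈ jointDist P)
    (hmem : ∀ᶠ i in l, v i ∈ jointDist P) :
    Tendsto (fun i => realObjective W P R (u i) (v i)) l (nhds (realObjective W P R Qt Q)) :=
  (((continuous_realDiv W P).tendsto Qt).comp hu).add
    ((tendsto_mutualInfo hv (hmem.mono fun _ h => jointDist_nonneg h)
      (jointDist_nonneg hQ)).sub_const R)

/-- Bounds for the objective function pass to limits. -/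
lemma le_realObjective_of_tendsto {ι : Type*} {l : Filter ι} [l.NeBot] {u v : ι → X × Y → ℝ}
    {Qt Q : X × Y → ℝ} {c : EReal} (hu : Tendsto u l (nhds Qt)) (hv : Tendsto v l (nhds Q))
    (hQ : Q ∈ jointDist P) (hmem : ∀ᶠ i in l, v i ∈ jointDist P)
    (hc : ∀ᶠ i in l, c ≤ ((realObjective W P R (u i) (v i) : ℝ) : EReal)) :
    c ≤ ((realObjective W P R Qt Q : ℝ) : EReal) :=
  ge_of_tendsto ((continuous_coe_real_ereal.tendsto _).comp
    (tendsto_realObjective hu hv hQ hmem)) hc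

lemma tendsto_mix (Q Q₀ : X × Y → ℝ) :
    Tendsto (fun t : ℝ => (1 - t) • Q + t • Q₀) (nhdsWithin 0 (Set.Ioi 0)) (nhds Q) := by
  have h : Continuous fun t : ℝ => (1 - t) • Q + t • Q₀ := by fun_prop
  have := h.tendsto 0
  simp only [sub_zero, one_smul, zero_smul, add_zero] at this
  exact this.mono_left nhdsWithin_le_nhds

lemma eventually_mem_Ioo : ∀ᶠ t : ℝ in nhdsWithin 0 (Set.Ioi 0), 0 < t ∧ t < 1 :=
  Ioo_mem_nhdsGT one_pos

/-- At rational distributions, a decoder that meets the requirement has thresholds at most the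
likelihood of every strictly feasible competitor. -/
lemma threshold_le_logLik (hW0 : ∀ x y, 0 ≤ W x y) (hR : 0 < R) {k : (X × Y → ℝ) → EReal}
    (hk : (E : EReal) ≤ errorExponent W P R k) {Q Q' : X × Y → ℝ} (hQ' : Q' ∈ admissible W P)
    (hQ : Q ∈ jointDist P) (hm : margY Q = margY Q') (hr' : IsRational Q') (hr : IsRational Q)
    (hlt : realDiv W P Q' + max (mutualInfo Q - R) 0 < E) :
    k Q ≤ ((realLogLik W Q' : ℝ) : EReal) := by
  by_contra h
  rw [← logLik_of_mem_admissible hQ', not_le] at h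
  have h1 := hk.trans (errorExponent_le hW0 hR hQ' hQ hm hr' hr h)
  have h2 : E ≤ realDiv W P Q' + max (mutualInfo Q - R) 0 := by exact_mod_cast h1
  linarith

lemma listExponent_le_of_rational (hW0 : ∀ x y, 0 ≤ W x y) (hR : 0 < R)
    {k : (X × Y → ℝ) → EReal} (hk : (E : EReal) ≤ errorExponent W P R k) {E' : ℝ} (hE' : E' < E)
    {Qt Q Q' : X × Y → ℝ} (h : IsListTriple W P R E' Qt Q Q') (hQt : Qt ∈ admissible W P)
    (hrt : IsRational Qt) (hr : IsRational Q) (hr' : IsRational Q') :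
    listExponent W P R k ≤ ((realObjective W P R Qt Q : ℝ) : EReal) := by
  have hmax := le_max_right (mutualInfo Qt - R) 0
  have hle : ((realLogLik W Q' : ℝ) : EReal) ≤ logLik W Q := by
    rw [logLik_of_mem_admissible h.wrong]
    exact_mod_cast h.logLik_le
  refine listExponent_le (δ := (E - realDiv W P Q') / 2) hW0 hR hQt h.wrong.1 h.marg_wrong hrt hr
    ((threshold_le_logLik hW0 hR hk h.comp h.trans h.marg_comp.symm hr' hrt
      (h.div_le.trans_lt hE')).trans hle) (by linarith [h.div_le]) ?_
  intro Q'' hQ'' hm hr'' hI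
  refine (threshold_le_logLik hW0 hR hk h.comp hQ''
    (hm.trans (h.marg_wrong.trans h.marg_comp.symm)) hr' hr'' ?_).trans hle
  have : max (mutualInfo Q'' - R) 0 ≤ (E - realDiv W P Q') / 2 :=
    max_le (by linarith) (by linarith [h.div_le])
  linarith [h.div_le]

/-- The bound passes from rational triples to triples whose likelihood comparison is stable: it is
either strict, or the likelihood is constant among the admissible distributions with the given
`Y`-marginal. In the second case the support-preserving approximation keeps the likelihoods
equal. -/
lemma listExponent_le_of_stable (hW0 : ∀ x y, 0 ≤ W x y) (hR : 0 < R) (hP : IsRational P)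
    {k : (X × Y → ℝ) → EReal} (hk : (E : EReal) ≤ errorExponent W P R k) {E' : ℝ} (hE' : E' < E)
    {Qt Q Q' : X × Y → ℝ} (h : IsListTriple W P R E' Qt Q Q') (hQt : Qt ∈ admissible W P)
    (hst : realLogLik W Q' < realLogLik W Q ∨
      ∀ Q₁ ∈ admissible W P, margY Q₁ = margY Q → realLogLik W Q₁ = realLogLik W Q) :
    listExponent W P R k ≤ ((realObjective W P R Qt Q : ℝ) : EReal) := by
  obtain ⟨φ, hrat, hsupp, hmarg, hlim, hmem⟩ := exists_rational_approx (Y := Y) hP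
  have hadm : ∀ Q ∈ admissible W P, ∀ᶠ i in atTop, φ i Q ∈ admissible W P := by
    intro Q hQ
    filter_upwards [hmem Q hQ.1] with i hi
    exact ⟨hi, fun x y hw => hsupp i Q _ (hQ.2 x y hw)⟩
  refine le_realObjective_of_tendsto (hlim Qt) (hlim Q) h.wrong.1 (hmem Q h.wrong.1) ?_
  have hlik : ∀ᶠ i in atTop, realLogLik W (φ i Q') ≤ realLogLik W (φ i Q) := by
    rcases hst with hst | hst
    · filter_upwards [(((continuous_realLogLik W).tendsto Q').comp (hlim Q')).eventually_lt
        (((continuous_realLogLik W).tendsto Q).comp (hlim Q)) hst] with i hi using hi.le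
    · filter_upwards [hadm Q h.wrong, hadm Q' h.comp] with i hi hi'
      -- `Q + ε (φ Q' - φ Q)` is admissible for small `ε` since `φ Q` vanishes off the support
      -- of `Q`, and it has the same `Y`-marginal as `Q`.
      have hv : ∀ p, ∀ᶠ t : ℝ in nhdsWithin 0 (Set.Ioi 0),
          0 ≤ (Q + t • (φ i Q' - φ i Q)) p := by
        intro p
        rcases eq_or_lt_of_le (jointDist_nonneg h.wrong.1 p) with h0 | h0
        · filter_upwards [self_mem_nhdsWithin] with t ht
          have := jointDist_nonneg hi'.1 p
          simp only [Pi.add_apply, Pi.smul_apply, Pi.sub_apply, smul_eq_mul, ← h0,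
            hsupp i Q p h0.symm, zero_add, sub_zero]
          exact mul_nonneg (le_of_lt ht) this
        · have hc : Continuous fun t : ℝ => (Q + t • (φ i Q' - φ i Q)) p := by
            simp only [Pi.add_apply, Pi.smul_apply, smul_eq_mul]
            fun_prop
          have := hc.tendsto 0
          simp only [zero_smul, add_zero] at this
          filter_upwards [(this.mono_left nhdsWithin_le_nhds).eventually (lt_mem_nhds h0)]
            with t ht using ht.le
      obtain ⟨t, ht0, htp⟩ := ((eventually_mem_Ioo).and (eventually_all.2 hv)).exists
      have e : Q + t • (φ i Q' - φ i Q) = (1 : ℝ) • Q +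
          t • ((1 : ℝ) • φ i Q' + (-1 : ℝ) • φ i Q) := by
        rw [one_smul, one_smul, neg_one_smul, ← sub_eq_add_neg]
      have hmX : margX (Q + t • (φ i Q' - φ i Q)) = P := by
        rw [e, margX_add_smul, margX_add_smul, hi.1.2, hi'.1.2, h.wrong.1.2]
        simp
      have hmY : margY (Q + t • (φ i Q' - φ i Q)) = margY Q := by
        rw [e, margY_add_smul, margY_add_smul,
          hmarg i Q' Q (h.marg_comp.trans h.marg_wrong.symm)]
        simp
      have hZ : Q + t • (φ i Q' - φ i Q) ∈ admissible W P := by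
        refine ⟨⟨⟨htp, ?_⟩, hmX⟩, fun x y hw => ?_⟩
        · rw [← h.wrong.1.1.2, Fintype.sum_prod_type, Fintype.sum_prod_type]
          exact Finset.sum_congr rfl fun x _ => congrFun (hmX.trans h.wrong.1.2.symm) x
        · simp [h.wrong.2 x y hw, hi.2 x y hw, hi'.2 x y hw]
      have hcst := hst _ hZ hmY
      rw [e, realLogLik_add_smul, realLogLik_add_smul] at hcst
      have h3 : t * (realLogLik W (φ i Q') - realLogLik W (φ i Q)) = 0 := by linarith
      have h4 := (mul_eq_zero.1 h3).resolve_left ht0.1.ne'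
      linarith
  have hdiv : ∀ᶠ i in atTop,
      realDiv W P (φ i Q') + max (mutualInfo (φ i Qt) - R) 0 < (E' + E) / 2 := by
    have hl := (((continuous_realDiv W P).tendsto Q').comp (hlim Q')).add
      (((tendsto_mutualInfo (hlim Qt) ((hmem Qt h.trans).mono fun _ h => jointDist_nonneg h)
        (jointDist_nonneg h.trans)).sub_const R).max (tendsto_const_nhds (x := (0 : ℝ))))
    exact hl.eventually (gt_mem_nhds (by linarith [h.div_le]))
  filter_upwards [hlik, hdiv, hadm Qt hQt, hadm Q h.wrong, hadm Q' h.comp] with i h1 h2 h3 h4 h5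
  exact listExponent_le_of_rational hW0 hR hk (E' := (E' + E) / 2) (by linarith)
    ⟨h3.1, h4, h5, hmarg i _ _ h.marg_wrong, hmarg i _ _ h.marg_comp, h1, h2.le⟩ h3
    (hrat i Qt) (hrat i Q) (hrat i Q')

/-- The bound for all triples with slack. If the likelihood comparison of a triple is not stable, it
is an equality and can be made strict by moving `Q` or `Q'` a little within the distributions of the
same `Y`-marginal. -/
lemma listExponent_le_of_lt (hW0 : ∀ x y, 0 ≤ W x y) (hR : 0 < R) (hP : IsRational P)
    {k : (X × Y → ℝ) → EReal} (hk : (E : EReal) ≤ errorExponent W P R k) {E' : ℝ} (hE' : E' < E)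
    {Qt Q Q' : X × Y → ℝ} (h : IsListTriple W P R E' Qt Q Q') (hQt : Qt ∈ admissible W P) :
    listExponent W P R k ≤ ((realObjective W P R Qt Q : ℝ) : EReal) := by
  by_cases hst : realLogLik W Q' < realLogLik W Q ∨
      ∀ Q₁ ∈ admissible W P, margY Q₁ = margY Q → realLogLik W Q₁ = realLogLik W Q
  · exact listExponent_le_of_stable hW0 hR hP hk hE' h hQt hst
  push Not at hst
  obtain ⟨hge, Q₁, hQ₁, hm₁, hne⟩ := hst
  have heq : realLogLik W Q' = realLogLik W Q := le_antisymm h.logLik_le hge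
  have hmix : ∀ {Q : X × Y → ℝ} {t : ℝ}, margY Q = margY Qt →
      margY ((1 - t) • Q + t • Q₁) = margY Qt := by
    intro Q t hm
    rw [margY_add_smul, hm, hm₁, h.marg_wrong, ← add_smul, sub_add_cancel, one_smul]
  rcases lt_or_gt_of_ne hne with hlt | hgt
  · have hdiv : ∀ᶠ t : ℝ in nhdsWithin 0 (Set.Ioi 0),
        realDiv W P ((1 - t) • Q' + t • Q₁) + max (mutualInfo Qt - R) 0 < (E' + E) / 2 := by
      have hl := (((continuous_realDiv W P).tendsto Q').comp (tendsto_mix Q' Q₁)).add_const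
        (max (mutualInfo Qt - R) 0)
      exact hl.eventually (gt_mem_nhds (by linarith [h.div_le]))
    obtain ⟨t, ht, hD⟩ := (eventually_mem_Ioo.and hdiv).exists
    have hlik : realLogLik W ((1 - t) • Q' + t • Q₁) < realLogLik W Q := by
      rw [realLogLik_add_smul, heq]
      nlinarith [ht.1]
    exact listExponent_le_of_stable hW0 hR hP hk (E' := (E' + E) / 2) (by linarith)
      ⟨h.trans, h.wrong, convex_admissible W P h.comp hQ₁ (by linarith) ht.1.le (by ring),
        h.marg_wrong, hmix h.marg_comp, hlik.le, hD.le⟩ hQt (Or.inl hlik)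
  · have hadm : ∀ᶠ t : ℝ in nhdsWithin 0 (Set.Ioi 0),
        (1 - t) • Q + t • Q₁ ∈ admissible W P := by
      filter_upwards [eventually_mem_Ioo] with t ht
      exact convex_admissible W P h.wrong hQ₁ (by linarith) ht.1.le (by ring)
    refine le_realObjective_of_tendsto (tendsto_const_nhds (x := Qt)) (tendsto_mix Q Q₁) h.wrong.1
      (hadm.mono fun _ h => h.1) ?_
    filter_upwards [eventually_mem_Ioo, hadm] with t ht hQ
    have hlik : realLogLik W Q' < realLogLik W ((1 - t) • Q + t • Q₁) := by
      rw [realLogLik_add_smul, heq]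
      nlinarith [ht.1]
    exact listExponent_le_of_stable hW0 hR hP hk hE'
      ⟨h.trans, hQ, h.comp, hmix h.marg_wrong, h.marg_comp, hlik.le, h.div_le⟩ hQt (Or.inl hlik)

/-- If `E` exceeds the critical exponent, then some list triple meets the divergence constraint with
slack. -/
lemma exists_strict_isListTriple (hE : criticalExponent W P R < (E : EReal)) :
    ∃ Q₀ Q₀' E₀, Q₀ ∈ admissible W P ∧ E₀ < E ∧ IsListTriple W P R E₀ Q₀ Q₀' Q₀' := by
  simp only [criticalExponent, iInf_lt_iff] at hE
  obtain ⟨Q₀, ⟨hQ₀, hfin⟩, Q₀', ⟨hQ₀', hm⟩, hlt⟩ := hE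
  have ha := mem_admissible_of_condDiv_lt_top hQ₀ hfin
  have ha' : Q₀' ∈ admissible W P := by
    by_contra hn
    rw [condDiv_eq_top hQ₀' hn, EReal.top_add_coe] at hlt
    exact not_top_lt hlt
  rw [condDiv_of_mem_admissible ha', ← EReal.coe_add, EReal.coe_lt_coe_iff] at hlt
  exact ⟨Q₀, Q₀', _, ha, hlt, ⟨hQ₀, ha', ha', hm, hm, le_rfl, le_rfl⟩⟩

/-- The existence of a list triple with admissible `Qt` forces `E` to be at least the critical
exponent. -/
lemma criticalExponent_le {Qt Q Q' : X × Y → ℝ} (h : IsListTriple W P R E Qt Q Q')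
    (hQt : Qt ∈ admissible W P) : criticalExponent W P R ≤ (E : EReal) := by
  have h1 : Qt ∈ {Q : X × Y → ℝ | Q ∈ jointDist P ∧ condDiv (condYX Q) W P < ⊤} :=
    ⟨hQt.1, by rw [condDiv_of_mem_admissible hQt]; exact EReal.coe_lt_top _⟩
  have h2 : Q' ∈ {Q' : X × Y → ℝ | Q' ∈ jointDist P ∧ margY Q' = margY Qt} :=
    ⟨h.comp.1, h.marg_comp⟩
  refine (iInf₂_le Qt h1).trans ((iInf₂_le Q' h2).trans ?_)
  rw [condDiv_of_mem_admissible h.comp, ← EReal.coe_add, EReal.coe_le_coe_iff]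
  exact h.div_le

/-- The converse: no decoder that meets the requirement has a list size exponent above the
objective function at any pair of the constraint set. -/
lemma listExponent_le_listObjective (hW0 : ∀ x y, 0 ≤ W x y) (hR : 0 < R) (hP : IsRational P)
    (hE : (E : EReal) ≠ criticalExponent W P R) {k : (X × Y → ℝ) → EReal}
    (hk : (E : EReal) ≤ errorExponent W P R k) {Qt Q : X × Y → ℝ} (hQt : Qt ∈ jointDist P)
    (hQ : Q ∈ DStar W P R E Qt) : listExponent W P R k ≤ listObjective W P R Qt Q := by
  by_cases ha : Qt ∈ admissible W P
  swap
  · rw [listObjective_eq_top hQt ha]; exact le_top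
  obtain ⟨Q', h⟩ := exists_isListTriple hQt hQ
  obtain ⟨Q₀, Q₀', E₀, hQ₀, hE₀, h₀⟩ :=
    exists_strict_isListTriple (lt_of_le_of_ne (criticalExponent_le h ha) hE.symm)
  rw [listObjective_eq ha]
  have hmix : ∀ᶠ t : ℝ in nhdsWithin 0 (Set.Ioi 0),
      (1 - t) • Qt + t • Q₀ ∈ admissible W P ∧ IsListTriple W P R ((1 - t) * E + t * E₀)
        ((1 - t) • Qt + t • Q₀) ((1 - t) • Q + t • Q₀') ((1 - t) • Q' + t • Q₀') := by
    filter_upwards [eventually_mem_Ioo] with t ht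
    exact ⟨convex_admissible W P ha hQ₀ (by linarith) ht.1.le (by ring),
      h.mix h₀ (by linarith) ht.1.le (by ring)⟩
  refine le_realObjective_of_tendsto (tendsto_mix Qt Q₀) (tendsto_mix Q Q₀') h.wrong.1
    (hmix.mono fun _ h => h.2.wrong.1) ?_
  filter_upwards [hmix, eventually_mem_Ioo] with t ht ht0
  exact listExponent_le_of_lt hW0 hR hP hk (by nlinarith [ht0.1]) ht.2 ht.1

/-- The decoder with threshold `hStar` meets the requirement. -/
lemma le_errorExponent_hStar (hW0 : ∀ x y, 0 ≤ W x y) (hR : 0 < R) :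
    (E : EReal) ≤ errorExponent W P R (hStar W P R E) := by
  refine le_errorExponent hW0 hR fun Qt hQt Q hQ hm hlt => ?_
  by_contra hD
  rw [not_le] at hD
  have hf : Qt ∈ feasible W P (margY Q) (E - max (mutualInfo Q - R) 0) :=
    ⟨hQt, hm.symm, by linarith⟩
  rw [logLik_of_mem_admissible hQt] at hlt
  exact absurd (gStar_le hf) (not_le.2 hlt)

lemma iInf_listObjective_le_listExponent (hW0 : ∀ x y, 0 ≤ W x y) (hR : 0 < R) :
    ⨅ Qt ∈ jointDist P, ⨅ Q ∈ DStar W P R E Qt, listObjective W P R Qt Q ≤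
      listExponent W P R (hStar W P R E) := by
  refine EReal.ge_of_forall_gt_iff_ge.1 fun r hr => ?_
  refine le_listExponent hW0 hR fun Qt hQt Q hQ hm hle => ?_
  have hmem : Q ∈ DStar W P R E Qt := ⟨hQ, hm, by rw [hm]; exact hle⟩
  have h1 := hr.le.trans ((iInf₂_le Qt hQt.1).trans (iInf₂_le Q hmem))
  rw [listObjective_eq hQt] at h1
  exact_mod_cast h1

/-- The minimum of the objective function is attained. -/
lemma exists_listObjective_eq_iInf (h : ∃ Qt ∈ jointDist P, (DStar W P R E Qt).Nonempty) :
    ∃ Qt ∈ jointDist P, ∃ Q ∈ DStar W P R E Qt,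
      ⨅ Qt ∈ jointDist P, ⨅ Q ∈ DStar W P R E Qt, listObjective W P R Qt Q =
        listObjective W P R Qt Q := by
  obtain ⟨Qt₀, hQt₀, Q₀, hQ₀⟩ := h
  set T : Set ((X × Y → ℝ) × (X × Y → ℝ) × (X × Y → ℝ)) :=
    {p | p.1 ∈ admissible W P ∧ IsListTriple W P R E p.1 p.2.1 p.2.2} with hT
  have hcomp : IsCompact T := by
    set K := admissible W P ×ˢ admissible W P ×ˢ admissible W P with hK
    have hKc : IsCompact K := (isCompact_admissible W P).prod
      ((isCompact_admissible W P).prod (isCompact_admissible W P))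
    have h1 : IsClosed {p : (X × Y → ℝ) × (X × Y → ℝ) × (X × Y → ℝ) | margY p.2.1 = margY p.1 ∧
        margY p.2.2 = margY p.1 ∧ realLogLik W p.2.2 ≤ realLogLik W p.2.1} := by
      have hc1 := continuous_margY.comp (continuous_fst : Continuous
        (Prod.fst : (X × Y → ℝ) × (X × Y → ℝ) × (X × Y → ℝ) → _))
      have hc2 := continuous_margY.comp (continuous_fst.comp (continuous_snd : Continuous
        (Prod.snd : (X × Y → ℝ) × (X × Y → ℝ) × (X × Y → ℝ) → _)))
      have hc3 := continuous_margY.comp (continuous_snd.comp (continuous_snd : Continuous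
        (Prod.snd : (X × Y → ℝ) × (X × Y → ℝ) × (X × Y → ℝ) → _)))
      exact (isClosed_eq hc2 hc1).inter ((isClosed_eq hc3 hc1).inter (isClosed_le
        ((continuous_realLogLik W).comp (continuous_snd.comp continuous_snd))
        ((continuous_realLogLik W).comp (continuous_fst.comp continuous_snd))))
    have h2 : ContinuousOn (fun p : (X × Y → ℝ) × (X × Y → ℝ) × (X × Y → ℝ) =>
        realDiv W P p.2.2 + max (mutualInfo p.1 - R) 0) K := by
      refine ((continuous_realDiv W P).comp
        (continuous_snd.comp continuous_snd)).continuousOn.add ?_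
      refine ContinuousOn.sup (ContinuousOn.sub ?_ continuousOn_const) continuousOn_const
      exact continuousOn_mutualInfo.comp continuous_fst.continuousOn
        fun p hp => jointDist_nonneg hp.1.1
    have h3 := (h2.preimage_isClosed_of_isClosed hKc.isClosed (isClosed_Iic (a := E))).inter h1
    have hTeq : T = (K ∩ (fun p : (X × Y → ℝ) × (X × Y → ℝ) × (X × Y → ℝ) =>
        realDiv W P p.2.2 + max (mutualInfo p.1 - R) 0) ⁻¹' Set.Iic E) ∩
        {p | margY p.2.1 = margY p.1 ∧ margY p.2.2 = margY p.1 ∧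
          realLogLik W p.2.2 ≤ realLogLik W p.2.1} := by
      ext p
      constructor
      · rintro ⟨ha, ht⟩
        exact ⟨⟨⟨ha, ht.wrong, ht.comp⟩, ht.div_le⟩, ht.marg_wrong, ht.marg_comp, ht.logLik_le⟩
      · rintro ⟨⟨⟨ha, hw, hc⟩, hd⟩, hm, hm', hl⟩
        exact ⟨ha, ha.1, hw, hc, hm, hm', hl, hd⟩
    rw [hTeq]
    exact hKc.of_isClosed_subset h3 fun p hp => hp.1.1
  rcases T.eq_empty_or_nonempty with hTe | hTn
  · -- All pairs have an infinite objective, so any of them attains the minimum.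
    have htop : ∀ Qt ∈ jointDist P, ∀ Q ∈ DStar W P R E Qt, listObjective W P R Qt Q = ⊤ := by
      intro Qt hQt Q hQ
      obtain ⟨Q', h⟩ := exists_isListTriple hQt hQ
      refine listObjective_eq_top hQt (fun ha => ?_) Q
      have : (Qt, Q, Q') ∈ T := ⟨ha, h⟩
      simp [hTe] at this
    refine ⟨Qt₀, hQt₀, Q₀, hQ₀, ?_⟩
    rw [htop Qt₀ hQt₀ Q₀ hQ₀]
    exact top_le_iff.1 (le_iInf₂ fun Qt hQt => le_iInf₂ fun Q hQ => (htop Qt hQt Q hQ).ge)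
  · have hcont : ContinuousOn (fun p : (X × Y → ℝ) × (X × Y → ℝ) × (X × Y → ℝ) =>
        realObjective W P R p.1 p.2.1) T := by
      refine ((continuous_realDiv W P).comp continuous_fst).continuousOn.add
        (ContinuousOn.sub ?_ continuousOn_const)
      exact continuousOn_mutualInfo.comp (continuous_fst.comp continuous_snd).continuousOn
        fun p hp => jointDist_nonneg hp.2.wrong.1
    obtain ⟨⟨Qt, Q, Q'⟩, ⟨ha, ht⟩, hmin⟩ := hcomp.exists_isMinOn hTn hcont
    refine ⟨Qt, ht.trans, Q, ht.mem_DStar, le_antisymm ?_ ?_⟩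
    · exact (iInf₂_le Qt ht.trans).trans (iInf₂_le Q ht.mem_DStar)
    · refine le_iInf₂ fun Qt₁ hQt₁ => le_iInf₂ fun Q₁ hQ₁ => ?_
      by_cases ha₁ : Qt₁ ∈ admissible W P
      · obtain ⟨Q₁', h₁⟩ := exists_isListTriple hQt₁ hQ₁
        rw [listObjective_eq ha, listObjective_eq ha₁]
        have := hmin (show (Qt₁, Q₁, Q₁') ∈ T from ⟨ha₁, h₁⟩)
        exact_mod_cast this
      · rw [listObjective_eq_top hQt₁ ha₁]; exact le_top

/-- Mixing a pair of the constraint set with one of the strict constraint set gives a pair of the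
strict constraint set. -/
lemma iInf_strict_le_listObjective
    (h : ∃ Qt ∈ jointDist P, (DStarStrict W P R E Qt).Nonempty ∧ condDiv (condYX Qt) W P < ⊤)
    {Qt Q : X × Y → ℝ} (hQt : Qt ∈ jointDist P) (hQ : Q ∈ DStar W P R E Qt) :
    ⨅ Qt ∈ jointDist P, ⨅ Q ∈ DStarStrict W P R E Qt, listObjective W P R Qt Q ≤
      listObjective W P R Qt Q := by
  by_cases ha : Qt ∈ admissible W P
  swap
  · rw [listObjective_eq_top hQt ha]; exact le_top
  obtain ⟨Qt₁, hQt₁, ⟨Q₁, hQ₁⟩, hfin⟩ := h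
  have ha₁ := mem_admissible_of_condDiv_lt_top hQt₁ hfin
  obtain ⟨Q', h⟩ := exists_isListTriple hQt hQ
  obtain ⟨Q₁', h₁, hlt⟩ := exists_isListTriple_of_strict hQt₁ hQ₁
  rw [listObjective_eq ha]
  have hmix : ∀ᶠ t : ℝ in nhdsWithin 0 (Set.Ioi 0),
      (1 - t) • Qt + t • Qt₁ ∈ admissible W P ∧
        (1 - t) • Q + t • Q₁ ∈ DStarStrict W P R E ((1 - t) • Qt + t • Qt₁) := by
    filter_upwards [eventually_mem_Ioo] with t ht
    refine ⟨convex_admissible W P ha ha₁ (by linarith) ht.1.le (by ring), ?_⟩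
    have hm := h.mix h₁ (a := 1 - t) (b := t) (by linarith) ht.1.le (by ring)
    have hE : (1 - t) * E + t * E = E := by ring
    rw [hE] at hm
    refine hm.mem_DStarStrict ?_
    rw [realLogLik_add_smul, realLogLik_add_smul]
    have h2 := mul_le_mul_of_nonneg_left h.logLik_le (by linarith : 0 ≤ 1 - t)
    have h3 := mul_lt_mul_of_pos_left hlt ht.1
    linarith
  refine le_realObjective_of_tendsto (tendsto_mix Qt Qt₁) (tendsto_mix Q Q₁) h.wrong.1
    (hmix.mono fun _ h => h.2.1) ?_
  filter_upwards [hmix] with t ht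
  rw [← listObjective_eq ht.1]
  exact (iInf₂_le _ ht.1.1).trans (iInf₂_le _ ht.2)

lemma mutualInfo_prod {q : Y → ℝ} (hP : P ∈ stdSimplex ℝ X) (hq : q ∈ stdSimplex ℝ Y) :
    mutualInfo (fun p : X × Y => P p.1 * q p.2) = 0 := by
  refine Finset.sum_eq_zero fun x _ => Finset.sum_eq_zero fun y _ => ?_
  have h1 : margX (fun p : X × Y => P p.1 * q p.2) x = P x := by
    simp [margX, ← Finset.mul_sum, hq.2]
  have h2 : margY (fun p : X × Y => P p.1 * q p.2) y = q y := by
    simp [margY, ← Finset.sum_mul, hP.2]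
  rw [h1, h2]
  by_cases h : P x * q y = 0
  · simp [h]
  · simp only [div_self h, Real.log_one, mul_zero]

/-- If `W` has no zero entry, the product distribution with the marginals of the channel's own
joint distribution shows that the critical exponent vanishes. -/
lemma criticalExponent_le_zero (hW : ∀ x y, 0 < W x y) (hW1 : ∀ x, ∑ y, W x y = 1)
    (hP : P ∈ stdSimplex ℝ X) (hR : 0 < R) : criticalExponent W P R ≤ 0 := by
  set Q' : X × Y → ℝ := fun p => P p.1 * W p.1 p.2 with hQ'
  have hX' : margX Q' = P := by
    funext x; simp [margX, hQ', ← Finset.mul_sum, hW1]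
  have hs' : Q' ∈ stdSimplex ℝ (X × Y) :=
    ⟨fun p => mul_nonneg (hP.1 p.1) (hW _ _).le, by
      rw [Fintype.sum_prod_type, ← hP.2]
      exact Finset.sum_congr rfl fun x _ => congrFun hX' x⟩
  have ha' : Q' ∈ admissible W P := ⟨⟨hs', hX'⟩, fun x y h => absurd h (hW x y).ne'⟩
  set q := margY Q' with hq
  have hqs : q ∈ stdSimplex ℝ Y := ⟨margY_nonneg hs'.1, by
    rw [← hs'.2, Fintype.sum_prod_type, Finset.sum_comm]; rfl⟩
  set Q : X × Y → ℝ := fun p => P p.1 * q p.2 with hQ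
  have hX : margX Q = P := by
    funext x; simp [margX, hQ, ← Finset.mul_sum, hqs.2]
  have hY : margY Q = q := by
    funext y; simp [margY, hQ, ← Finset.sum_mul, hP.2]
  have ha : Q ∈ admissible W P := ⟨⟨⟨fun p => mul_nonneg (hP.1 p.1) (hqs.1 p.2), by
      rw [Fintype.sum_prod_type, ← hP.2]
      exact Finset.sum_congr rfl fun x _ => congrFun hX x⟩, hX⟩,
    fun x y h => absurd h (hW x y).ne'⟩
  have hD : condDiv (condYX Q') W P = 0 := by
    rw [condDiv, if_pos fun x y _ h => absurd h (hW x y).ne', ← EReal.coe_zero]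
    congr 1
    refine Finset.sum_eq_zero fun x _ => ?_
    by_cases hx : P x = 0
    · rw [hx, zero_mul]
    · rw [Finset.sum_eq_zero, mul_zero]
      intro y _
      have : condYX Q' x y = W x y := by
        rw [condYX, hX', hQ']
        field_simp
      rw [this, div_self (hW x y).ne', Real.log_one, mul_zero]
  have h1 : Q ∈ {Q : X × Y → ℝ | Q ∈ jointDist P ∧ condDiv (condYX Q) W P < ⊤} :=
    ⟨ha.1, by rw [condDiv_of_mem_admissible ha]; exact EReal.coe_lt_top _⟩
  have h2 : Q' ∈ {Q' : X × Y → ℝ | Q' ∈ jointDist P ∧ margY Q' = margY Q} :=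
    ⟨ha'.1, by rw [hY]⟩
  refine (iInf₂_le Q h1).trans ((iInf₂_le Q' h2).trans ?_)
  rw [hD, mutualInfo_prod hP hqs, max_eq_right (by linarith)]
  simp

end Threshold

/-! ### Continuity of the optimal threshold -/

section Continuity

variable {X Y : Type*} [Fintype X] [Fintype Y] {W : X → Y → ℝ} {P : X → ℝ} {R E : ℝ}

/-- The joint distributions at which `hStar` is finite; it is the compact set of
`IsThresholdFunction`. -/
def finiteDomain (W : X → Y → ℝ) (P : X → ℝ) (R E : ℝ) : Set (X × Y → ℝ) :=
  {Q | Q ∈ stdSimplex ℝ (X × Y) ∧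
    (feasible W P (margY Q) (E - max (mutualInfo Q - R) 0)).Nonempty}

lemma isCompact_finiteDomain (W : X → Y → ℝ) (P : X → ℝ) (R E : ℝ) :
    IsCompact (finiteDomain W P R E) := by
  set K := stdSimplex ℝ (X × Y) ×ˢ admissible W P with hK
  have hKc : IsCompact K := (isCompact_stdSimplex ℝ _).prod (isCompact_admissible W P)
  have h1 : IsClosed {p : (X × Y → ℝ) × (X × Y → ℝ) | margY p.2 = margY p.1} :=
    isClosed_eq (continuous_margY.comp continuous_snd) (continuous_margY.comp continuous_fst)
  have h2 : ContinuousOn (fun p : (X × Y → ℝ) × (X × Y → ℝ) =>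
      realDiv W P p.2 + max (mutualInfo p.1 - R) 0) K := by
    refine ((continuous_realDiv W P).comp continuous_snd).continuousOn.add ?_
    refine ContinuousOn.sup (ContinuousOn.sub ?_ continuousOn_const) continuousOn_const
    exact continuousOn_mutualInfo.comp continuous_fst.continuousOn fun p hp => hp.1.1
  have h3 := (h2.preimage_isClosed_of_isClosed hKc.isClosed (isClosed_Iic (a := E))).inter h1
  have h4 := (hKc.of_isClosed_subset h3 fun p hp => hp.1.1).image continuous_fst
  convert h4 using 1
  ext Q
  constructor
  · rintro ⟨hQ, Q', hQ', hm, hD⟩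
    exact ⟨(Q, Q'), ⟨⟨⟨hQ, hQ'⟩, by
      change realDiv W P Q' + max (mutualInfo Q - R) 0 ≤ E
      linarith⟩, hm⟩, rfl⟩
  · rintro ⟨⟨Q, Q'⟩, ⟨⟨⟨hQ, hQ'⟩, hD⟩, hm⟩, rfl⟩
    refine ⟨hQ, Q', hQ', hm, ?_⟩
    change realDiv W P Q' + max (mutualInfo Q - R) 0 ≤ E at hD
    linarith

/-- A limit of minimizers of the likelihood is a minimizer. If the limit `a` could be improved to
`b`, then `z i + (b - a) / 2` would eventually improve the minimizers `z i`: it is non-negative in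
the limit, and strict convexity of the divergence leaves room in the divergence constraint. -/
lemma realLogLik_le_of_tendsto {u z : ℕ → X × Y → ℝ} {Q a b : X × Y → ℝ}
    (hu : ∀ i, u i ∈ stdSimplex ℝ (X × Y)) (hQ : Q ∈ stdSimplex ℝ (X × Y))
    (hlu : Tendsto u atTop (nhds Q)) (hlz : Tendsto z atTop (nhds a))
    (hz : ∀ i, z i ∈ feasible W P (margY (u i)) (E - max (mutualInfo (u i) - R) 0))
    (hmin : ∀ i, ∀ Q' ∈ feasible W P (margY (u i)) (E - max (mutualInfo (u i) - R) 0),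
      realLogLik W (z i) ≤ realLogLik W Q')
    (hb : b ∈ feasible W P (margY Q) (E - max (mutualInfo Q - R) 0)) :
    a ∈ feasible W P (margY Q) (E - max (mutualInfo Q - R) 0) ∧
      realLogLik W a ≤ realLogLik W b := by
  have hI : Tendsto (fun i => E - max (mutualInfo (u i) - R) 0) atTop
      (nhds (E - max (mutualInfo Q - R) 0)) :=
    tendsto_const_nhds.sub (((tendsto_mutualInfo hlu
      (Eventually.of_forall fun i => (hu i).1) hQ.1).sub_const R).max tendsto_const_nhds)
  have ha : a ∈ feasible W P (margY Q) (E - max (mutualInfo Q - R) 0) := by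
    refine ⟨(isCompact_admissible W P).isClosed.mem_of_tendsto hlz
      (Eventually.of_forall fun i => (hz i).1), ?_, ?_⟩
    · refine tendsto_nhds_unique ((continuous_margY.tendsto a).comp hlz) ?_
      refine ((continuous_margY.tendsto Q).comp hlu).congr fun i => ?_
      exact (hz i).2.1.symm
    · exact le_of_tendsto_of_tendsto' (((continuous_realDiv W P).tendsto a).comp hlz) hI
        fun i => (hz i).2.2
  refine ⟨ha, ?_⟩
  by_contra hlt
  rw [not_le] at hlt
  have hne : a ≠ b := fun h => by rw [h] at hlt; exact lt_irrefl _ hlt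
  set v : X × Y → ℝ := (1 / 2 : ℝ) • b + (-(1 / 2) : ℝ) • a with hv
  have hZ : a + v = (1 / 2 : ℝ) • a + (1 / 2 : ℝ) • b := by
    rw [hv]; module
  have hlim : Tendsto (fun i => z i + v) atTop (nhds (a + v)) := hlz.add_const v
  have e : ∀ i, z i + v = (1 : ℝ) • z i + (1 : ℝ) • v := fun i => by rw [one_smul, one_smul]
  have hvX : margX v = 0 := by
    rw [hv, margX_add_smul, ha.1.1.2, hb.1.1.2]; module
  have hvY : margY v = 0 := by
    rw [hv, margY_add_smul, ha.2.1, hb.2.1]; module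
  have hmX : ∀ i, margX (z i + v) = P := fun i => by
    rw [e, margX_add_smul, hvX, (hz i).1.1.2]; simp
  have hmY : ∀ i, margY (z i + v) = margY (u i) := fun i => by
    rw [e, margY_add_smul, hvY, (hz i).2.1]; simp
  have hpos : ∀ p, ∀ᶠ i in atTop, 0 ≤ (z i + v) p := by
    intro p
    have ha0 := jointDist_nonneg ha.1.1 p
    have hb0 := jointDist_nonneg hb.1.1 p
    have hZp : (a + v) p = 1 / 2 * a p + 1 / 2 * b p := by rw [hZ]; simp
    rcases eq_or_lt_of_le (show 0 ≤ (a + v) p by rw [hZp]; positivity) with h0 | h0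
    · have h1 : a p = 0 := by linarith
      have h2 : b p = 0 := by linarith
      refine Eventually.of_forall fun i => ?_
      have := jointDist_nonneg (hz i).1.1 p
      simpa [hv, h1, h2] using this
    · filter_upwards [((continuous_apply p).tendsto _).comp hlim |>.eventually (lt_mem_nhds h0)]
        with i hi using hi.le
  have hD : realDiv W P (a + v) < E - max (mutualInfo Q - R) 0 := by
    have h1 : realDiv W P ((1 / 2 : ℝ) • a + (1 / 2 : ℝ) • b) <
        (1 / 2 : ℝ) * realDiv W P a + (1 / 2 : ℝ) * realDiv W P b :=
      (strictConvexOn_realDiv W P).2 ha.1 hb.1 hne (by norm_num) (by norm_num) (by norm_num)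
    rw [← hZ] at h1
    linarith [ha.2.2, hb.2.2]
  have hDe := (((continuous_realDiv W P).tendsto _).comp hlim).eventually_lt hI hD
  obtain ⟨i, hip, hiD⟩ := ((eventually_all.2 hpos).and hDe).exists
  have hfeas : z i + v ∈ feasible W P (margY (u i)) (E - max (mutualInfo (u i) - R) 0) := by
    refine ⟨⟨⟨⟨hip, ?_⟩, hmX i⟩, fun x y hw => ?_⟩, hmY i, hiD.le⟩
    · rw [← (hz i).1.1.1.2, Fintype.sum_prod_type, Fintype.sum_prod_type]
      exact Finset.sum_congr rfl fun x _ => congrFun ((hmX i).trans (hz i).1.1.2.symm) x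
    · simp [hv, (hz i).1.2 x y hw, ha.1.2 x y hw, hb.1.2 x y hw]
  have h1 := hmin i _ hfeas
  rw [e, realLogLik_add_smul, hv, realLogLik_add_smul] at h1
  linarith

lemma isThresholdFunction_hStar (W : X → Y → ℝ) (P : X → ℝ) (R E : ℝ) :
    IsThresholdFunction (hStar W P R E) := by
  refine ⟨finiteDomain W P R E, fun _ h => h.1, isCompact_finiteDomain W P R E,
    ⟨fun Q => (hStar W P R E Q).toReal, ?_, ?_⟩, ?_⟩
  · choose m hm hval hmin using fun Q : finiteDomain W P R E => exists_gStar_eq Q.2.2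
    have hreal : ∀ Q : finiteDomain W P R E,
        (hStar W P R E Q).toReal = realLogLik W (m Q) := fun Q => by
      rw [hStar, hval, EReal.toReal_coe]
    rw [continuousOn_iff_continuous_domRestrict, continuous_iff_continuousAt]
    intro Q
    refine tendsto_of_subseq_tendsto fun s hs => ?_
    obtain ⟨a, _, φ, hφ, hlim⟩ :=
      (isCompact_admissible W P).tendsto_subseq (x := fun i => m (s i)) fun i => (hm (s i)).1
    refine ⟨φ, ?_⟩
    have hlu : Tendsto (fun i => (s (φ i) : X × Y → ℝ)) atTop (nhds Q) :=
      (continuous_subtype_val.tendsto Q).comp (hs.comp hφ.tendsto_atTop)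
    have key := realLogLik_le_of_tendsto (fun i => (s (φ i)).2.1) Q.2.1 hlu hlim
      (fun i => hm (s (φ i))) (fun i => hmin (s (φ i))) (hm Q)
    have heq : realLogLik W a = realLogLik W (m Q) := le_antisymm key.2 (hmin Q a key.1)
    simp only [Set.domRestrict_apply, hreal]
    rw [← heq]
    exact ((continuous_realLogLik W).tendsto a).comp hlim
  · intro Q hQ
    obtain ⟨Q', _, hval, _⟩ := exists_gStar_eq hQ.2
    simp only [hStar, hval, EReal.toReal_coe]
  · intro Q hQ hn
    refine gStar_eq_top (Set.not_nonempty_iff_eq_empty.1 fun h => hn ⟨hQ, h⟩)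

end Continuity

end

end ThresholdDecoding

open ThresholdDecoding in
theorem theorem3 {X Y : Type*} [Fintype X] [Fintype Y]
    (W : X → Y → ℝ) (hW0 : ∀ x y, 0 ≤ W x y) (hW1 : ∀ x, ∑ y, W x y = 1)
    (P : X → ℝ) (hP : ∃ n : ℕ, 0 < n ∧ (typeClass P n).Nonempty)
    (R : ℝ) (hR : 0 < R) (E : ℝ)
    (hE : (0 < E ∧ ∀ x y, 0 < W x y) ∨ (E : EReal) ≠ criticalExponent W P R) :
    IsOptimalThreshold W P R E (hStar W P R E) ∧
    (listExponent W P R (hStar W P R E) =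
      ⨅ Qt ∈ jointDist P, ⨅ Q ∈ DStar W P R E Qt, listObjective W P R Qt Q) ∧
    ((∃ Qt ∈ jointDist P, (DStar W P R E Qt).Nonempty) →
      ∃ Qt ∈ jointDist P, ∃ Q ∈ DStar W P R E Qt,
        listExponent W P R (hStar W P R E) = listObjective W P R Qt Q) ∧
    ((∃ Qt ∈ jointDist P, (DStarStrict W P R E Qt).Nonempty ∧ condDiv (condYX Qt) W P < ⊤) →
      listExponent W P R (hStar W P R E) =
        ⨅ Qt ∈ jointDist P, ⨅ Q ∈ DStarStrict W P R E Qt, listObjective W P R Qt Q) := by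
  obtain ⟨n, hn, x, hx⟩ := hP
  have hxP := mem_typeClass.1 hx
  have hPr : IsRational P := hxP ▸ isRational_empirical x
  have hPs : P ∈ stdSimplex ℝ X := hxP ▸ empirical_mem_stdSimplex hn x
  have hE' : (E : EReal) ≠ criticalExponent W P R := by
    rcases hE with ⟨hE, hW⟩ | hE
    · refine ((criticalExponent_le_zero hW hW1 hPs hR).trans_lt ?_).ne'
      exact_mod_cast hE
    · exact hE
  have herr : (E : EReal) ≤ errorExponent W P R (hStar W P R E) := le_errorExponent_hStar hW0 hR
  have hconv : ∀ k : (X × Y → ℝ) → EReal, (E : EReal) ≤ errorExponent W P R k →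
      listExponent W P R k ≤ ⨅ Qt ∈ jointDist P, ⨅ Q ∈ DStar W P R E Qt, listObjective W P R Qt Q :=
    fun k hk => le_iInf₂ fun Qt hQt => le_iInf₂ fun Q hQ =>
      listExponent_le_listObjective hW0 hR hPr hE' hk hQt hQ
  have hform := le_antisymm (hconv _ herr) (iInf_listObjective_le_listExponent hW0 hR)
  refine ⟨⟨isThresholdFunction_hStar W P R E, herr, fun k _ hk => ?_⟩, hform, fun h => ?_,
    fun h => ?_⟩
  · rw [hform]; exact hconv k hk
  · rw [hform]; exact exists_listObjective_eq_iInf h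
  · rw [hform]
    refine le_antisymm ?_ (le_iInf₂ fun Qt hQt => le_iInf₂ fun Q hQ =>
      iInf_strict_le_listObjective h hQt hQ)
    refine le_iInf₂ fun Qt hQt => le_iInf₂ fun Q hQ => ?_
    exact (iInf₂_le Qt hQt).trans (iInf₂_le Q ⟨hQ.1, hQ.2.1, hQ.2.2.le⟩)
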